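/- **Notation.** Let $p,n\in\mathbb N=\{0,1,2,\dots\}$. For a multiindex $\alpha\in\mathbb N^n$ put $|\alpha|=\sum\alpha_i$, $\alpha!=\prod\alpha_i!$. Let $\mathcal P_p$ be the space of polynomials of degree at most $p$ on $\mathbb R^n$ and $\mathcal P_p^*$ its dual, with its usual topology. For $\eta\in\mathcal P_p^*$, $b\in\mathbb R^n$, $|\alpha|\le p$ put $\eta_\alpha(b)=\eta\big(\tfrac1{\alpha!}(x-b)^\alpha\big)$, and let $\delta_a\in\mathcal P_p^*$ be $\delta_a(P)=P(a)$. Let $X\subset\mathbb R^n$, and let $W$ be either $\mathcal P_p^*$ or $\mathcal P_p^*\times\mathbb R$; for $w\in W$ let $\mathrm{pr}(w)\in\mathcal P_p^*$ be $w$ itself, respectively its first component. For a bundle $\Phi\subset X\times W$ of linear subspaces $\Phi_a\subset W$, $a\in X$, let $$\Delta\Phi=\{(a,b,v+w):\ a,b\in X,\ v\in\Phi_a,\ w\in\Phi_b,\ |a-b|^{p-|\alpha|}\,|\mathrm{pr}(w)_\alpha(b)|\le 1\ \text{for all}\ |\alpha|\le p\},$$ $$\Phi'_a=\{w\in W:\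 (a,a,w)\in\overline{\Delta\Phi}\},\qquad \rho(\Phi)=\bigcup_{a\in X}\{a\}\times\operatorname{Span}\Phi'_a,\qquad \widehat\Phi=\rho^{2\dim W}(\Phi).$$ The *paratangent bundle of order $p$* of $X$ is $\tau^p(X)=\widehat E$ with $E=\{(a,\lambda\delta_a):a\in X,\lambda\in\mathbb R\}\subset X\times\mathcal P_p^*$. For $f:X\to\mathbb R$ let $\nabla^pf=\widehat\Phi$ with $\Phi=\{(a,\lambda\delta_a,\lambda f(a)):a\in X,\lambda\in\mathbb R\}\subset X\times\mathcal P_p^*\times\mathbb R$. We write $\nabla^pf:\tau^p(X)\to\mathbb R$ if $\nabla^pf$ is the graph of a function $\tau^p(X)\to\mathbb R$. A $\mathcal C^p$ *submanifold* of $\mathbb R^n$ is a subset $M$ that near each of its points is carried to a coordinate subspace $\mathbb R^m\times\{0\}$ by a $\mathcal C^p$ diffeomorphism between open subsets of $\mathbb R^n$ (a homeomorphism if $p=0$; $m$ may depend on the point). A family $F=(F^\alpha)_{|\alpha|\le p}$ of functions $X\to\mathbb R$ is a $\mathcal C^p$ *Whitney field* on $X$ if for all $|\alpha|\le p$ and $c\in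 X$ $$\frac{F^\alpha(b)-\sum_{|\beta|\le p-|\alpha|}\frac1{\beta!}F^{\alpha+\beta}(a)(b-a)^\beta}{|b-a|^{p-|\alpha|}}\to0\quad\text{as } a,b\to c,\ a,b\in X,\ a\ne b.$$ **Theorem.** Let $X\subset U\subset\mathbb R^n$, where $U$ is open and $X$ is closed in $U$. 1. Suppose that $X\subset M$, where $M$ is a $\mathcal C^p$ submanifold of $\mathbb R^n$, and that $X$ is the closure in $M$ of its interior in $M$. (In particular this applies if $M$ is a closed $\mathcal C^p$ submanifold of $U$; then $X$ is automatically closed in $U$.) Then, for every $f:X\to\mathbb R$, $f$ is the restriction of a function of class $\mathcal C^p$ on $U$ if and only if $\nabla^pf:\tau^p(X)\to\mathbb R$. 2. Suppose that $X$ is the closure in $U$ of its interior. Then $\tau^p(X)=X\times\mathcal P_p^*$. Moreover, if $f:X\to\mathbb R$ and $\nabla^pf:\tau^p(X)\to\mathbb R$, then there is a $\mathcal C^p$ Whitney field $F=(F^\alpha)_{|\alpha|\le p}$ on $X$ with $F^0=f$. -/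

import Mathlib

open Filter Topology

/-- Euclidean space `ℝⁿ`. -/
abbrev Euc (n : ℕ) : Type := EuclideanSpace ℝ (Fin n)

/-- The length `|α| = α₁ + ⋯ + αₙ` of a multiindex. -/
def miLen {n : ℕ} (α : Fin n → ℕ) : ℕ := ∑ i, α i

/-- The factorial `α! = α₁! ⋯ αₙ!` of a multiindex. -/
def miFact {n : ℕ} (α : Fin n → ℕ) : ℕ := ∏ i, (α i).factorial

/-- The finite set of the multiindices `α` with `|α| ≤ k`. -/
def miLE (n k : ℕ) : Finset (Fin n → ℕ) :=
  (Fintype.piFinset fun _ : Fin n => Finset.range (k + 1)).filter fun α => miLen α ≤ k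

/-- `miLE n k` contains exactly the multiindices of length at most `k`. -/
theorem mem_miLE {n k : ℕ} {α : Fin n → ℕ} : α ∈ miLE n k ↔ miLen α ≤ k := by
  simp only [miLE, Finset.mem_filter, Fintype.mem_piFinset, Finset.mem_range,
    and_iff_right_iff_imp]
  intro h i
  have h1 : α i ≤ miLen α := Finset.single_le_sum (fun j _ => Nat.zero_le (α j)) (Finset.mem_univ i)
  omega

/-- The space `𝒫_p(ℝⁿ)` of polynomials of degree at most `p` on `ℝⁿ`. -/
noncomputable abbrev PolyLE (n p : ℕ) : Submodule ℝ (MvPolynomial (Fin n) ℝ) :=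
  MvPolynomial.restrictTotalDegree (Fin n) ℝ p

/-- The dual space `𝒫_p^*`. -/
abbrev PolyDual (n p : ℕ) : Type := Module.Dual ℝ (PolyLE n p)

/-- The topology of the finite-dimensional space `𝒫_p^*`:
`ξ_j → ξ` if and only if `ξ_j(P) → ξ(P)` for every `P`. -/
noncomputable instance polyDualTopology (n p : ℕ) : TopologicalSpace (PolyDual n p) :=
  TopologicalSpace.induced (fun (ξ : PolyDual n p) (P : PolyLE n p) => ξ P) Pi.topologicalSpace

/-- The polynomial `(x - a)^α / α!`. -/
noncomputable def taylorMonomial {n : ℕ} (a : Euc n) (α : Fin n → ℕ) :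
    MvPolynomial (Fin n) ℝ :=
  MvPolynomial.C ((miFact α : ℝ)⁻¹) *
    ∏ i, (MvPolynomial.X i - MvPolynomial.C (a i)) ^ α i

/-- `(x - a)^α / α!` has degree at most `p` if `|α| ≤ p`. -/
theorem taylorMonomial_mem {n p : ℕ} (a : Euc n) {α : Fin n → ℕ} (hα : miLen α ≤ p) :
    taylorMonomial a α ∈ PolyLE n p := by
  rw [MvPolynomial.mem_restrictTotalDegree]
  refine le_trans ?_ hα
  refine (MvPolynomial.totalDegree_mul _ _).trans ?_
  rw [MvPolynomial.totalDegree_C, zero_add]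
  refine (MvPolynomial.totalDegree_finsetProd _ _).trans ?_
  refine Finset.sum_le_sum fun i _ => ?_
  refine (MvPolynomial.totalDegree_pow _ _).trans ?_
  have h : (MvPolynomial.X i - MvPolynomial.C (a i) : MvPolynomial (Fin n) ℝ).totalDegree ≤ 1 := by
    refine (MvPolynomial.totalDegree_sub _ _).trans ?_
    simp
  calc α i * _ ≤ α i * 1 := Nat.mul_le_mul_left _ h
    _ = α i := Nat.mul_one _

/-- The number `ξ_α(a) = ξ((x - a)^α / α!)`, for `|α| ≤ p`. -/
noncomputable def dualCoeff {n p : ℕ} (ξ : PolyDual n p) (a : Euc n) (α : Fin n → ℕ)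
    (hα : miLen α ≤ p) : ℝ :=
  ξ ⟨taylorMonomial a α, taylorMonomial_mem a hα⟩

/-- The delta function `δ_a ∈ 𝒫_p^*`, `δ_a(P) = P(a)`. -/
noncomputable def deltaDual {n p : ℕ} (a : Euc n) : PolyDual n p where
  toFun P := MvPolynomial.eval (fun i => a i) (P : MvPolynomial (Fin n) ℝ)
  map_add' P Q := by simp
  map_smul' c P := by simp

/-!
Bundles of linear subspaces of a vector space `W` over `X ⊆ ℝⁿ` are subsets of `ℝⁿ × W` that lie
over `X`. The constructions are made for a space `W` with a linear map `pr : W → 𝒫_p^*`; they are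
used for `W = 𝒫_p^*` with the identity and for `W = 𝒫_p^* × ℝ` with the first projection.
-/

/-- `ΔΦ`, the set of all `(a, b, v + w)` with `a, b ∈ X`, `v ∈ Φ_a`, `w ∈ Φ_b` and
`|a - b|^(p - |α|) |η_α(b)| ≤ 1` for all `|α| ≤ p`, where `η = pr w`. -/
def bundleDelta {n p : ℕ} {W : Type*} [AddCommGroup W] [Module ℝ W] (pr : W →ₗ[ℝ] PolyDual n p)
    (X : Set (Euc n)) (Φ : Set (Euc n × W)) : Set (Euc n × Euc n × W) :=
  {q | ∃ a ∈ X, ∃ b ∈ X, ∃ v w : W, (a, v) ∈ Φ ∧ (b, w) ∈ Φ ∧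
    (∀ (α : Fin n → ℕ) (hα : miLen α ≤ p),
      ‖a - b‖ ^ (p - miLen α) * |dualCoeff (pr w) b α hα| ≤ 1) ∧
    q = (a, b, v + w)}

/-- `Φ'`, the set of all `(a, w)` with `a ∈ X` such that `(a, a, w)` lies in the closure
of `ΔΦ`. -/
def bundlePrime {n p : ℕ} {W : Type*} [AddCommGroup W] [Module ℝ W] [TopologicalSpace W]
    (pr : W →ₗ[ℝ] PolyDual n p) (X : Set (Euc n)) (Φ : Set (Euc n × W)) : Set (Euc n × W) :=
  {q | q.1 ∈ X ∧ (q.1, q.1, q.2) ∈ closure (bundleDelta pr X Φ)}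

/-- The Glaeser operation `ρ(Φ)`, whose fibre over `a ∈ X` is the linear span of `Φ'_a`. -/
def glaeserOp {n p : ℕ} {W : Type*} [AddCommGroup W] [Module ℝ W] [TopologicalSpace W]
    (pr : W →ₗ[ℝ] PolyDual n p) (X : Set (Euc n)) (Φ : Set (Euc n × W)) : Set (Euc n × W) :=
  {q | q.1 ∈ X ∧ q.2 ∈ Submodule.span ℝ {w : W | (q.1, w) ∈ bundlePrime pr X Φ}}

/-- The saturation `ρ^(2r)(Φ)`, `r = dim W`, of a bundle with respect to the operation `ρ`. -/
noncomputable def saturation {n p : ℕ} {W : Type*} [AddCommGroup W] [Module ℝ W]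
    [TopologicalSpace W] (pr : W →ₗ[ℝ] PolyDual n p) (X : Set (Euc n)) (Φ : Set (Euc n × W)) :
    Set (Euc n × W) :=
  (glaeserOp pr X)^[2 * Module.finrank ℝ W] Φ

/-- The paratangent bundle `τ^p(X) ⊆ X × 𝒫_p^*` of order `p`: the saturation of
`{(a, λ δ_a) : a ∈ X, λ ∈ ℝ}`. -/
noncomputable def paratangentBundle {n : ℕ} (p : ℕ) (X : Set (Euc n)) :
    Set (Euc n × PolyDual n p) :=
  saturation LinearMap.id X {q | q.1 ∈ X ∧ ∃ t : ℝ, q.2 = t • deltaDual q.1}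

/-- The bundle `∇^p f ⊆ X × 𝒫_p^* × ℝ`: the saturation of
`{(a, λ δ_a, λ f(a)) : a ∈ X, λ ∈ ℝ}`. -/
noncomputable def nablaBundle {n : ℕ} (p : ℕ) {X : Set (Euc n)} (f : X → ℝ) :
    Set (Euc n × (PolyDual n p × ℝ)) :=
  saturation (LinearMap.fst ℝ (PolyDual n p) ℝ) X
    {q | ∃ (a : X) (t : ℝ), q = ((a : Euc n), t • deltaDual (a : Euc n), t * f a)}

/-- The assertion `∇^p f : τ^p(X) → ℝ`: the bundle `∇^p f` is the graph of a function
defined on `τ^p(X)`. -/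
def NablaIsFunction {n : ℕ} (p : ℕ) {X : Set (Euc n)} (f : X → ℝ) : Prop :=
  ∃ g : paratangentBundle p X → ℝ,
    nablaBundle p f = {q | ∃ e : paratangentBundle p X, q = (e.1.1, e.1.2, g e)}

/-- `M` is a `𝒞^p` submanifold of `ℝⁿ`: around each of its points there is a local `𝒞^p`
diffeomorphism `σ` between open subsets of `ℝⁿ` (a homeomorphism if `p = 0`) that takes `M` to a
coordinate subspace `ℝ^m × {0}`. -/
def IsCpSubmanifold {n : ℕ} (p : ℕ) (M : Set (Euc n)) : Prop :=
  ∀ a ∈ M, ∃ m ≤ n, ∃ σ : OpenPartialHomeomorph (Euc n) (Euc n),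
    a ∈ σ.source ∧ ContDiffOn ℝ p σ σ.source ∧ ContDiffOn ℝ p σ.symm σ.target ∧
    ∀ x ∈ σ.source, (x ∈ M ↔ ∀ i : Fin n, m ≤ (i : ℕ) → σ x i = 0)

/-- `X` is the closure of its interior in `M` (both operations in the subspace topology
of `M`). -/
def IsClosureOfInteriorIn {n : ℕ} (X M : Set (Euc n)) : Prop :=
  X ⊆ M ∧ (Subtype.val ⁻¹' X : Set M) = closure (interior (Subtype.val ⁻¹' X : Set M))

/-- `f` is the restriction to `X` of a function of class `𝒞^p` on the open set `U`. -/
def ExtendsCp {n : ℕ} (p : ℕ) (U : Set (Euc n)) {X : Set (Euc n)} (f : X → ℝ) : Prop :=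
  ∃ F : Euc n → ℝ, ContDiffOn ℝ p F U ∧ ∀ x : X, F x = f x

/-- The Taylor remainder
`(R^p_a F)^α(b) = F^α(b) - ∑_{|β| ≤ p - |α|} F^{α+β}(a) (b - a)^β / β!`. -/
noncomputable def whitneyRemainder {n : ℕ} (p : ℕ) {X : Set (Euc n)}
    (F : (Fin n → ℕ) → X → ℝ) (α : Fin n → ℕ) (a b : X) : ℝ :=
  F α b - ∑ β ∈ miLE n (p - miLen α),
    (miFact β : ℝ)⁻¹ * F (α + β) a * ∏ i, ((b : Euc n) i - (a : Euc n) i) ^ β i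

/-- `F = (F^α)_{|α| ≤ p}` is a `𝒞^p` Whitney field on `X`: for all `|α| ≤ p` and `c ∈ X`,
`(R^p_a F)^α(b) / |b - a|^(p - |α|) → 0` as `a, b → c` in `X`, `a ≠ b`.
The values of `F^α` for `|α| > p` play no role. -/
def IsWhitneyField {n : ℕ} (p : ℕ) {X : Set (Euc n)} (F : (Fin n → ℕ) → X → ℝ) : Prop :=
  ∀ α : Fin n → ℕ, miLen α ≤ p → ∀ c : X,
    Tendsto (fun q : X × X =>
        whitneyRemainder p F α q.1 q.2 / ‖(q.2 : Euc n) - (q.1 : Euc n)‖ ^ (p - miLen α))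
      (𝓝[{q : X × X | q.1 ≠ q.2}] (c, c)) (𝓝 0)

/-! Necessity. Let T_a be the Taylor polynomial at a of a C^p extension of f. For v over a and w
over b, v(T_a) + w(T_b) = (v + w)(T_a) + w(T_b - T_a), and by Taylor's formula at b the last term is
the sum over α of D^α(T_b - T_a)(b) · w_α(b). Whitney's condition makes the derivative o(|a - b|^(p
- |α|)), and the bound in ΔΦ is exactly what makes the product tend to zero
(`CompatibleAt.tendsto_add`). Hence the Glaeser operation commutes with passing to the graph ξ ↦ (ξ,
ξ(T_a)) (`glaeserFibre_map_graphMap`), and every iterate of the bundle of f is the graph over the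
corresponding iterate for X. The two saturations use different numbers of iterations; this is
harmless because the iterates are stationary (`glaeserFibre_iterate_eq_of_le`).

Sufficiency. A fibre of ∇^p f that is a graph is the graph of evaluation at some polynomial Q(a)
(`NablaIsFunction.exists_polynomial`). Let φ : E → ℝⁿ be a C^p parametrization and Y ⊆ φ⁻¹(X) a set
contained in the closure of its interior. The functionals P ↦ D^k(P ∘ φ)(y)(v), k ≤ p, lie in τ^p(X)
over φ(y): inside Y they arise from those of lower order as limits of difference quotients, which
the Glaeser operation admits, and at the other points of Y they are limits of interior ones
(`jetDual_mem_paratangentFibre`).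

Let T_a be the Taylor polynomial of Q(φ(a)) ∘ φ at a in Y. If these polynomials violated Whitney's
condition at order k, then there would be a, b → c and vectors v with |D| > ε |b - a|^(p - k) ∏
|v_i|, where D = D^k(T_b - T_a)(b)(v). Consider the k-th jet functional at b minus the functional
"k-th derivative at b of the Taylor polynomial at a", divided by D. On a fixed polynomial P it is a
Taylor remainder of P ∘ φ divided by D, so it tends to 0; on the field Q it takes the value 1. Its
summand over φ(b) meets the bounds of ΔΦ up to a constant. Therefore (0, 1) lies in ∇^p f, which no
graph of a linear function allows (`eventually_norm_iteratedFDeriv_sub_le_of_nabla`). Whitney's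
extension theorem now extends f ∘ φ from E; composing with the chart gives local extensions of f,
and a partition of unity on U glues them.

In part 2 take φ = id: the jet functionals at a span the whole dual, and T_a is Q(a) itself, so the
derivatives of Q(a) at a form the Whitney field. -/

/-! ### Taylor polynomials and remainder estimates in normed spaces -/

section Taylor

variable {E F : Type*} [NormedAddCommGroup E] [NormedSpace ℝ E]
  [NormedAddCommGroup F] [NormedSpace ℝ F]

/-- Mean value inequality of higher order along a segment. -/
theorem norm_iteratedFDeriv_le_sum_segment {h : E → F} {p : ℕ} (hh : ContDiff ℝ p h) {b : E}
    {S : ℝ} (q : ℕ) : ∀ (k : ℕ), k + q = p → ∀ x : E,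
      (∀ z ∈ segment ℝ b x, ‖iteratedFDeriv ℝ p h z‖ ≤ S) →
      ‖iteratedFDeriv ℝ k h x‖ ≤
        ∑ j ∈ Finset.range q, ‖iteratedFDeriv ℝ (k + j) h b‖ * ‖x - b‖ ^ j + S * ‖x - b‖ ^ q := by
  induction q with
  | zero =>
    intro k hk x hS
    obtain rfl : k = p := by omega
    simpa using hS x (right_mem_segment ℝ b x)
  | succ q ih =>
    intro k hk x hS
    have hS0 : 0 ≤ S := (norm_nonneg _).trans (hS x (right_mem_segment ℝ b x))
    -- The induction hypothesis at order k + 1, made uniform on the segment by replacing ‖z - b‖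
    -- with ‖x - b‖.
    set C : ℝ := ∑ j ∈ Finset.range q, ‖iteratedFDeriv ℝ (k + 1 + j) h b‖ * ‖x - b‖ ^ j
      + S * ‖x - b‖ ^ q with hC
    have hbound : ∀ z ∈ segment ℝ b x, ‖fderiv ℝ (iteratedFDeriv ℝ k h) z‖ ≤ C := by
      intro z hz
      rw [norm_fderiv_iteratedFDeriv]
      have hzb : ‖z - b‖ ≤ ‖x - b‖ := by
        obtain ⟨t, u, ht0, hu0, htu, rfl⟩ := hz
        have : t • b + u • x - b = u • (x - b) := by
          rw [show t = 1 - u by linarith]; module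
        rw [this, norm_smul, Real.norm_eq_abs, abs_of_nonneg hu0]
        exact mul_le_of_le_one_left (norm_nonneg _) (by linarith)
      have := ih (k + 1) (by omega) z fun w hw =>
        hS w ((convex_segment b x).segment_subset (left_mem_segment ℝ b x) hz hw)
      refine this.trans ?_
      rw [hC]
      gcongr
    have hd : ∀ z ∈ segment ℝ b x, DifferentiableAt ℝ (iteratedFDeriv ℝ k h) z := fun z _ =>
      (hh.differentiable_iteratedFDeriv (by exact_mod_cast (by omega : k < p))) z
    have hmv := (convex_segment b x).norm_image_sub_le_of_norm_fderiv_le hd hbound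
      (left_mem_segment ℝ b x) (right_mem_segment ℝ b x)
    have htri : ‖iteratedFDeriv ℝ k h x‖ ≤ ‖iteratedFDeriv ℝ k h b‖ + C * ‖x - b‖ := by
      have := norm_add_le (iteratedFDeriv ℝ k h b) (iteratedFDeriv ℝ k h x - iteratedFDeriv ℝ k h b)
      rw [add_sub_cancel] at this
      linarith
    refine htri.trans (le_of_eq ?_)
    have hN : ∀ j, ‖iteratedFDeriv ℝ (k + (j + 1)) h b‖ = ‖iteratedFDeriv ℝ (k + 1 + j) h b‖ :=
      fun j => congrArg (fun n => ‖iteratedFDeriv ℝ n h b‖) (by omega)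
    have hN0 : ‖iteratedFDeriv ℝ (k + 0) h b‖ = ‖iteratedFDeriv ℝ k h b‖ := rfl
    rw [Finset.sum_range_succ', hC, add_mul, Finset.sum_mul, hN0]
    simp only [hN, pow_succ, pow_zero, mul_one, ← mul_assoc]
    ring

/-- The iterated derivatives of a `C^k` function are symmetric. -/
theorem ContDiff.iteratedFDeriv_comp_perm_of_nat {h : E → F} : ∀ {k : ℕ}, ContDiff ℝ k h →
    ∀ (x : E) (v : Fin k → E) (σ : Equiv.Perm (Fin k)),
      iteratedFDeriv ℝ k h x (v ∘ σ) = iteratedFDeriv ℝ k h x v := by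
  intro k
  induction k with
  | zero => intro _ x v σ; congr 1; exact Subsingleton.elim _ _
  | succ k ih =>
    intro hh x v σ
    have hk : ContDiff ℝ k h := hh.of_le (by exact_mod_cast Nat.le_succ k)
    have hdiff : Differentiable ℝ (iteratedFDeriv ℝ k h) :=
      hh.differentiable_iteratedFDeriv (by exact_mod_cast Nat.lt_succ_self k)
    -- Adjacent transpositions generate the symmetric group. Exchanging the first two arguments is
    -- the symmetry of the second derivative of the iterated derivative two orders lower; the other
    -- transpositions act inside the derivative one order lower, where the induction hypothesis
    -- applies.
    have key : ∀ σ ∈ Submonoid.closure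
        (Set.range fun i : Fin k => Equiv.swap i.castSucc i.succ),
        ∀ v : Fin (k + 1) → E,
          iteratedFDeriv ℝ (k + 1) h x (v ∘ σ) = iteratedFDeriv ℝ (k + 1) h x v := by
      intro σ hσ
      induction hσ using Submonoid.closure_induction with
      | one => intro v; simp
      | mul σ τ _ _ h1 h2 =>
        intro v
        rw [Equiv.Perm.coe_mul, ← Function.comp_assoc, h2, h1]
      | mem σ hσ =>
        obtain ⟨i, rfl⟩ := hσ
        intro v
        cases k with
        | zero => exact i.elim0
        | succ k =>
          rcases Fin.eq_zero_or_eq_succ i with rfl | ⟨j, rfl⟩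
          · have hk' : ContDiff ℝ k h := hk.of_le (by exact_mod_cast Nat.le_succ k)
            have hkd : Differentiable ℝ (iteratedFDeriv ℝ k h) :=
              hk.differentiable_iteratedFDeriv (by exact_mod_cast Nat.lt_succ_self k)
            have h2 : ContDiff ℝ 2 (iteratedFDeriv ℝ k h) :=
              hh.iteratedFDeriv_right (by norm_cast; omega)
            have hsymm : IsSymmSndFDerivAt ℝ (iteratedFDeriv ℝ k h) x :=
              h2.contDiffAt.isSymmSndFDerivAt (by simp)
            have hfd : Differentiable ℝ (fderiv ℝ (iteratedFDeriv ℝ k h)) :=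
              (h2.fderiv_right (m := 1) (by norm_num)).differentiable (by norm_num)
            have expr : ∀ u : Fin (k + 2) → E, iteratedFDeriv ℝ (k + 1 + 1) h x u =
                fderiv ℝ (fderiv ℝ (iteratedFDeriv ℝ k h)) x (u 0) (u 1)
                  (Fin.tail (Fin.tail u)) := by
              intro u
              rw [iteratedFDeriv_succ_apply_left]
              have e1 : ∀ y, iteratedFDeriv ℝ (k + 1) h y (Fin.tail u) =
                  fderiv ℝ (iteratedFDeriv ℝ k h) y (u 1) (Fin.tail (Fin.tail u)) := fun y => by
                rw [iteratedFDeriv_succ_apply_left]; rfl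
              have e2 := fderiv_continuousMultilinear_apply_const_apply (𝕜 := ℝ) (x := x)
                (c := iteratedFDeriv ℝ (k + 1) h) (hdiff x) (Fin.tail u) (u 0)
              rw [← e2]
              simp only [e1]
              have e3 := fderiv_continuousMultilinear_apply_const_apply (𝕜 := ℝ) (x := x)
                (c := fun y => fderiv ℝ (iteratedFDeriv ℝ k h) y (u 1))
                ((hfd x).clm_apply (differentiableAt_const _)) (Fin.tail (Fin.tail u)) (u 0)
              rw [e3]
              congr 1
              rw [fderiv_clm_apply (hfd x) (differentiableAt_const _)]
              simp
            rw [expr, expr, hsymm.eq]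
            congr 1
          · rw [iteratedFDeriv_succ_apply_left, iteratedFDeriv_succ_apply_left]
            rw [← fderiv_continuousMultilinear_apply_const_apply (hdiff x),
              ← fderiv_continuousMultilinear_apply_const_apply (hdiff x)]
            have h0 : (v ∘ (Equiv.swap j.succ.castSucc j.succ.succ)) 0 = v 0 := by
              simp only [Function.comp_apply]
              rw [Equiv.swap_apply_of_ne_of_ne]
              · exact Fin.ne_of_val_ne (by simp)
              · exact Fin.ne_of_val_ne (by simp)
            have ht : Fin.tail (v ∘ (Equiv.swap j.succ.castSucc j.succ.succ)) =
                Fin.tail v ∘ (Equiv.swap j.castSucc j.succ) := by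
              funext i
              simp only [Fin.tail, Function.comp_apply]
              congr 1
              have := (Fin.succ_injective (k + 1)).swap_apply j.castSucc j.succ i
              rw [← Fin.succ_castSucc]
              exact this
            rw [h0, ht]
            congr 2
            funext y
            exact ih hk y _ _
    exact key σ (by rw [Equiv.Perm.mclosure_swap_castSucc_succ]; trivial) v

theorem contDiff_multilinear_diag {j : ℕ} (M : ContinuousMultilinearMap ℝ (fun _ : Fin j => E) F)
    (a : E) {N : WithTop ℕ∞} : ContDiff ℝ N fun x => M fun _ => x - a := by
  have : ContDiff ℝ N fun x : E => (fun _ : Fin j => x - a) :=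
    contDiff_pi.2 fun i => contDiff_id.sub contDiff_const
  exact M.contDiff.comp this

/-- Only the vanishing of the right-hand side matters: the descending factorial is zero for k > j,
and the power is zero for k < j at x = a. The size of `C` is never used. -/
theorem norm_iteratedFDeriv_multilinear_diag_le {j : ℕ}
    (M : ContinuousMultilinearMap ℝ (fun _ : Fin j => E) F) (a x : E) (k : ℕ) :
    ∃ C : ℝ, ‖iteratedFDeriv ℝ k (fun x => M fun _ => x - a) x‖ ≤
      C * (Nat.descFactorial j k * ‖M‖ * ‖(fun _ : Fin j => x - a)‖ ^ (j - k)) := by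
  let g : E →L[ℝ] (Fin j → E) := ContinuousLinearMap.pi fun _ => ContinuousLinearMap.id ℝ E
  have h1 : (fun x => M fun _ => x - a) = fun x => (M ∘ g) (x - a) := rfl
  rw [h1, iteratedFDeriv_comp_sub,
    ContinuousLinearMap.iteratedFDeriv_comp_right (n := (k : WithTop ℕ∞)) g M.contDiff (x - a) le_rfl]
  refine ⟨∏ _i : Fin k, ‖g‖, ?_⟩
  refine (ContinuousMultilinearMap.norm_compContinuousLinearMap_le _ _).trans ?_
  rw [mul_comm]
  gcongr
  have := M.norm_iteratedFDeriv_le k (g (x - a))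
  rw [Fintype.card_fin] at this
  exact this

theorem iteratedFDeriv_multilinear_diag_eq_zero_of_lt {j : ℕ}
    (M : ContinuousMultilinearMap ℝ (fun _ : Fin j => E) F) (a x : E) {k : ℕ} (hk : j < k) :
    iteratedFDeriv ℝ k (fun x => M fun _ => x - a) x = 0 := by
  obtain ⟨C, hC⟩ := norm_iteratedFDeriv_multilinear_diag_le M a x k
  rw [Nat.descFactorial_eq_zero_iff_lt.2 hk] at hC
  simpa using hC

theorem iteratedFDeriv_multilinear_diag_self_eq_zero {j : ℕ}
    (M : ContinuousMultilinearMap ℝ (fun _ : Fin j => E) F) (a : E) {k : ℕ} (hk : k ≠ j) :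
    iteratedFDeriv ℝ k (fun x => M fun _ => x - a) a = 0 := by
  rcases lt_or_gt_of_ne hk with hk | hk
  · obtain ⟨C, hC⟩ := norm_iteratedFDeriv_multilinear_diag_le M a a k
    have h0 : (fun _ : Fin j => a - a) = 0 := by funext; simp
    rw [h0, norm_zero, zero_pow (by omega)] at hC
    simpa using hC
  · exact iteratedFDeriv_multilinear_diag_eq_zero_of_lt M a a hk

/-- The Taylor polynomial of order `p` of `h` at `a`, as a function. -/
noncomputable def taylorAt (p : ℕ) (h : E → F) (a x : E) : F :=
  ∑ j ∈ Finset.range (p + 1), ((j.factorial : ℝ)⁻¹ • iteratedFDeriv ℝ j h a) fun _ => x - a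

theorem contDiff_taylorAt (p : ℕ) (h : E → F) (a : E) {N : WithTop ℕ∞} :
    ContDiff ℝ N (taylorAt p h a) :=
  ContDiff.sum fun _ _ => contDiff_multilinear_diag _ a

theorem iteratedFDeriv_taylorAt (p k : ℕ) (h : E → F) (a x : E) :
    iteratedFDeriv ℝ k (taylorAt p h a) x = ∑ j ∈ Finset.range (p + 1), iteratedFDeriv ℝ k
      (fun x => ((j.factorial : ℝ)⁻¹ • iteratedFDeriv ℝ j h a) fun _ => x - a) x :=
  iteratedFDeriv_fun_sum_apply fun _ _ => (contDiff_multilinear_diag _ a).contDiffAt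

theorem iteratedFDeriv_taylorAt_of_lt {p k : ℕ} (hk : p < k) (h : E → F) (a x : E) :
    iteratedFDeriv ℝ k (taylorAt p h a) x = 0 := by
  rw [iteratedFDeriv_taylorAt]
  refine Finset.sum_eq_zero fun j hj => iteratedFDeriv_multilinear_diag_eq_zero_of_lt _ _ _ ?_
  rw [Finset.mem_range] at hj
  omega

theorem iteratedFDeriv_taylorAt_self {p k : ℕ} (hk : k ≤ p) {h : E → F} (hh : ContDiff ℝ p h)
    (a : E) : iteratedFDeriv ℝ k (taylorAt p h a) a = iteratedFDeriv ℝ k h a := by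
  rw [iteratedFDeriv_taylorAt, Finset.sum_eq_single_of_mem k (by simpa using by omega)]
  · ext v
    have h1 := iteratedFDeriv_comp_sub (𝕜 := ℝ) (f := fun y =>
      ((k.factorial : ℝ)⁻¹ • iteratedFDeriv ℝ k h a) fun _ : Fin k => y) k a a
    rw [h1, ContinuousMultilinearMap.iteratedFDeriv_comp_diagonal]
    have h2 : ∀ σ : Equiv.Perm (Fin k),
        ((k.factorial : ℝ)⁻¹ • iteratedFDeriv ℝ k h a) (fun i => v (σ i)) =
          (k.factorial : ℝ)⁻¹ • iteratedFDeriv ℝ k h a v := fun σ => by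
      have := (hh.of_le (by exact_mod_cast hk)).iteratedFDeriv_comp_perm_of_nat a v σ
      rw [smul_apply]
      exact congrArg _ this
    rw [Finset.sum_congr rfl fun σ _ => h2 σ, Finset.sum_const, Finset.card_univ,
      Fintype.card_perm, Fintype.card_fin, ← Nat.cast_smul_eq_nsmul ℝ, smul_smul,
      mul_inv_cancel₀ (by exact_mod_cast k.factorial_ne_zero), one_smul]
  · intro j _ hj
    exact iteratedFDeriv_multilinear_diag_self_eq_zero _ _ (Ne.symm hj)

/-- A function whose derivatives of order `p + 1` vanish is controlled by its jet at a point. -/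
theorem norm_iteratedFDeriv_le_of_iteratedFDeriv_eq_zero {h : E → F} {p : ℕ}
    (hh : ContDiff ℝ (p + 1 : ℕ) h) (h0 : ∀ x, iteratedFDeriv ℝ (p + 1) h x = 0) {k : ℕ}
    (hk : k ≤ p) (b x : E) :
    ‖iteratedFDeriv ℝ k h x‖ ≤
      ∑ j ∈ Finset.range (p + 1 - k), ‖iteratedFDeriv ℝ (k + j) h b‖ * ‖x - b‖ ^ j := by
  have := norm_iteratedFDeriv_le_sum_segment hh (b := b) (S := 0) (p + 1 - k) k (by omega) x
    (fun z _ => by simp [h0])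
  simpa using this

theorem eq_zero_of_jet_eq_zero {h : E → F} {p : ℕ}
    (hh : ContDiff ℝ (p + 1 : ℕ) h) (h0 : ∀ x, iteratedFDeriv ℝ (p + 1) h x = 0) (b : E)
    (hb : ∀ k ≤ p, iteratedFDeriv ℝ k h b = 0) : h = 0 := by
  funext x
  have := norm_iteratedFDeriv_le_of_iteratedFDeriv_eq_zero hh h0 (Nat.zero_le p) b x
  rw [Finset.sum_eq_zero, norm_iteratedFDeriv_zero] at this
  · simpa using this
  · intro j hj
    rw [Finset.mem_range] at hj
    rw [hb (0 + j) (by omega)]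
    simp

/-- Taylor's theorem, uniformly near a point. -/
theorem eventually_norm_iteratedFDeriv_sub_taylorAt_le {h : E → F} {p : ℕ} (hh : ContDiff ℝ p h)
    (c : E) {ε : ℝ} (hε : 0 < ε) :
    ∀ᶠ q : E × E in 𝓝 (c, c), ∀ k ≤ p,
      ‖iteratedFDeriv ℝ k (fun x => h x - taylorAt p h q.1 x) q.2‖ ≤ ε * ‖q.2 - q.1‖ ^ (p - k) := by
  have hcont : Continuous (iteratedFDeriv ℝ p h) := hh.continuous_iteratedFDeriv le_rfl
  obtain ⟨δ, hδ, hδε⟩ := Metric.continuousAt_iff.1 (hcont.continuousAt (x := c)) (ε / 2) (by positivity)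
  have hball : Metric.ball c δ ×ˢ Metric.ball c δ ∈ 𝓝 (c, c) :=
    prod_mem_nhds (Metric.ball_mem_nhds c hδ) (Metric.ball_mem_nhds c hδ)
  filter_upwards [hball] with ⟨a, b⟩ ⟨ha, hb⟩ k hk
  simp only at ha hb ⊢
  have hT : ContDiff ℝ p (taylorAt p h a) := contDiff_taylorAt p h a
  have hu : ContDiff ℝ p fun x => h x - taylorAt p h a x := hh.sub hT
  have hsub : ∀ j ≤ p, ∀ z, iteratedFDeriv ℝ j (fun x => h x - taylorAt p h a x) z =
      iteratedFDeriv ℝ j h z - iteratedFDeriv ℝ j (taylorAt p h a) z := fun j hj z =>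
    fun_iteratedFDeriv_sub_apply ((hh.of_le (by exact_mod_cast hj)).contDiffAt)
      (contDiff_taylorAt p h a).contDiffAt
  -- The top derivative of a Taylor polynomial is constant, so that of the remainder is D^p h(z) -
  -- D^p h(a), small by continuity. The lower derivatives of the remainder vanish at a, and the mean
  -- value inequality does the rest.
  have htop : ∀ z, iteratedFDeriv ℝ p (taylorAt p h a) z = iteratedFDeriv ℝ p h a := by
    intro z
    rw [← iteratedFDeriv_taylorAt_self le_rfl hh a]
    have hd : Differentiable ℝ (iteratedFDeriv ℝ p (taylorAt p h a)) :=
      (contDiff_taylorAt p h a (N := (p + 1 : ℕ))).differentiable_iteratedFDeriv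
        (by exact_mod_cast Nat.lt_succ_self p)
    refine is_const_of_fderiv_eq_zero hd (fun y => ?_) z a
    rw [← norm_eq_zero, norm_fderiv_iteratedFDeriv, iteratedFDeriv_taylorAt_of_lt (Nat.lt_succ_self p),
      norm_zero]
  have hS : ∀ z ∈ segment ℝ a b,
      ‖iteratedFDeriv ℝ p (fun x => h x - taylorAt p h a x) z‖ ≤ ε := by
    intro z hz
    have hzc : z ∈ Metric.ball c δ := (convex_ball c δ).segment_subset ha hb hz
    rw [hsub p le_rfl, htop]
    have h1 := hδε hzc
    have h2 := hδε ha
    rw [← dist_eq_norm]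
    have := dist_triangle_right (iteratedFDeriv ℝ p h z) (iteratedFDeriv ℝ p h a) (iteratedFDeriv ℝ p h c)
    linarith
  have := norm_iteratedFDeriv_le_sum_segment hu (p - k) k (by omega) b hS
  rwa [Finset.sum_eq_zero, zero_add] at this
  intro j hj
  rw [Finset.mem_range] at hj
  rw [hsub (k + j) (by omega), iteratedFDeriv_taylorAt_self (by omega) hh, sub_self, norm_zero,
    zero_mul]

end Taylor

/-! ### The Glaeser operation on fibres and its stationarity -/

section Glaeser

instance polyDual_isTopologicalAddGroup (n p : ℕ) : IsTopologicalAddGroup (PolyDual n p) :=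
  topologicalAddGroup_induced (LinearMap.ltoFun ℝ (PolyLE n p) ℝ ℝ)

instance polyDual_continuousSMul (n p : ℕ) : ContinuousSMul ℝ (PolyDual n p) :=
  continuousSMul_induced (LinearMap.ltoFun ℝ (PolyLE n p) ℝ ℝ)

instance polyDual_t2Space (n p : ℕ) : T2Space (PolyDual n p) :=
  (Topology.IsEmbedding.mk ⟨rfl⟩ DFunLike.coe_injective :
    Topology.IsEmbedding (fun (ξ : PolyDual n p) (P : PolyLE n p) => ξ P)).t2Space

theorem tendsto_polyDual_iff {n p : ℕ} {ι : Type*} {l : Filter ι} {ξ : ι → PolyDual n p}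
    {η : PolyDual n p} : Tendsto ξ l (𝓝 η) ↔ ∀ P, Tendsto (fun i => ξ i P) l (𝓝 (η P)) := by
  rw [(Topology.IsInducing.mk rfl :
    Topology.IsInducing (fun (ξ : PolyDual n p) (P : PolyLE n p) => ξ P)).tendsto_nhds_iff,
    tendsto_pi_nhds]
  rfl

variable {n p : ℕ} {W : Type*} [AddCommGroup W] [Module ℝ W]

/-- The bundle over `X` with given fibres. -/
def bundleOf (X : Set (Euc n)) (S : Euc n → Submodule ℝ W) : Set (Euc n × W) :=
  {q | q.1 ∈ X ∧ q.2 ∈ S q.1}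

variable [TopologicalSpace W]

/-- The fibres of the Glaeser operation applied to the bundle with given fibres. -/
def glaeserFibre (pr : W →ₗ[ℝ] PolyDual n p) (X : Set (Euc n)) (S : Euc n → Submodule ℝ W)
    (a : Euc n) : Submodule ℝ W :=
  Submodule.span ℝ {w : W | (a, w) ∈ bundlePrime pr X (bundleOf X S)}

theorem glaeserOp_iterate_bundleOf (pr : W →ₗ[ℝ] PolyDual n p) (X : Set (Euc n))
    (S : Euc n → Submodule ℝ W) (k : ℕ) :
    (glaeserOp pr X)^[k] (bundleOf X S) = bundleOf X ((glaeserFibre pr X)^[k] S) := by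
  induction k with
  | zero => rfl
  | succ k ih => rw [Function.iterate_succ_apply', Function.iterate_succ_apply', ih]; rfl

/-- The Glaeser operation does not see positive factors in the bounds for the second summand. -/
theorem mem_glaeserFibre_of_tendsto [ContinuousSMul ℝ W] {pr : W →ₗ[ℝ] PolyDual n p}
    {X : Set (Euc n)} {S : Euc n → Submodule ℝ W} {ι : Type*} {l : Filter ι} [l.NeBot]
    {a b : ι → Euc n} {v w : ι → W} {c : Euc n} {u : W} (hc : c ∈ X) (C : ℝ)
    (h : ∀ᶠ i in l, a i ∈ X ∧ b i ∈ X ∧ v i ∈ S (a i) ∧ w i ∈ S (b i) ∧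
      ∀ (α : Fin n → ℕ) (hα : miLen α ≤ p),
        ‖a i - b i‖ ^ (p - miLen α) * |dualCoeff (pr (w i)) (b i) α hα| ≤ C)
    (ha : Tendsto a l (𝓝 c)) (hb : Tendsto b l (𝓝 c))
    (hvw : Tendsto (fun i => v i + w i) l (𝓝 u)) : u ∈ glaeserFibre pr X S c := by
  -- The fibres are linear, so both summands may be divided by `K`; the maximum with 1 keeps the
  -- divisor positive for any `C`.
  set K : ℝ := max C 1 with hK
  have hK0 : 0 < K := lt_of_lt_of_le one_pos (le_max_right _ _)
  have hmem : K⁻¹ • u ∈ glaeserFibre pr X S c := by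
    refine Submodule.subset_span ⟨hc, ?_⟩
    refine mem_closure_of_tendsto (f := fun i => (a i, b i, K⁻¹ • (v i + w i)))
      (ha.prodMk_nhds (hb.prodMk_nhds (hvw.const_smul _))) ?_
    filter_upwards [h] with i ⟨h1, h2, h3, h4, h5⟩
    refine ⟨a i, h1, b i, h2, K⁻¹ • v i, K⁻¹ • w i, ⟨h1, Submodule.smul_mem _ _ h3⟩,
      ⟨h2, Submodule.smul_mem _ _ h4⟩, fun α hα => ?_, by rw [smul_add]⟩
    have := (h5 α hα).trans (le_max_left C 1)
    have e : dualCoeff (pr (K⁻¹ • w i)) (b i) α hα = K⁻¹ * dualCoeff (pr (w i)) (b i) α hα := by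
      simp [dualCoeff]
    rw [e, abs_mul, abs_of_pos (inv_pos.2 hK0), mul_left_comm, inv_mul_le_iff₀ hK0, mul_one]
    exact this
  have := Submodule.smul_mem _ K hmem
  rwa [smul_smul, mul_inv_cancel₀ hK0.ne', one_smul] at this

/-- Limits of elements of the fibres lie in the fibre of the Glaeser operation. -/
theorem mem_glaeserFibre_of_tendsto_mem [ContinuousSMul ℝ W] {pr : W →ₗ[ℝ] PolyDual n p}
    {X : Set (Euc n)} {S : Euc n → Submodule ℝ W} {ι : Type*} {l : Filter ι} [l.NeBot]
    {a : ι → Euc n} {v : ι → W} {c : Euc n} {u : W} (hc : c ∈ X)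
    (h : ∀ᶠ i in l, a i ∈ X ∧ v i ∈ S (a i))
    (ha : Tendsto a l (𝓝 c)) (hv : Tendsto v l (𝓝 u)) : u ∈ glaeserFibre pr X S c := by
  refine mem_glaeserFibre_of_tendsto (a := a) (b := a) (v := v) (w := fun _ => 0) hc 0 ?_ ha ha
    (by simpa using hv)
  filter_upwards [h] with i ⟨h1, h2⟩
  exact ⟨h1, h1, h2, Submodule.zero_mem _, fun α hα => by simp [dualCoeff]⟩

theorem le_glaeserFibre [ContinuousSMul ℝ W] (pr : W →ₗ[ℝ] PolyDual n p) {X : Set (Euc n)}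
    (S : Euc n → Submodule ℝ W) {a : Euc n} (ha : a ∈ X) : S a ≤ glaeserFibre pr X S a :=
  fun _ hv => mem_glaeserFibre_of_tendsto_mem (l := (pure () : Filter Unit)) ha
    (Eventually.of_forall fun _ => ⟨ha, hv⟩) tendsto_const_nhds tendsto_const_nhds

/-- The operation is local: the closure defining the fibre over a is tested on arbitrarily small
neighbourhoods of (a, a, w), which only see fibres near a. -/
theorem glaeserFibre_le_of_eventually_le (pr : W →ₗ[ℝ] PolyDual n p) {X : Set (Euc n)}
    {S S' : Euc n → Submodule ℝ W} {a : Euc n} (h : ∀ᶠ b in 𝓝[X] a, S b ≤ S' b) :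
    glaeserFibre pr X S a ≤ glaeserFibre pr X S' a := by
  refine Submodule.span_mono fun w hw => ⟨hw.1, ?_⟩
  rw [eventually_nhdsWithin_iff] at h
  refine mem_closure_iff_nhds.2 fun N hN => ?_
  have hN' : N ∩ ({b | b ∈ X → S b ≤ S' b} ×ˢ {b | b ∈ X → S b ≤ S' b} ×ˢ Set.univ) ∈
      𝓝 (a, a, w) :=
    inter_mem hN (prod_mem_nhds h (prod_mem_nhds h univ_mem))
  obtain ⟨q, ⟨hqN, h1, h2, -⟩, b, hb, c, hc, v, u, hv, hu, hbd, rfl⟩ :=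
    mem_closure_iff_nhds.1 hw.2 _ hN'
  exact ⟨_, hqN, b, hb, c, hc, v, u, ⟨hb, h1 hb hv.2⟩, ⟨hc, h2 hc hu.2⟩, hbd, rfl⟩

theorem glaeserFibre_congr (pr : W →ₗ[ℝ] PolyDual n p) {X : Set (Euc n)}
    {S S' : Euc n → Submodule ℝ W} {a : Euc n} (h : ∀ᶠ b in 𝓝[X] a, S b = S' b) :
    glaeserFibre pr X S a = glaeserFibre pr X S' a :=
  le_antisymm (glaeserFibre_le_of_eventually_le pr (h.mono fun _ h => h.le))
    (glaeserFibre_le_of_eventually_le pr (h.mono fun _ h => h.ge))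

/-- By locality, equality of consecutive iterates propagates to later ones provided that it holds on
a whole neighbourhood; equality at a alone would not be enough. -/
theorem glaeserFibre_iterate_eventually_stable (pr : W →ₗ[ℝ] PolyDual n p) {X : Set (Euc n)}
    (S : Euc n → Submodule ℝ W) {a : Euc n} {j l : ℕ} (hjl : j ≤ l)
    (h : ∀ᶠ b in 𝓝[X] a, (glaeserFibre pr X)^[j + 1] S b = (glaeserFibre pr X)^[j] S b) :
    ∀ᶠ b in 𝓝[X] a, (glaeserFibre pr X)^[l + 1] S b = (glaeserFibre pr X)^[l] S b := by
  induction l, hjl using Nat.le_induction with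
  | base => exact h
  | succ l _ ih =>
    filter_upwards [eventually_eventually_nhdsWithin.2 ih] with b hb
    rw [Function.iterate_succ_apply' _ (l + 1), Function.iterate_succ_apply' _ l]
    rw [Function.iterate_succ_apply' _ l] at hb
    exact glaeserFibre_congr pr hb

variable [IsTopologicalAddGroup W] [ContinuousSMul ℝ W] [T2Space W] [FiniteDimensional ℝ W]

/-- The Glaeser operation dominates the dimension of the nearby fibres. -/
theorem eventually_finrank_le_glaeserFibre (pr : W →ₗ[ℝ] PolyDual n p) {X : Set (Euc n)}
    (S : Euc n → Submodule ℝ W) {a : Euc n} (ha : a ∈ X) :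
    ∀ᶠ b in 𝓝[X] a, Module.finrank ℝ (S b) ≤ Module.finrank ℝ (glaeserFibre pr X S a) := by
  by_contra hcon
  set T := glaeserFibre pr X S a with hT
  obtain ⟨C, hC⟩ := Submodule.exists_isCompl T
  let e : W ≃L[ℝ] EuclideanSpace ℝ (Fin (Module.finrank ℝ W)) :=
    ContinuousLinearEquiv.ofFinrankEq (by simp)
  -- A fibre of dimension greater than that of `T` meets the complement `C` in a unit vector.
  -- Compactness of the sphere gives a limit of such vectors, which lies in `T` as a limit of fibre
  -- elements and in `C` because `C` is closed.
  have hex : ∀ b, Module.finrank ℝ T < Module.finrank ℝ (S b) → ∃ v ∈ S b, v ∈ C ∧ ‖e v‖ = 1 := by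
    intro b hb
    have hne : S b ⊓ C ≠ ⊥ := by
      intro hbot
      have h1 := Submodule.finrank_sup_add_finrank_inf_eq (S b) C
      have h2 := Submodule.finrank_add_eq_of_isCompl hC
      have h3 := Submodule.finrank_le (S b ⊔ C)
      rw [hbot, finrank_bot] at h1
      omega
    obtain ⟨v, hv, hv0⟩ := Submodule.exists_mem_ne_zero_of_ne_bot hne
    have hev : ‖e v‖ ≠ 0 := by simpa using hv0
    refine ⟨‖e v‖⁻¹ • v, Submodule.smul_mem _ _ hv.1, Submodule.smul_mem _ _ hv.2, ?_⟩
    rw [map_smul, norm_smul, norm_inv, norm_norm, inv_mul_cancel₀ hev]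
  choose! v hvS hvC hv1 using hex
  have hne : (𝓝[X] a ⊓ 𝓟 {b | Module.finrank ℝ T < Module.finrank ℝ (S b)}).NeBot := by
    rw [← frequently_mem_iff_neBot]
    rw [not_eventually] at hcon
    exact hcon.mono fun b hb => not_le.1 hb
  set u := Ultrafilter.of (𝓝[X] a ⊓ 𝓟 {b | Module.finrank ℝ T < Module.finrank ℝ (S b)}) with hu
  have hule := Ultrafilter.of_le (𝓝[X] a ⊓ 𝓟 {b | Module.finrank ℝ T < Module.finrank ℝ (S b)})
  have hud : ∀ᶠ b in (u : Filter (Euc n)), Module.finrank ℝ T < Module.finrank ℝ (S b) :=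
    hule (mem_inf_of_right (mem_principal_self _))
  have hua : (u : Filter (Euc n)) ≤ 𝓝[X] a := hule.trans inf_le_left
  obtain ⟨y, hy, hyu⟩ := (isCompact_sphere (0 : EuclideanSpace ℝ (Fin (Module.finrank ℝ W))) 1).ultrafilter_le_nhds
    (u.map fun b => e (v b)) (by
      rw [le_principal_iff]
      change ∀ᶠ b in (u : Filter (Euc n)), e (v b) ∈ _
      filter_upwards [hud] with b hb
      simpa using hv1 b hb)
  have hlim : Tendsto (fun b => v b) (u : Filter (Euc n)) (𝓝 (e.symm y)) := by
    have h1 : Tendsto (fun b => e (v b)) (u : Filter (Euc n)) (𝓝 y) := hyu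
    have h2 := (e.symm.continuous.tendsto y).comp h1
    simpa [Function.comp_def] using h2
  have hmemT : e.symm y ∈ T :=
    mem_glaeserFibre_of_tendsto_mem (a := id) ha
      ((hud.and (hua self_mem_nhdsWithin)).mono fun b hb => ⟨hb.2, hvS b hb.1⟩)
      (hua.trans nhdsWithin_le_nhds) hlim
  have hmemC : e.symm y ∈ C :=
    (Submodule.closed_of_finiteDimensional C).mem_of_tendsto hlim (hud.mono fun b hb => hvC b hb)
  have h0 : e.symm y = 0 := by
    have := hC.disjoint.le_bot ⟨hmemT, hmemC⟩
    simpa using this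
  have : y = 0 := by simpa using h0
  rw [this] at hy
  simp at hy

/-- Two iterations pay for one dimension. For b near a the iterate 2k + 3 has dimension at most k +
2. If the iterate 2k + 2 at b has dimension at most k + 1, the induction hypothesis at b says that
the iterates were already stationary there; otherwise its dimension is at least k + 2, and inclusion
of iterates forces equality. The case k = 0 needs the initial fibres to be non-zero. -/
theorem glaeserFibre_iterate_stable_of_finrank_le (pr : W →ₗ[ℝ] PolyDual n p) {X : Set (Euc n)}
    (S : Euc n → Submodule ℝ W) (hS : ∀ a ∈ X, 1 ≤ Module.finrank ℝ (S a)) (k : ℕ) :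
    ∀ a ∈ X, Module.finrank ℝ ((glaeserFibre pr X)^[2 * k + 2] S a) ≤ k + 1 →
      ∀ᶠ b in 𝓝[X] a,
        (glaeserFibre pr X)^[2 * k + 1] S b = (glaeserFibre pr X)^[2 * k] S b := by
  induction k with
  | zero =>
    intro a ha h
    have := eventually_finrank_le_glaeserFibre pr ((glaeserFibre pr X)^[1] S) ha
    filter_upwards [this, self_mem_nhdsWithin] with b hb hbX
    refine (Submodule.eq_of_le_of_finrank_le (le_glaeserFibre pr S hbX) ?_).symm
    exact (hb.trans h).trans (hS b hbX)
  | succ k ih =>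
    intro a ha h
    have := eventually_finrank_le_glaeserFibre pr ((glaeserFibre pr X)^[2 * k + 3] S) ha
    rw [show 2 * (k + 1) + 2 = (2 * k + 3) + 1 by ring, Function.iterate_succ_apply'] at h
    filter_upwards [this, self_mem_nhdsWithin] with b hb hbX
    rw [show 2 * (k + 1) = 2 * k + 2 by ring]
    by_cases hk : Module.finrank ℝ ((glaeserFibre pr X)^[2 * k + 2] S b) ≤ k + 1
    · have h1 := glaeserFibre_iterate_eventually_stable pr S (by omega : 2 * k ≤ 2 * k + 2)
        (ih b hbX hk)
      exact h1.self_of_nhdsWithin hbX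
    · rw [Function.iterate_succ_apply']
      refine (Submodule.eq_of_le_of_finrank_le (le_glaeserFibre pr _ hbX) ?_).symm
      rw [← Function.iterate_succ_apply' (glaeserFibre pr X)]
      exact (hb.trans h).trans (by omega)

/-- The iterations of the Glaeser operation are stationary from `2 dim W` on. -/
theorem glaeserFibre_iterate_eq_of_le (pr : W →ₗ[ℝ] PolyDual n p) {X : Set (Euc n)}
    (S : Euc n → Submodule ℝ W) (hS : ∀ a ∈ X, 1 ≤ Module.finrank ℝ (S a)) {a : Euc n}
    (ha : a ∈ X) {l : ℕ} (hl : 2 * Module.finrank ℝ W ≤ l) :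
    (glaeserFibre pr X)^[l] S a = (glaeserFibre pr X)^[2 * Module.finrank ℝ W] S a := by
  induction l, hl using Nat.le_induction with
  | base => rfl
  | succ l hl ih =>
    rw [← ih]
    -- With dim W = k + 1 the dimension hypothesis of the preceding lemma is automatic, so
    -- stationarity starts at 2k. The dimension is non-zero because the initial fibre over `a` is.
    obtain ⟨k, hk⟩ : ∃ k, Module.finrank ℝ W = k + 1 :=
      Nat.exists_eq_succ_of_ne_zero (by have := (hS a ha).trans (Submodule.finrank_le _); omega)
    have h1 := glaeserFibre_iterate_stable_of_finrank_le pr S hS k a ha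
      (hk ▸ Submodule.finrank_le _)
    exact (glaeserFibre_iterate_eventually_stable pr S (by omega : 2 * k ≤ l) h1).self_of_nhdsWithin
      ha

/-- Saturation in usable form: limits permitted by the Glaeser operation do not leave the saturated
fibres. -/
theorem glaeserFibre_saturated (pr : W →ₗ[ℝ] PolyDual n p) {X : Set (Euc n)}
    (S : Euc n → Submodule ℝ W) (hS : ∀ a ∈ X, 1 ≤ Module.finrank ℝ (S a)) {a : Euc n}
    (ha : a ∈ X) :
    glaeserFibre pr X ((glaeserFibre pr X)^[2 * Module.finrank ℝ W] S) a =
      (glaeserFibre pr X)^[2 * Module.finrank ℝ W] S a := by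
  rw [← Function.iterate_succ_apply' (glaeserFibre pr X)]
  exact glaeserFibre_iterate_eq_of_le pr S hS ha (Nat.le_succ _)

end Glaeser

/-! ### Polynomials as functions, their partial derivatives and Taylor's formula -/

section Polynomials

open MvPolynomial

variable {n : ℕ}

/-- The function on `ℝⁿ` defined by a polynomial. -/
noncomputable def polyFun (P : MvPolynomial (Fin n) ℝ) (x : Euc n) : ℝ :=
  MvPolynomial.eval (fun i => x i) P

theorem contDiff_polyFun (P : MvPolynomial (Fin n) ℝ) {N : WithTop ℕ∞} :
    ContDiff ℝ N (polyFun P) := by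
  unfold polyFun
  induction P using MvPolynomial.induction_on with
  | C a => simpa using contDiff_const
  | add p q hp hq => simpa using hp.add hq
  | mul_X p i hp =>
    simp only [map_mul, eval_X]
    exact hp.mul (contDiff_piLp_apply 2)

theorem iteratedFDeriv_mul_eq_zero_of_lt {E : Type*} [NormedAddCommGroup E] [NormedSpace ℝ E]
    {f g : E → ℝ} {d e k : ℕ} (hf : ContDiff ℝ k f)
    (hg : ContDiff ℝ k g) {x : E} (hf0 : ∀ j ≤ k, d < j → iteratedFDeriv ℝ j f x = 0)
    (hg0 : ∀ j ≤ k, e < j → iteratedFDeriv ℝ j g x = 0) (hk : d + e < k) :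
    iteratedFDeriv ℝ k (fun y => f y * g y) x = 0 := by
  have := norm_iteratedFDeriv_mul_le hf hg x (n := k) le_rfl
  rw [Finset.sum_eq_zero] at this
  · simpa using this
  · intro j hj
    rw [Finset.mem_range] at hj
    by_cases hd : d < j
    · rw [hf0 j (by omega) hd]; simp
    · rw [hg0 (k - j) (by omega) (by omega)]; simp

theorem iteratedFDeriv_coord_eq_zero (i : Fin n) {k : ℕ} (hk : 1 < k) (x : Euc n) :
    iteratedFDeriv ℝ k (fun y : Euc n => y i) x = 0 := by
  let g : Euc n →L[ℝ] ℝ := EuclideanSpace.proj i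
  have h1 : (fun y : Euc n => y i) = g := rfl
  obtain ⟨k, rfl⟩ : ∃ m, k = m + 2 := ⟨k - 2, by omega⟩
  rw [h1, ← norm_eq_zero, ← norm_iteratedFDeriv_fderiv]
  have h2 : fderiv ℝ g = fun _ => g := by funext y; exact g.fderiv
  rw [h2, iteratedFDeriv_const_of_ne (by omega), Pi.zero_apply, norm_zero]

theorem iteratedFDeriv_prod_pow_eq_zero (s : Fin n → ℕ) (T : Finset (Fin n)) {k : ℕ}
    (hk : ∑ i ∈ T, s i < k) (x : Euc n) :
    iteratedFDeriv ℝ k (fun y : Euc n => ∏ i ∈ T, y i ^ s i) x = 0 := by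
  have hc : ∀ i, ∀ N : WithTop ℕ∞, ContDiff ℝ N fun y : Euc n => y i := fun i N =>
    contDiff_piLp_apply 2
  induction T using Finset.induction_on generalizing k with
  | empty =>
    simp only [Finset.prod_empty]
    rw [iteratedFDeriv_const_of_ne (by simpa using Nat.pos_iff_ne_zero.1 hk), Pi.zero_apply]
  | insert a T ha ih =>
    simp only [Finset.prod_insert ha]
    rw [Finset.sum_insert ha] at hk
    have hpow : ∀ m j : ℕ, m < j → iteratedFDeriv ℝ j (fun y : Euc n => y a ^ m) x = 0 := by
      intro m
      induction m with
      | zero =>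
        intro j hj
        simp only [pow_zero]
        rw [iteratedFDeriv_const_of_ne (by omega), Pi.zero_apply]
      | succ m ihm =>
        intro j hj
        simp only [pow_succ]
        exact iteratedFDeriv_mul_eq_zero_of_lt ((hc a _).pow m) (hc a _)
          (fun i _ hi => ihm i hi) (fun i _ hi => iteratedFDeriv_coord_eq_zero a hi x) hj
    exact iteratedFDeriv_mul_eq_zero_of_lt ((hc a _).pow _)
      (contDiff_prod fun i _ => (hc i _).pow _) (fun j _ hj => hpow _ j hj)
      (fun j _ hj => ih hj) hk

theorem polyFun_eq_sum (P : MvPolynomial (Fin n) ℝ) (x : Euc n) :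
    polyFun P x = ∑ s ∈ P.support, P.coeff s * ∏ i, x i ^ s i :=
  MvPolynomial.eval_eq' _ _

theorem iteratedFDeriv_polyFun_eq_zero {p k : ℕ} {P : MvPolynomial (Fin n) ℝ}
    (hP : P ∈ PolyLE n p) (hk : p < k) (x : Euc n) : iteratedFDeriv ℝ k (polyFun P) x = 0 := by
  have hc : ∀ i, ∀ N : WithTop ℕ∞, ContDiff ℝ N fun y : Euc n => y i := fun i N =>
    contDiff_piLp_apply 2
  have h1 : polyFun P = fun x => ∑ s ∈ P.support, P.coeff s • ∏ i, x i ^ s i :=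
    funext (polyFun_eq_sum P)
  rw [h1, iteratedFDeriv_fun_sum_apply]
  · refine Finset.sum_eq_zero fun s hs => ?_
    rw [iteratedFDeriv_const_smul_apply' (contDiff_prod fun i _ => (hc i _).pow _).contDiffAt,
      iteratedFDeriv_prod_pow_eq_zero s, smul_zero]
    rw [mem_restrictTotalDegree] at hP
    have := (le_totalDegree hs).trans hP
    rw [Finsupp.sum_fintype _ _ (by simp)] at this
    omega
  · exact fun s _ => ((contDiff_prod fun i _ => (hc i _).pow _).const_smul _).contDiffAt

/-- The iterated partial derivative of a polynomial. -/
noncomputable def polyDeriv (α : Fin n → ℕ) : MvPolynomial (Fin n) ℝ →ₗ[ℝ] MvPolynomial (Fin n) ℝ :=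
  (basisMonomials (Fin n) ℝ).constr ℝ fun s =>
    monomial (s - Finsupp.equivFunOnFinite.symm α) (∏ i, ((s i).descFactorial (α i) : ℝ))

theorem polyDeriv_monomial (α : Fin n → ℕ) (s : Fin n →₀ ℕ) (c : ℝ) :
    polyDeriv α (monomial s c) = monomial (s - Finsupp.equivFunOnFinite.symm α)
      (c * ∏ i, ((s i).descFactorial (α i) : ℝ)) := by
  have h1 : monomial s c = c • basisMonomials (Fin n) ℝ s := by simp [smul_monomial]
  rw [h1, map_smul, polyDeriv, Module.Basis.constr_basis, smul_monomial, smul_eq_mul]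

theorem descFactorial_add (m a b : ℕ) :
    m.descFactorial (a + b) = m.descFactorial a * (m - a).descFactorial b := by
  induction b with
  | zero => simp
  | succ b ih => rw [← add_assoc, Nat.descFactorial_succ, Nat.descFactorial_succ, ih,
      Nat.sub_sub]; ring

theorem polyDeriv_polyDeriv (α β : Fin n → ℕ) (P : MvPolynomial (Fin n) ℝ) :
    polyDeriv β (polyDeriv α P) = polyDeriv (α + β) P := by
  induction P using MvPolynomial.induction_on' with
  | monomial s c =>
    simp only [polyDeriv_monomial, mul_assoc, ← Finset.prod_mul_distrib]
    refine congrArg₂ (fun s c => monomial s c) ?_ ?_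
    · ext i; simp [Nat.sub_sub]
    · congr 1
      refine Finset.prod_congr rfl fun i _ => ?_
      rw [Pi.add_apply, descFactorial_add]
      simp
  | add P Q hP hQ => simp only [map_add, hP, hQ]

theorem polyDeriv_zero (P : MvPolynomial (Fin n) ℝ) : polyDeriv 0 P = P := by
  induction P using MvPolynomial.induction_on' with
  | monomial s c =>
    rw [polyDeriv_monomial]
    refine congrArg₂ (fun s c => monomial s c) ?_ ?_
    · ext i; simp
    · simp
  | add P Q hP hQ => simp only [map_add, hP, hQ]

theorem polyDeriv_single (i : Fin n) (P : MvPolynomial (Fin n) ℝ) :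
    polyDeriv (Pi.single i 1) P = pderiv i P := by
  classical
  induction P using MvPolynomial.induction_on' with
  | monomial s c =>
    rw [polyDeriv_monomial, pderiv_monomial]
    refine congrArg₂ (fun s c => monomial s c) ?_ ?_
    · ext j; simp [Finsupp.single_apply]
    · congr 1
      rw [Finset.prod_eq_single i]
      · simp
      · intro j _ hj; simp [Pi.single_eq_of_ne hj]
      · simp
  | add P Q hP hQ => simp only [map_add, hP, hQ]

theorem monomial_mem_polyLE {p : ℕ} {s : Fin n →₀ ℕ} (hs : ∑ i, s i ≤ p) (c : ℝ) :
    monomial s c ∈ PolyLE n p := by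
  rw [mem_restrictTotalDegree]
  refine (totalDegree_monomial_le s c).trans ?_
  rwa [Finsupp.sum_fintype _ _ (by simp)]

/-- Linear properties on polynomials of degree at most `p` may be checked on monomials. -/
theorem polyLE_induction {p : ℕ} {motive : MvPolynomial (Fin n) ℝ → Prop}
    (zero : motive 0)
    (add : ∀ P Q, motive P → motive Q → motive (P + Q))
    (mono : ∀ (s : Fin n →₀ ℕ) (c : ℝ), ∑ i, s i ≤ p → motive (monomial s c))
    {P : MvPolynomial (Fin n) ℝ} (hP : P ∈ PolyLE n p) : motive P := by
  rw [P.as_sum]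
  refine Finset.sum_induction _ motive add zero fun s hs => mono s _ ?_
  rw [mem_restrictTotalDegree] at hP
  have := (le_totalDegree hs).trans hP
  rwa [Finsupp.sum_fintype _ _ (by simp)] at this

/-- The truncated subtraction is correct: if some α_i exceeds the exponent of a monomial, its
descending factorial, and with it the derivative, is zero. -/
theorem polyDeriv_mem {p : ℕ} (α : Fin n → ℕ) {P : MvPolynomial (Fin n) ℝ} (hP : P ∈ PolyLE n p) :
    polyDeriv α P ∈ PolyLE n (p - miLen α) := by
  refine polyLE_induction (motive := fun P => polyDeriv α P ∈ PolyLE n (p - miLen α)) ?_ ?_ ?_ hP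
  · rw [map_zero]; exact zero_mem _
  · intro P Q hP hQ; rw [map_add]; exact add_mem hP hQ
  · intro s c hs
    rw [polyDeriv_monomial]
    by_cases h : ∀ i, α i ≤ s i
    · apply monomial_mem_polyLE
      have : ∑ i, (s - Finsupp.equivFunOnFinite.symm α) i + miLen α = ∑ i, s i := by
        rw [miLen, ← Finset.sum_add_distrib]
        exact Finset.sum_congr rfl fun i _ => by simpa using Nat.sub_add_cancel (h i)
      omega
    · push Not at h
      obtain ⟨i, hi⟩ := h
      rw [Finset.prod_eq_zero (Finset.mem_univ i), mul_zero, monomial_zero]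
      · exact zero_mem _
      · exact_mod_cast Nat.descFactorial_eq_zero_iff_lt.2 hi

/-- Taylor's formula for polynomials. -/
theorem polyLE_eq_sum_taylorMonomial {p : ℕ} {P : MvPolynomial (Fin n) ℝ} (hP : P ∈ PolyLE n p)
    (b : Euc n) :
    P = ∑ α ∈ miLE n p, C (polyFun (polyDeriv α P) b) * taylorMonomial b α := by
  refine polyLE_induction (motive := fun P => P = ∑ α ∈ miLE n p,
    C (polyFun (polyDeriv α P) b) * taylorMonomial b α) ?_ ?_ ?_ hP
  · simp [polyFun]
  · intro P Q hP hQ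
    conv_lhs => rw [hP, hQ]
    rw [← Finset.sum_add_distrib]
    refine Finset.sum_congr rfl fun α _ => ?_
    simp [polyFun, add_mul]
  · intro s c hs
    have hsi : ∀ i, s i ≤ p := fun i =>
      (Finset.single_le_sum (f := fun i => s i) (fun _ _ => Nat.zero_le _) (Finset.mem_univ i)).trans hs
    -- The binomial expansion is padded to the common range p + 1, the added terms having zero
    -- descending factorial. Multiplying out then gives a sum over a box of multiindices, whose
    -- members with |α| > p vanish for the same reason.
    have hbin : ∀ i, (X i : MvPolynomial (Fin n) ℝ) ^ s i = ∑ j ∈ Finset.range (p + 1),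
        C (((s i).descFactorial j : ℝ) * (j.factorial : ℝ)⁻¹ * b i ^ (s i - j)) *
          (X i - C (b i)) ^ j := by
      intro i
      conv_lhs => rw [← sub_add_cancel (X i : MvPolynomial (Fin n) ℝ) (C (b i)), add_pow]
      rw [← Finset.sum_subset (Finset.range_mono (Nat.add_le_add_right (hsi i) 1))]
      · refine Finset.sum_congr rfl fun j _ => ?_
        have hj : ((s i).descFactorial j : ℝ) * (j.factorial : ℝ)⁻¹ = ((s i).choose j : ℝ) := by
          rw [Nat.descFactorial_eq_factorial_mul_choose]
          push_cast
          field_simp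
        rw [hj, map_mul, map_pow, map_natCast]
        ring
      · intro j _ hj
        rw [Finset.mem_range, not_lt] at hj
        rw [Nat.descFactorial_eq_zero_iff_lt.2 (by omega)]
        simp
    have hmono : (monomial s c : MvPolynomial (Fin n) ℝ) = C c * ∏ i, X i ^ s i := by
      rw [monomial_eq, Finsupp.prod_fintype _ _ (by simp)]
    conv_lhs => rw [hmono]; simp only [hbin]
    rw [Finset.prod_univ_sum, miLE, Finset.sum_filter, Finset.mul_sum]
    refine Finset.sum_congr rfl fun α _ => ?_
    have heval : polyFun (polyDeriv α (monomial s c)) b =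
        c * (∏ i, ((s i).descFactorial (α i) : ℝ)) * ∏ i, b i ^ (s i - α i) := by
      rw [polyDeriv_monomial, polyFun, eval_monomial, Finsupp.prod_fintype _ _ (by simp)]
      simp
    split_ifs with hα
    · rw [heval, taylorMonomial, Finset.prod_mul_distrib, ← map_prod, ← mul_assoc, ← mul_assoc,
        ← map_mul, ← map_mul]
      congr 2
      rw [Finset.prod_mul_distrib, Finset.prod_mul_distrib, miFact, Finset.prod_inv_distrib]
      push_cast
      ring
    · obtain ⟨i, hi⟩ : ∃ i, s i < α i := by
        by_contra hcon
        push Not at hcon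
        exact hα ((Finset.sum_le_sum fun i _ => hcon i).trans hs)
      rw [Finset.prod_eq_zero (Finset.mem_univ i), mul_zero]
      rw [Nat.descFactorial_eq_zero_iff_lt.2 hi]
      simp

theorem polyFun_eq_sum_taylor {p : ℕ} {P : MvPolynomial (Fin n) ℝ} (hP : P ∈ PolyLE n p)
    (a b : Euc n) :
    polyFun P b = ∑ α ∈ miLE n p,
      (miFact α : ℝ)⁻¹ * polyFun (polyDeriv α P) a * ∏ i, (b i - a i) ^ α i := by
  conv_lhs => rw [polyLE_eq_sum_taylorMonomial hP a, polyFun, map_sum]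
  refine Finset.sum_congr rfl fun α _ => ?_
  simp [taylorMonomial]
  ring

theorem fderiv_polyFun_apply_single (P : MvPolynomial (Fin n) ℝ) (x : Euc n) (i : Fin n) :
    fderiv ℝ (polyFun P) x (EuclideanSpace.single i 1) = polyFun (pderiv i P) x := by
  classical
  have hd : ∀ Q : MvPolynomial (Fin n) ℝ, DifferentiableAt ℝ (polyFun Q) x := fun Q =>
    ((contDiff_polyFun Q (N := 1)).differentiable (by norm_num)) x
  induction P using MvPolynomial.induction_on with
  | C a =>
    have : polyFun (C a : MvPolynomial (Fin n) ℝ) = fun _ => a := by funext y; simp [polyFun]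
    rw [this]
    simp [polyFun]
  | add p q hp hq =>
    have : polyFun (p + q) = fun y => polyFun p y + polyFun q y := by funext y; simp [polyFun]
    rw [this, fderiv_fun_add (hd p) (hd q)]
    simp only [add_apply, hp, hq]
    simp [polyFun]
  | mul_X p j hp =>
    have : polyFun (p * X j) = fun y => polyFun p y * (EuclideanSpace.proj j : Euc n →L[ℝ] ℝ) y := by
      funext y; simp [polyFun]
    rw [this, fderiv_fun_mul (hd p) (ContinuousLinearMap.differentiableAt _),
      ContinuousLinearMap.fderiv]
    simp only [add_apply, smul_apply, hp, smul_eq_mul]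
    simp [polyFun, pderiv_X, Pi.single_apply, eq_comm]
    ring_nf
    split_ifs <;> simp

/-- Each partial derivative is a derivative along a unit vector, so no constant is lost when
directions are peeled off one at a time. -/
theorem norm_iteratedFDeriv_polyDeriv_le (N : ℕ) : ∀ (α : Fin n → ℕ), miLen α = N →
    ∀ (P : MvPolynomial (Fin n) ℝ) (j : ℕ) (x : Euc n),
      ‖iteratedFDeriv ℝ j (polyFun (polyDeriv α P)) x‖ ≤ ‖iteratedFDeriv ℝ (j + N) (polyFun P) x‖ := by
  induction N with
  | zero =>
    intro α hα P j x
    have : α = 0 := by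
      funext i
      have := (Finset.sum_eq_zero_iff.1 hα) i (Finset.mem_univ i)
      exact this
    rw [this, polyDeriv_zero]
    rfl
  | succ N ih =>
    intro α hα P j x
    obtain ⟨i, hi⟩ : ∃ i, 0 < α i := by
      by_contra hcon
      push Not at hcon
      have : miLen α = 0 := Finset.sum_eq_zero fun i _ => Nat.le_zero.1 (hcon i)
      omega
    set β : Fin n → ℕ := α - Pi.single i 1 with hβ
    have hsum : α = Pi.single i 1 + β := by
      funext j
      rw [hβ, Pi.add_apply, Pi.sub_apply]
      rcases eq_or_ne j i with rfl | hj
      · simp; omega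
      · simp [Pi.single_eq_of_ne hj]
    have hβlen : miLen β = N := by
      have : miLen α = 1 + miLen β := by
        rw [hsum, miLen, miLen]
        simp [Finset.sum_add_distrib]
      omega
    rw [hsum, ← polyDeriv_polyDeriv, polyDeriv_single]
    refine (ih β hβlen _ j x).trans ?_
    have h1 : polyFun (pderiv i P) =
        fun y => fderiv ℝ (polyFun P) y (EuclideanSpace.single i 1) :=
      funext fun y => by rw [fderiv_polyFun_apply_single]
    rw [h1]
    have h2 : ContDiff ℝ (j + N : ℕ) (fderiv ℝ (polyFun P)) :=
      (contDiff_polyFun P (N := (j + N + 1 : ℕ))).fderiv_right (by norm_cast)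
    refine (norm_iteratedFDeriv_clm_apply_const h2.contDiffAt le_rfl).trans ?_
    rw [norm_iteratedFDeriv_fderiv, PiLp.norm_single, norm_one, one_mul]
    rfl

theorem abs_polyFun_polyDeriv_le (α : Fin n → ℕ) (P : MvPolynomial (Fin n) ℝ) (x : Euc n) :
    |polyFun (polyDeriv α P) x| ≤ ‖iteratedFDeriv ℝ (miLen α) (polyFun P) x‖ := by
  have := norm_iteratedFDeriv_polyDeriv_le (miLen α) α rfl P 0 x
  rw [norm_iteratedFDeriv_zero] at this
  rwa [Nat.zero_add] at this

theorem polyFun_injective {P Q : MvPolynomial (Fin n) ℝ} (h : polyFun P = polyFun Q) : P = Q :=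
  MvPolynomial.funext fun x => by
    have := congrFun h (WithLp.toLp 2 x)
    simpa [polyFun] using this

end Polynomials

/-! ### Whitney partitions of unity from dyadic grids -/

section WhitneyPartition

/-- A smooth bump function on the line whose integer translates add up to one. -/
noncomputable def lineBump (t : ℝ) : ℝ := Real.smoothTransition (t + 1) - Real.smoothTransition t

theorem lineBump_eq_zero {t : ℝ} (ht : 1 ≤ |t|) : lineBump t = 0 := by
  rcases le_abs.1 ht with h | h
  · rw [lineBump, Real.smoothTransition.one_of_one_le h,
      Real.smoothTransition.one_of_one_le (by linarith), sub_self]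
  · rw [lineBump, Real.smoothTransition.zero_of_nonpos (by linarith),
      Real.smoothTransition.zero_of_nonpos (by linarith), sub_self]

theorem contDiff_lineBump (N : ℕ) : ContDiff ℝ N lineBump :=
  ((Real.smoothTransition.contDiff (n := N)).comp (contDiff_id.add contDiff_const)).sub
    (Real.smoothTransition.contDiff (n := N))

theorem sum_Icc_int_sub (f : ℤ → ℝ) (a : ℤ) (N : ℕ) :
    ∑ j ∈ Finset.Icc a (a + N), (f j - f (j - 1)) = f (a + N) - f (a - 1) := by
  have h : Finset.Icc a (a + N) = (Finset.range (N + 1)).image fun t : ℕ => a + (t : ℤ) := by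
    ext x
    simp only [Finset.mem_Icc, Finset.mem_image, Finset.mem_range]
    constructor
    · rintro ⟨h1, h2⟩
      exact ⟨(x - a).toNat, by omega, by omega⟩
    · rintro ⟨t, ht, rfl⟩
      omega
  rw [h, Finset.sum_image (fun _ _ _ _ h => by simpa using h)]
  have := Finset.sum_range_sub (fun t : ℕ => f (a + t - 1)) (N + 1)
  push_cast at this
  simp only [add_zero] at this
  rw [show a + (N : ℤ) = a + (N + 1) - 1 by ring, ← this]
  refine Finset.sum_congr rfl fun t _ => ?_
  rw [show a + ((t : ℤ) + 1) - 1 = a + t by ring]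

/-- The sum telescopes to a value where the transition is 1 minus one where it is 0. The window of
six integers is deliberately wide, so that one index set serves a neighbourhood of any point with
floor `N`. -/
theorem sum_lineBump {t : ℝ} {N : ℤ} (h1 : (N : ℝ) - 1 < t) (h2 : t < N + 2) :
    ∑ l ∈ Finset.Icc (N - 2) (N + 3), lineBump (t - l) = 1 := by
  have := sum_Icc_int_sub (fun l : ℤ => -Real.smoothTransition (t - l)) (N - 2) 5
  rw [show N - 2 + ((5 : ℕ) : ℤ) = N + 3 by push_cast; ring] at this
  have h3 : ∀ l : ℤ, lineBump (t - l) =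
      -Real.smoothTransition (t - l) - -Real.smoothTransition (t - ((l - 1 : ℤ) : ℝ)) := by
    intro l
    rw [lineBump]
    push_cast
    ring_nf
  simp only [h3]
  rw [this]
  push_cast
  rw [Real.smoothTransition.zero_of_nonpos (by linarith),
    Real.smoothTransition.one_of_one_le (by linarith)]
  ring

variable {E : Type*} [NormedAddCommGroup E] [NormedSpace ℝ E] {m : ℕ} (e : E ≃L[ℝ] (Fin m → ℝ))

/-- The bump function of the cube with corner `h k`, of mesh `h`. -/
noncomputable def gridBump (h : ℝ) (k : Fin m → ℤ) (x : E) : ℝ :=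
  ∏ i, lineBump (e (h⁻¹ • x) i - k i)

/-- The grid point `h k`. -/
noncomputable def gridPoint (h : ℝ) (k : Fin m → ℤ) : E := h • e.symm fun i => (k i : ℝ)

/-- The indices of the bump functions that matter near `x`. -/
noncomputable def gridIndex (h : ℝ) (x : E) : Finset (Fin m → ℤ) :=
  Fintype.piFinset fun i => Finset.Icc (⌊e (h⁻¹ • x) i⌋ - 2) (⌊e (h⁻¹ • x) i⌋ + 3)

theorem card_gridIndex (h : ℝ) (x : E) : (gridIndex e h x).card = 6 ^ m := by
  rw [gridIndex, Fintype.card_piFinset]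
  have : ∀ a : ℤ, (Finset.Icc (a - 2) (a + 3)).card = 6 := fun a => by
    rw [Int.card_Icc]; omega
  simp [this]

theorem contDiff_gridBump (h : ℝ) (k : Fin m → ℤ) (N : ℕ) : ContDiff ℝ N (gridBump e h k) := by
  refine contDiff_prod fun i _ => (contDiff_lineBump N).comp (ContDiff.sub ?_ contDiff_const)
  have : ContDiff ℝ N fun x : E => e (h⁻¹ • x) :=
    e.contDiff.comp (contDiff_const.smul contDiff_id)
  exact contDiff_pi.1 this i

theorem norm_le_of_gridBump_ne_zero {h : ℝ} (hh : 0 < h) {k : Fin m → ℤ} {x : E}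
    (hx : gridBump e h k x ≠ 0) :
    ‖x - gridPoint e h k‖ ≤ ‖(e.symm : (Fin m → ℝ) →L[ℝ] E)‖ * h := by
  have h1 : ∀ i, |e (h⁻¹ • x) i - k i| ≤ 1 := fun i => by
    by_contra hcon
    exact hx (Finset.prod_eq_zero (Finset.mem_univ i) (lineBump_eq_zero (not_le.1 hcon).le))
  have h2 : x - gridPoint e h k = h • e.symm fun i => e (h⁻¹ • x) i - k i := by
    have : (fun i => e (h⁻¹ • x) i - k i) = e (h⁻¹ • x) - fun i => (k i : ℝ) := rfl
    rw [this, map_sub, smul_sub, e.symm_apply_apply, smul_smul, mul_inv_cancel₀ hh.ne', one_smul]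
    rfl
  rw [h2, norm_smul, Real.norm_eq_abs, abs_of_pos hh, mul_comm]
  gcongr
  refine ((e.symm : (Fin m → ℝ) →L[ℝ] E).le_opNorm _).trans ?_
  refine mul_le_of_le_one_right (norm_nonneg _) ?_
  exact (pi_norm_le_iff_of_nonneg zero_le_one).2 h1

theorem norm_le_of_mem_gridIndex {h : ℝ} (hh : 0 < h) {k : Fin m → ℤ} {x : E}
    (hk : k ∈ gridIndex e h x) :
    ‖x - gridPoint e h k‖ ≤ 3 * ‖(e.symm : (Fin m → ℝ) →L[ℝ] E)‖ * h := by
  have h1 : ∀ i, |e (h⁻¹ • x) i - k i| ≤ 3 := fun i => by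
    have := Finset.mem_Icc.1 (Fintype.mem_piFinset.1 hk i)
    have h3 := Int.floor_le (e (h⁻¹ • x) i)
    have h4 := Int.lt_floor_add_one (e (h⁻¹ • x) i)
    have h5 : ((⌊e (h⁻¹ • x) i⌋ : ℤ) : ℝ) - 2 ≤ k i := by exact_mod_cast this.1
    have h6 : (k i : ℝ) ≤ (⌊e (h⁻¹ • x) i⌋ : ℤ) + 3 := by exact_mod_cast this.2
    rw [abs_le]
    constructor <;> linarith
  have h2 : x - gridPoint e h k = h • e.symm fun i => e (h⁻¹ • x) i - k i := by
    have : (fun i => e (h⁻¹ • x) i - k i) = e (h⁻¹ • x) - fun i => (k i : ℝ) := rfl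
    rw [this, map_sub, smul_sub, e.symm_apply_apply, smul_smul, mul_inv_cancel₀ hh.ne', one_smul]
    rfl
  rw [h2, norm_smul, Real.norm_eq_abs, abs_of_pos hh, mul_comm]
  gcongr
  refine ((e.symm : (Fin m → ℝ) →L[ℝ] E).le_opNorm _).trans ?_
  rw [mul_comm 3]
  gcongr
  exact (pi_norm_le_iff_of_nonneg (by norm_num)).2 h1

theorem eventually_gridIndex (h : ℝ) (x : E) :
    ∀ᶠ y in 𝓝 x, (∀ k ∉ gridIndex e h x, gridBump e h k y = 0) ∧
      ∑ k ∈ gridIndex e h x, gridBump e h k y = 1 := by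
  have hcont : Continuous fun y : E => e (h⁻¹ • y) := e.continuous.comp (continuous_const_smul _)
  have h1 : ∀ᶠ y in 𝓝 x, ∀ i, |e (h⁻¹ • y) i - e (h⁻¹ • x) i| < 1 := by
    rw [eventually_all]
    intro i
    have h2 : Continuous fun y : E => |e (h⁻¹ • y) i - e (h⁻¹ • x) i| :=
      (((continuous_apply i).comp hcont).sub continuous_const).abs
    exact h2.continuousAt.eventually_lt continuousAt_const (by simp)
  filter_upwards [h1] with y hy
  have hfl : ∀ i, ((⌊e (h⁻¹ • x) i⌋ : ℤ) : ℝ) - 1 < e (h⁻¹ • y) i ∧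
      e (h⁻¹ • y) i < (⌊e (h⁻¹ • x) i⌋ : ℤ) + 2 := fun i => by
    have h3 := Int.floor_le (e (h⁻¹ • x) i)
    have h4 := Int.lt_floor_add_one (e (h⁻¹ • x) i)
    have h5 := abs_lt.1 (hy i)
    constructor <;> linarith
  constructor
  · intro k hk
    rw [gridIndex, Fintype.mem_piFinset] at hk
    push Not at hk
    obtain ⟨i, hi⟩ := hk
    refine Finset.prod_eq_zero (Finset.mem_univ i) (lineBump_eq_zero ?_)
    by_contra hcon
    rw [not_le, abs_lt] at hcon
    refine hi (Finset.mem_Icc.2 ⟨?_, ?_⟩)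
    · have : ((⌊e (h⁻¹ • x) i⌋ : ℤ) : ℝ) - 2 < k i := by linarith [(hfl i).1]
      exact_mod_cast this.le
    · have : (k i : ℝ) < (⌊e (h⁻¹ • x) i⌋ : ℤ) + 3 := by linarith [(hfl i).2]
      exact_mod_cast this.le
  · have := Finset.prod_univ_sum (fun i => Finset.Icc (⌊e (h⁻¹ • x) i⌋ - 2) (⌊e (h⁻¹ • x) i⌋ + 3))
      (fun i (l : ℤ) => lineBump (e (h⁻¹ • y) i - l))
    rw [gridIndex]
    simp only [gridBump]
    rw [← this]
    exact Finset.prod_eq_one fun i _ => sum_lineBump (hfl i).1 (hfl i).2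

/-- Every bump is `gridBump e 1 0` after a translation and the dilation by h⁻¹, which costs one
factor h⁻¹ per derivative; the model has compact support, hence bounded derivatives. -/
theorem exists_bound_gridBump (l : ℕ) : ∃ C : ℝ, 0 ≤ C ∧ ∀ (h : ℝ), 0 < h → ∀ (k : Fin m → ℤ)
    (x : E), ‖iteratedFDeriv ℝ l (gridBump e h k) x‖ ≤ C * h⁻¹ ^ l := by
  have hsupp : HasCompactSupport (gridBump e 1 0) := by
    refine HasCompactSupport.intro
      (e.toHomeomorph.isCompact_preimage.2 (isCompact_closedBall (0 : Fin m → ℝ) 1)) fun x hx => ?_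
    have hx' : ¬ ‖e x‖ ≤ 1 := by simpa using hx
    rw [pi_norm_le_iff_of_nonneg zero_le_one] at hx'
    push Not at hx'
    obtain ⟨i, hi⟩ := hx'
    refine Finset.prod_eq_zero (Finset.mem_univ i) (lineBump_eq_zero ?_)
    rw [Real.norm_eq_abs] at hi
    simpa using hi.le
  obtain ⟨C, hC⟩ := ((contDiff_gridBump e 1 0 l).continuous_iteratedFDeriv
    le_rfl).bounded_above_of_compact_support (hsupp.iteratedFDeriv (𝕜 := ℝ) l)
  refine ⟨C, (norm_nonneg _).trans (hC 0), fun h hh k x => ?_⟩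
  let g : E →L[ℝ] E := h⁻¹ • ContinuousLinearMap.id ℝ E
  have h1 : gridBump e h k =
      fun x => (fun y => gridBump e 1 0 (y - e.symm fun i => (k i : ℝ))) (g x) := by
    funext y
    simp only [gridBump, g]
    refine Finset.prod_congr rfl fun i _ => ?_
    simp
  have hcd : ContDiff ℝ l fun y => gridBump e 1 0 (y - e.symm fun i => (k i : ℝ)) :=
    (contDiff_gridBump e 1 0 l).comp (contDiff_id.sub contDiff_const)
  have h2 := ContinuousLinearMap.iteratedFDeriv_comp_right g hcd x le_rfl
  rw [h1]
  refine (congrArg norm h2).le.trans ?_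
  refine (ContinuousMultilinearMap.norm_compContinuousLinearMap_le _ _).trans ?_
  rw [iteratedFDeriv_comp_sub]
  have hg : ‖g‖ ≤ h⁻¹ := by
    refine ContinuousLinearMap.opNorm_le_bound _ (by positivity) fun y => ?_
    simp only [g, smul_apply, ContinuousLinearMap.id_apply]
    rw [norm_smul, Real.norm_eq_abs, abs_of_pos (inv_pos.2 hh)]
  have hCn : 0 ≤ C := (norm_nonneg _).trans (hC 0)
  rw [Finset.prod_const, Finset.card_univ, Fintype.card_fin]
  gcongr
  exact hC _

variable (K : Set E)

open Classical in
/-- A smooth function that is one near `K` and zero far from `K`, at the scale `h`. -/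
noncomputable def gridCutoff (h : ℝ) (x : E) : ℝ :=
  ∑ᶠ k : Fin m → ℤ,
    if Metric.infDist (gridPoint e h k) K ≤ (‖(e.symm : (Fin m → ℝ) →L[ℝ] E)‖ + 1) * h
    then gridBump e h k x else 0

open Classical in
theorem eventually_gridCutoff (h : ℝ) (x : E) :
    ∀ᶠ y in 𝓝 x, gridCutoff e K h y = ∑ k ∈ (gridIndex e h x).filter fun k =>
      Metric.infDist (gridPoint e h k) K ≤ (‖(e.symm : (Fin m → ℝ) →L[ℝ] E)‖ + 1) * h,
      gridBump e h k y := by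
  filter_upwards [eventually_gridIndex e h x] with y hy
  rw [gridCutoff, Finset.sum_filter]
  refine finsum_eq_sum_of_support_subset _ fun k hk => ?_
  by_contra hcon
  refine hk ?_
  simp only
  rw [hy.1 k (by simpa using hcon), ite_self]

/-- A bump that is non-zero at x has its grid point close enough to K to be selected, so the
selected sum at x is the full partition of unity. -/
theorem gridCutoff_eq_one {h : ℝ} (hh : 0 < h) {x : E} (hx : Metric.infDist x K ≤ h) :
    gridCutoff e K h x = 1 := by
  classical
  rw [(eventually_gridCutoff e K h x).self_of_nhds, Finset.sum_filter]
  refine (Finset.sum_congr rfl fun k _ => ?_).trans (eventually_gridIndex e h x).self_of_nhds.2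
  by_cases hk : gridBump e h k x = 0
  · rw [hk, ite_self]
  · rw [if_pos]
    have h1 := norm_le_of_gridBump_ne_zero e hh hk
    have h2 := Metric.infDist_le_infDist_add_dist (s := K) (x := gridPoint e h k) (y := x)
    rw [dist_comm, dist_eq_norm] at h2
    linarith

theorem infDist_le_of_gridCutoff_ne_zero {h : ℝ} (hh : 0 < h) {x : E}
    (hx : gridCutoff e K h x ≠ 0) :
    Metric.infDist x K ≤ (2 * ‖(e.symm : (Fin m → ℝ) →L[ℝ] E)‖ + 1) * h := by
  classical
  rw [(eventually_gridCutoff e K h x).self_of_nhds] at hx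
  obtain ⟨k, hk, hk0⟩ := Finset.exists_ne_zero_of_sum_ne_zero hx
  have h1 := norm_le_of_gridBump_ne_zero e hh hk0
  have h2 := (Finset.mem_filter.1 hk).2
  have h3 := Metric.infDist_le_infDist_add_dist (s := K) (x := x) (y := gridPoint e h k)
  rw [dist_eq_norm] at h3
  linarith

theorem contDiff_gridCutoff (h : ℝ) (N : ℕ) : ContDiff ℝ N (gridCutoff e K h) := by
  classical
  refine contDiff_iff_contDiffAt.2 fun x => ?_
  refine ContDiffAt.congr_of_eventuallyEq ?_ (eventually_gridCutoff e K h x)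
  exact (ContDiff.sum fun k _ => contDiff_gridBump e h k N).contDiffAt

theorem exists_bound_gridCutoff (l : ℕ) : ∃ C : ℝ, 0 ≤ C ∧ ∀ (h : ℝ), 0 < h → ∀ (x : E),
    ‖iteratedFDeriv ℝ l (gridCutoff e K h) x‖ ≤ C * h⁻¹ ^ l := by
  classical
  obtain ⟨C, hC0, hC⟩ := exists_bound_gridBump e l
  refine ⟨6 ^ m * C, by positivity, fun h hh x => ?_⟩
  rw [Filter.EventuallyEq.eq_of_nhds (Filter.EventuallyEq.iteratedFDeriv ℝ
    (eventually_gridCutoff e K h x) l),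
    iteratedFDeriv_fun_sum_apply fun k _ => (contDiff_gridBump e h k l).contDiffAt]
  refine (norm_sum_le_of_le _ fun k _ => hC h hh k x).trans ?_
  rw [Finset.sum_const, nsmul_eq_mul, mul_assoc]
  gcongr
  calc ((Finset.filter _ (gridIndex e h x)).card : ℝ) ≤ (gridIndex e h x).card := by
        exact_mod_cast Finset.card_filter_le _ _
    _ = 6 ^ m := by rw [card_gridIndex]; push_cast; rfl

/-- The members of the Whitney partition of unity. -/
noncomputable def whitneyBump (i : Σ _ : ℤ, Fin m → ℤ) (x : E) : ℝ :=
  (gridCutoff e K (2 ^ i.1) x - gridCutoff e K (2 ^ (i.1 - 1)) x) * gridBump e (2 ^ i.1) i.2 x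

theorem contDiff_whitneyBump (i : Σ _ : ℤ, Fin m → ℤ) (N : ℕ) :
    ContDiff ℝ N (whitneyBump e K i) :=
  ((contDiff_gridCutoff e K _ N).sub (contDiff_gridCutoff e K _ N)).mul
    (contDiff_gridBump e _ _ N)

theorem exists_bound_whitneyBump (l : ℕ) : ∃ C : ℝ, 0 ≤ C ∧ ∀ (i : Σ _ : ℤ, Fin m → ℤ) (x : E),
    ‖iteratedFDeriv ℝ l (whitneyBump e K i) x‖ ≤ C * ((2 : ℝ) ^ i.1)⁻¹ ^ l := by
  choose A hA0 hA using exists_bound_gridCutoff e K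
  choose B hB0 hB using fun l => exists_bound_gridBump e (E := E) (m := m) l
  refine ⟨∑ j ∈ Finset.range (l + 1), (l.choose j : ℝ) * (A j * (1 + 2 ^ j)) * B (l - j),
    Finset.sum_nonneg fun j _ => mul_nonneg (mul_nonneg (by positivity)
      (mul_nonneg (hA0 j) (by positivity))) (hB0 _), fun i x => ?_⟩
  have h2 : (0 : ℝ) < 2 ^ i.1 := by positivity
  have h2' : (0 : ℝ) < 2 ^ (i.1 - 1) := by positivity
  refine (norm_iteratedFDeriv_mul_le ((contDiff_gridCutoff e K _ l).sub
    (contDiff_gridCutoff e K _ l)) (contDiff_gridBump e _ _ l) x le_rfl).trans ?_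
  rw [Finset.sum_mul]
  refine Finset.sum_le_sum fun j hj => ?_
  have hj' : j ≤ l := by simpa [Nat.lt_succ_iff] using hj
  have h3 : ‖iteratedFDeriv ℝ j (fun x => gridCutoff e K (2 ^ i.1) x -
      gridCutoff e K (2 ^ (i.1 - 1)) x) x‖ ≤ A j * (1 + 2 ^ j) * ((2 : ℝ) ^ i.1)⁻¹ ^ j := by
    rw [fun_iteratedFDeriv_sub_apply (contDiff_gridCutoff e K _ j).contDiffAt
      (contDiff_gridCutoff e K _ j).contDiffAt]
    refine (norm_sub_le _ _).trans ((add_le_add (hA j _ h2 x) (hA j _ h2' x)).trans (le_of_eq ?_))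
    have : ((2 : ℝ) ^ (i.1 - 1))⁻¹ = 2 * ((2 : ℝ) ^ i.1)⁻¹ := by
      rw [zpow_sub_one₀ two_ne_zero, mul_inv, inv_inv, mul_comm]
    rw [this, mul_pow]
    ring
  have h4 := hB (l - j) _ h2 i.2 x
  have h5 : ((2 : ℝ) ^ i.1)⁻¹ ^ l = ((2 : ℝ) ^ i.1)⁻¹ ^ j * ((2 : ℝ) ^ i.1)⁻¹ ^ (l - j) := by
    rw [← pow_add, Nat.add_sub_cancel' hj']
  calc _ ≤ (l.choose j : ℝ) * (A j * (1 + 2 ^ j) * ((2 : ℝ) ^ i.1)⁻¹ ^ j) *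
        (B (l - j) * ((2 : ℝ) ^ i.1)⁻¹ ^ (l - j)) := by
        have := hA0 j
        gcongr
    _ = _ := by rw [h5]; ring

/-- A Whitney partition of unity on the complement of a closed set. -/
theorem exists_whitney_partition [FiniteDimensional ℝ E] {K : Set E} (hK : IsClosed K)
    (hne : K.Nonempty) :
    ∃ (φ : (Σ _ : ℤ, Fin (Module.finrank ℝ E) → ℤ) → E → ℝ)
      (a : (Σ _ : ℤ, Fin (Module.finrank ℝ E) → ℤ) → E) (N : ℕ) (A : ℝ) (C : ℕ → ℝ),
      0 ≤ A ∧ (∀ l, 0 ≤ C l) ∧ (∀ i, a i ∈ K) ∧ (∀ i (N : ℕ), ContDiff ℝ N (φ i)) ∧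
      ∀ x ∉ K, ∃ I : Finset (Σ _ : ℤ, Fin (Module.finrank ℝ E) → ℤ), I.card ≤ N ∧
        (∀ᶠ y in 𝓝 x, (∀ i ∉ I, φ i y = 0) ∧ ∑ i ∈ I, φ i y = 1) ∧
        ∀ i ∈ I, ‖x - a i‖ ≤ A * Metric.infDist x K ∧
          ∀ l, ‖iteratedFDeriv ℝ l (φ i) x‖ * Metric.infDist x K ^ l ≤ C l := by
  set e : E ≃L[ℝ] (Fin (Module.finrank ℝ E) → ℝ) := (Module.finBasis ℝ E).equivFunL with he
  have : ProperSpace E := FiniteDimensional.proper ℝ E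
  set L : ℝ := ‖(e.symm : (Fin (Module.finrank ℝ E) → ℝ) →L[ℝ] E)‖ with hL
  have hL0 : 0 ≤ L := norm_nonneg _
  choose B hB0 hB using exists_bound_whitneyBump e K
  choose pt hptK hpt using fun z => hK.exists_infDist_eq_dist hne z
  -- With 2^J ≤ d < 2^(J + 1), near x the cutoff is 1 at scales from J + 1 on and 0 at scales up to
  -- J - Q - 1, by the choice of `Q`. Only the Q + 2 scales between J - Q and J + 1 contribute, with
  -- 6^m indices each, where m is the dimension of E.
  obtain ⟨Q, hQ⟩ : ∃ Q : ℕ, 2 * L + 1 < 2 ^ Q := pow_unbounded_of_one_lt _ one_lt_two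
  refine ⟨whitneyBump e K, fun i => pt (gridPoint e (2 ^ i.1) i.2),
    (Q + 2) * 6 ^ (Module.finrank ℝ E), 12 * L + 1, fun l => B l * (2 ^ (Q + 1)) ^ l,
    by positivity, fun l => mul_nonneg (hB0 l) (by positivity), fun i => hptK _,
    fun i N => contDiff_whitneyBump e K i N, fun x hx => ?_⟩
  have hd : 0 < Metric.infDist x K := (hK.notMem_iff_infDist_pos hne).1 hx
  set d := Metric.infDist x K with hd_def
  obtain ⟨J, hJ1, hJ2⟩ := exists_mem_Ico_zpow hd (one_lt_two (α := ℝ))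
  have htwo : (0 : ℝ) < 2 := two_pos
  set I : Finset (Σ _ : ℤ, Fin (Module.finrank ℝ E) → ℤ) :=
    (Finset.Icc (J - Q) (J + 1)).sigma fun j => gridIndex e (2 ^ j) x with hI
  have hIcc : J + 1 = J - Q + ((Q + 1 : ℕ) : ℤ) := by push_cast; ring
  refine ⟨I, ?_, ?_, ?_⟩
  · rw [hI, Finset.card_sigma, Finset.sum_congr rfl fun j _ => card_gridIndex e (2 ^ j) x,
      Finset.sum_const, Int.card_Icc, smul_eq_mul]
    gcongr
    omega
  · have h1 : ∀ᶠ y in 𝓝 x, ∀ j ∈ Finset.Icc (J - Q) (J + 1),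
        (∀ k ∉ gridIndex e (2 ^ j) x, gridBump e (2 ^ j) k y = 0) ∧
          ∑ k ∈ gridIndex e (2 ^ j) x, gridBump e (2 ^ j) k y = 1 :=
      (Finset.eventually_all _).2 fun j _ => eventually_gridIndex e (2 ^ j) x
    have hcont : Continuous fun y => Metric.infDist y K := Metric.continuous_infDist_pt K
    have h2 : ∀ᶠ y in 𝓝 x, (2 : ℝ) ^ (J - 1) < Metric.infDist y K :=
      hcont.continuousAt.eventually (lt_mem_nhds (lt_of_lt_of_le
        (zpow_lt_zpow_right₀ one_lt_two (by omega)) hJ1))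
    have h3 : ∀ᶠ y in 𝓝 x, Metric.infDist y K < (2 : ℝ) ^ (J + 1) :=
      hcont.continuousAt.eventually (gt_mem_nhds hJ2)
    filter_upwards [h1, h2, h3] with y hy1 hy2 hy3
    have hone : ∀ j : ℤ, J + 1 ≤ j → gridCutoff e K (2 ^ j) y = 1 := fun j hj =>
      gridCutoff_eq_one e K (by positivity)
        (hy3.le.trans (zpow_le_zpow_right₀ one_le_two hj))
    have hzero : ∀ j : ℤ, j ≤ J - Q - 1 → gridCutoff e K (2 ^ j) y = 0 := fun j hj => by
      by_contra hcon
      have h4 := infDist_le_of_gridCutoff_ne_zero e K (by positivity) hcon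
      have h5 : (2 * L + 1) * (2 : ℝ) ^ j ≤ 2 ^ Q * 2 ^ (J - Q - 1) := by
        have : (2 : ℝ) ^ j ≤ 2 ^ (J - Q - 1) := zpow_le_zpow_right₀ one_le_two hj
        gcongr
      have h6 : (2 : ℝ) ^ Q * 2 ^ (J - Q - 1) = 2 ^ (J - 1) := by
        rw [← zpow_natCast, ← zpow_add₀ two_ne_zero]
        congr 1
        ring
      linarith
    constructor
    · rintro ⟨j, k⟩ hjk
      rw [hI, Finset.mem_sigma, not_and_or] at hjk
      simp only [whitneyBump]
      by_cases hj : j ∈ Finset.Icc (J - (Q : ℤ)) (J + 1)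
      · rw [(hy1 j hj).1 k (hjk.resolve_left (not_not.2 hj)), mul_zero]
      · rw [Finset.mem_Icc, not_and_or] at hj
        rcases hj with hj | hj
        · rw [hzero j (by omega), hzero (j - 1) (by omega), sub_self, zero_mul]
        · rw [hone j (by omega), hone (j - 1) (by omega), sub_self, zero_mul]
    · rw [hI, Finset.sum_sigma]
      simp only [whitneyBump]
      -- At each scale the grid bumps add up to one; what remains is a telescoping sum of cutoffs.
      rw [Finset.sum_congr rfl fun j hj => by
        rw [← Finset.mul_sum, (hy1 j hj).2, mul_one]]
      have := sum_Icc_int_sub (fun j => gridCutoff e K (2 ^ j) y) (J - Q) (Q + 1)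
      rw [← hIcc] at this
      rw [this, hone (J + 1) le_rfl, hzero (J - Q - 1) le_rfl, sub_zero]
  · rintro ⟨j, k⟩ hjk
    rw [hI, Finset.mem_sigma, Finset.mem_Icc] at hjk
    obtain ⟨⟨hj1, hj2⟩, hk⟩ := hjk
    simp only at hj1 hj2 hk ⊢
    have hh : (0 : ℝ) < 2 ^ j := by positivity
    have hh1 : (2 : ℝ) ^ j ≤ 2 * d := by
      have h1 : (2 : ℝ) ^ j ≤ 2 ^ (J + 1) := zpow_le_zpow_right₀ one_le_two hj2
      rw [zpow_add_one₀ two_ne_zero] at h1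
      linarith
    have hh2 : d * ((2 : ℝ) ^ j)⁻¹ ≤ 2 ^ (Q + 1) := by
      rw [mul_inv_le_iff₀ hh]
      refine hJ2.le.trans ?_
      rw [← zpow_natCast, ← zpow_add₀ two_ne_zero]
      exact zpow_le_zpow_right₀ one_le_two (by push_cast; omega)
    constructor
    -- The grid point is within 6 L d of x, hence within d + 6 L d of its nearest point of K;
    -- together this gives 12 L + 1.
    · have h1 := norm_le_of_mem_gridIndex e hh hk
      have h2 := hpt (gridPoint e (2 ^ j) k)
      have h3 := Metric.infDist_le_infDist_add_dist (s := K) (x := gridPoint e (2 ^ j) k) (y := x)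
      rw [dist_comm, dist_eq_norm] at h3
      rw [dist_eq_norm] at h2
      have h4 := norm_sub_le_norm_sub_add_norm_sub x (gridPoint e (2 ^ j) k)
        (pt (gridPoint e (2 ^ j) k))
      have h5 : 3 * L * (2 : ℝ) ^ j ≤ 3 * L * (2 * d) := by gcongr
      linarith
    · intro l
      have h1 := hB l ⟨j, k⟩ x
      calc _ ≤ B l * ((2 : ℝ) ^ j)⁻¹ ^ l * d ^ l := by gcongr
        _ = B l * (d * ((2 : ℝ) ^ j)⁻¹) ^ l := by rw [mul_pow]; ring
        _ ≤ _ := by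
          have := hB0 l
          gcongr

end WhitneyPartition

/-! ### Whitney's extension theorem -/

section WhitneyExtension

variable {E : Type*} [NormedAddCommGroup E] [NormedSpace ℝ E]

/-- The compatibility of two Taylor polynomials at one of their base points controls their
difference everywhere. -/
theorem norm_iteratedFDeriv_sub_le_of_compatible {p : ℕ} {f g : E → ℝ}
    (hf : ContDiff ℝ (p + 1 : ℕ) f) (hg : ContDiff ℝ (p + 1 : ℕ) g)
    (hf0 : ∀ x, iteratedFDeriv ℝ (p + 1) f x = 0) (hg0 : ∀ x, iteratedFDeriv ℝ (p + 1) g x = 0)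
    {a b : E} {ε : ℝ} (hε : 0 ≤ ε)
    (h : ∀ k ≤ p, ‖iteratedFDeriv ℝ k (fun x => f x - g x) b‖ ≤ ε * ‖b - a‖ ^ (p - k))
    {k : ℕ} (hk : k ≤ p) (x : E) {s : ℝ} (hs : ‖x - b‖ ≤ s) (hs' : ‖b - a‖ ≤ s) :
    ‖iteratedFDeriv ℝ k (fun x => f x - g x) x‖ ≤ (p + 1) * ε * s ^ (p - k) := by
  have h0 : ∀ x, iteratedFDeriv ℝ (p + 1) (fun x => f x - g x) x = 0 := fun x => by
    rw [fun_iteratedFDeriv_sub_apply hf.contDiffAt hg.contDiffAt, hf0, hg0, sub_zero]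
  have hs0 : 0 ≤ s := (norm_nonneg _).trans hs
  refine (norm_iteratedFDeriv_le_of_iteratedFDeriv_eq_zero (hf.sub hg) h0 hk b x).trans ?_
  have h1 : ∀ j ∈ Finset.range (p + 1 - k),
      ‖iteratedFDeriv ℝ (k + j) (fun x => f x - g x) b‖ * ‖x - b‖ ^ j ≤ ε * s ^ (p - k) := by
    intro j hj
    rw [Finset.mem_range] at hj
    calc _ ≤ ε * ‖b - a‖ ^ (p - (k + j)) * ‖x - b‖ ^ j := by
          gcongr; exact h _ (by omega)
      _ ≤ ε * s ^ (p - (k + j)) * s ^ j := by gcongr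
      _ = ε * s ^ (p - k) := by rw [mul_assoc, ← pow_add]; congr 2; omega
  refine (Finset.sum_le_sum h1).trans ?_
  rw [Finset.sum_const, Finset.card_range, nsmul_eq_mul, mul_assoc]
  gcongr
  have : p + 1 - k ≤ p + 1 := Nat.sub_le _ _
  exact_mod_cast this

/-- The jets of T_x on K and of F off K are shown to form a Taylor series of F. At c in K, the term
of order m differs from D^m T_c by at most ε |x - c|^(p - m), with ε arbitrary. For m < p this is
o(|x - c|), so the term has the derivative of D^m T_c; for m = p it gives continuity. -/
theorem contDiff_of_jet_approx {p : ℕ} {K : Set E} (hK : IsClosed K)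
    {T : E → E → ℝ} (hT : ∀ a ∈ K, ContDiff ℝ (p + 1 : ℕ) (T a)) {F : E → ℝ}
    (hFK : ∀ a ∈ K, F a = T a a) (hF : ∀ x ∉ K, ContDiffAt ℝ p F x)
    (hin : ∀ c ∈ K, ∀ ε > 0, ∀ᶠ x in 𝓝 c, x ∈ K → ∀ k ≤ p,
      ‖iteratedFDeriv ℝ k (T x) x - iteratedFDeriv ℝ k (T c) x‖ ≤ ε * ‖x - c‖ ^ (p - k))
    (hout : ∀ c ∈ K, ∀ ε > 0, ∀ᶠ x in 𝓝 c, x ∉ K → ∀ k ≤ p,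
      ‖iteratedFDeriv ℝ k F x - iteratedFDeriv ℝ k (T c) x‖ ≤ ε * ‖x - c‖ ^ (p - k)) :
    ContDiff ℝ p F := by
  classical
  let q : E → FormalMultilinearSeries ℝ E ℝ := fun x =>
    if x ∈ K then ftaylorSeries ℝ (T x) x else ftaylorSeries ℝ F x
  have hqK : ∀ x ∈ K, ∀ k, q x k = iteratedFDeriv ℝ k (T x) x := fun x hx k => by
    simp only [q, if_pos hx]; rfl
  have hqF : ∀ x ∉ K, ∀ k, q x k = iteratedFDeriv ℝ k F x := fun x hx k => by
    simp only [q, if_neg hx]; rfl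
  have hq : ∀ c ∈ K, ∀ ε > 0, ∀ᶠ x in 𝓝 c, ∀ k ≤ p,
      ‖q x k - iteratedFDeriv ℝ k (T c) x‖ ≤ ε * ‖x - c‖ ^ (p - k) := by
    intro c hc ε hε
    filter_upwards [hin c hc ε hε, hout c hc ε hε] with x h1 h2 k hk
    by_cases hx : x ∈ K
    · rw [hqK x hx]; exact h1 hx k hk
    · rw [hqF x hx]; exact h2 hx k hk
  have hnear : ∀ x ∉ K, ∀ k, (fun y => q y k) =ᶠ[𝓝 x] iteratedFDeriv ℝ k F := fun x hx k => by
    filter_upwards [hK.isOpen_compl.mem_nhds hx] with y hy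
    exact hqF y hy k
  have hder : ∀ m < p, ∀ x, HasFDerivAt (fun y => q y m) (q x (m + 1)).curryLeft x := by
    intro m hm x
    by_cases hx : x ∈ K
    · have hd : HasFDerivAt (iteratedFDeriv ℝ m (T x)) (q x (m + 1)).curryLeft x := by
        have h1 := ((hT x hx).differentiable_iteratedFDeriv
          (by exact_mod_cast (by omega : m < p + 1)) x).hasFDerivAt
        rw [hqK x hx]
        convert h1 using 1
        ext v w
        rw [ContinuousMultilinearMap.curryLeft_apply, iteratedFDeriv_succ_apply_left]
        simp
      have hr : HasFDerivAt (fun y => q y m - iteratedFDeriv ℝ m (T x) y)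
          (0 : E →L[ℝ] (E [×m]→L[ℝ] ℝ)) x := by
        rw [hasFDerivAt_iff_isLittleO_nhds_zero, Asymptotics.isLittleO_iff]
        intro ε hε
        have h2 : ∀ᶠ y in 𝓝 x, ‖y - x‖ ≤ 1 := by
          filter_upwards [Metric.closedBall_mem_nhds x one_pos] with y hy
          rwa [← dist_eq_norm]
        have h3 : Tendsto (fun h : E => x + h) (𝓝 0) (𝓝 x) := by
          have : Continuous fun h : E => x + h := by fun_prop
          simpa using this.tendsto 0
        filter_upwards [h3.eventually (hq x hx ε hε), h3.eventually h2] with h h4 h5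
        rw [hqK x hx, sub_self, sub_zero, zero_apply, sub_zero]
        rw [add_sub_cancel_left] at h5
        refine (h4 m hm.le).trans ?_
        rw [add_sub_cancel_left]
        gcongr
        calc ‖h‖ ^ (p - m) ≤ ‖h‖ ^ 1 :=
              pow_le_pow_of_le_one (norm_nonneg _) h5 (by omega)
          _ = ‖h‖ := pow_one _
      have h6 := hr.add hd
      rw [zero_add] at h6
      exact h6.congr_of_eventuallyEq (Eventually.of_forall fun y => by simp)
    · refine HasFDerivAt.congr_of_eventuallyEq ?_ (hnear x hx m)
      have h1 := ((hF x hx).differentiableAt_iteratedFDeriv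
        (by exact_mod_cast hm)).hasFDerivAt
      rw [hqF x hx]
      convert h1 using 1
      ext v w
      rw [ContinuousMultilinearMap.curryLeft_apply, iteratedFDeriv_succ_apply_left]
      simp
  have hcont : ∀ m ≤ p, Continuous fun y => q y m := by
    intro m hm
    rcases hm.lt_or_eq with hm | rfl
    · exact continuous_iff_continuousAt.2 fun x => (hder m hm x).continuousAt
    · refine continuous_iff_continuousAt.2 fun x => ?_
      by_cases hx : x ∈ K
      · have h1 : Tendsto (fun y => q y m - iteratedFDeriv ℝ m (T x) y) (𝓝 x) (𝓝 0) := by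
          rw [Metric.tendsto_nhds]
          intro ε hε
          filter_upwards [hq x hx (ε / 2) (by positivity)] with y hy
          have := hy m le_rfl
          rw [Nat.sub_self, pow_zero, mul_one] at this
          rw [dist_zero_right]
          linarith
        have h2 : Tendsto (iteratedFDeriv ℝ m (T x)) (𝓝 x) (𝓝 (iteratedFDeriv ℝ m (T x) x)) :=
          ((hT x hx).continuous_iteratedFDeriv (by exact_mod_cast Nat.le_succ m)).tendsto x
        have h3 := h1.add h2
        rw [zero_add] at h3
        rw [ContinuousAt, hqK x hx]
        simpa using h3
      · exact ((hF x hx).continuousAt_iteratedFDeriv le_rfl).congr (hnear x hx m).symm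
  have hT : HasFTaylorSeriesUpTo (p : WithTop ℕ∞) F q := by
    refine ⟨fun x => ?_, fun m hm x => hder m (by exact_mod_cast hm) x,
      fun m hm => hcont m (by exact_mod_cast hm)⟩
    by_cases hx : x ∈ K
    · rw [hqK x hx, hFK x hx]
      exact iteratedFDeriv_zero_apply _
    · rw [hqF x hx]
      exact iteratedFDeriv_zero_apply _
  exact hT.contDiff

/-- **Whitney's extension theorem**, for a compatible family of Taylor polynomials on a closed
subset of a finite-dimensional space. -/
theorem exists_contDiff_of_whitney [FiniteDimensional ℝ E] {p : ℕ} {K : Set E} (hK : IsClosed K)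
    {T : E → E → ℝ} (hT : ∀ a ∈ K, ContDiff ℝ (p + 1 : ℕ) (T a))
    (hT0 : ∀ a ∈ K, ∀ x, iteratedFDeriv ℝ (p + 1) (T a) x = 0)
    (hW : ∀ c ∈ K, ∀ ε > 0, ∃ δ > 0, ∀ a ∈ K, ∀ b ∈ K, a ∈ Metric.ball c δ → b ∈ Metric.ball c δ →
      ∀ k ≤ p, ‖iteratedFDeriv ℝ k (fun x => T b x - T a x) b‖ ≤ ε * ‖b - a‖ ^ (p - k)) :
    ∃ F : E → ℝ, ContDiff ℝ p F ∧ ∀ a ∈ K, F a = T a a := by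
  classical
  rcases K.eq_empty_or_nonempty with rfl | hne
  · exact ⟨fun _ => 0, contDiff_const, by simp⟩
  have : ProperSpace E := FiniteDimensional.proper ℝ E
  obtain ⟨φ, pt, N, A, C, hA, hC, hptK, hφ, hpart⟩ := exists_whitney_partition hK hne
  have hTle : ∀ a ∈ K, ∀ k ≤ p + 1, ContDiff ℝ k (T a) := fun a ha k hk =>
    (hT a ha).of_le (by exact_mod_cast hk)
  let F : E → ℝ := fun x => if x ∈ K then T x x else ∑ᶠ i, φ i x * T (pt i) x
  have hFK : ∀ a ∈ K, F a = T a a := fun a ha => if_pos ha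
  have hFnear : ∀ x ∉ K, ∀ I : Finset _, (∀ᶠ y in 𝓝 x, (∀ i ∉ I, φ i y = 0) ∧
      ∑ i ∈ I, φ i y = 1) → F =ᶠ[𝓝 x] fun y => ∑ i ∈ I, φ i y * T (pt i) y := by
    intro x hx I hI
    filter_upwards [hI, hK.isOpen_compl.mem_nhds hx] with y hy hyK
    refine (if_neg hyK).trans (finsum_eq_sum_of_support_subset _ fun i hi => ?_)
    by_contra hcon
    exact hi (by simp [hy.1 i (by simpa using hcon)])
  refine ⟨F, contDiff_of_jet_approx hK hT hFK ?_ ?_ ?_, hFK⟩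
  · intro x hx
    obtain ⟨I, -, hI, -⟩ := hpart x hx
    refine ContDiffAt.congr_of_eventuallyEq ?_ (hFnear x hx I hI)
    exact (ContDiff.sum fun i _ => (hφ i p).mul (hTle _ (hptK i) p (by omega))).contDiffAt
  · intro c hc ε hε
    obtain ⟨δ, hδ, h⟩ := hW c hc ε hε
    filter_upwards [Metric.ball_mem_nhds c hδ] with x hx hxK k hk
    rw [← fun_iteratedFDeriv_sub_apply (hTle x hxK k (by omega)).contDiffAt
      (hTle c hc k (by omega)).contDiffAt]
    exact h c hc x hxK (Metric.mem_ball_self hδ) hx k hk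
  · intro c hc ε hε
    set B : ℝ := ∑ k ∈ Finset.range (p + 1), ∑ l ∈ Finset.range (k + 1),
      (k.choose l : ℝ) * C l * ((p + 1) * (2 * A + 1) ^ (p - (k - l))) with hB
    have hB0 : 0 ≤ B := Finset.sum_nonneg fun k _ => Finset.sum_nonneg fun l _ =>
      mul_nonneg (mul_nonneg (by positivity) (hC l)) (by positivity)
    -- `N * B` comes from comparing F with T_a, and the second term from comparing T_a with T_c,
    -- where a is a point of K nearest to x; the 1 makes `D` positive.
    set D : ℝ := N * B + (p + 1) * 3 ^ p + 1 with hD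
    have hD0 : 0 < D := by positivity
    set η : ℝ := ε / D with hη
    have hη0 : 0 < η := by positivity
    obtain ⟨δ, hδ, h⟩ := hW c hc η hη0
    -- Small enough to keep a (at distance at most 2 |x - c| from c) and the base points (at most (A
    -- + 1) |x - c|) in the ball of radius `δ`.
    have hδ' : 0 < δ / (A + 2) := by positivity
    filter_upwards [Metric.ball_mem_nhds c hδ'] with x hx hxK k hk
    rw [Metric.mem_ball, lt_div_iff₀ (by positivity), dist_eq_norm] at hx
    obtain ⟨I, hIcard, hI, hIb⟩ := hpart x hxK
    -- The comparison goes through a nearest point a and not directly through c: the derivatives of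
    -- the bumps grow like powers of 1/d, which only differences T_(pt i) - T_a, bounded by powers
    -- of d, can absorb.
    obtain ⟨a, haK, had⟩ := hK.exists_infDist_eq_dist hne x
    set d := Metric.infDist x K with hd
    have hd0 : 0 < d := (hK.notMem_iff_infDist_pos hne).1 hxK
    have hdc : d ≤ ‖x - c‖ := by rw [← dist_eq_norm]; exact Metric.infDist_le_dist_of_mem hc
    rw [dist_eq_norm] at had
    have hac : ‖a - c‖ ≤ 2 * ‖x - c‖ := by
      have := norm_sub_le_norm_sub_add_norm_sub a x c
      rw [norm_sub_rev a x] at this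
      linarith
    have hxc0 : 0 ≤ A * ‖x - c‖ := by positivity
    have hac' : a ∈ Metric.ball c δ := by
      rw [Metric.mem_ball, dist_eq_norm]; linarith
    have hFx : iteratedFDeriv ℝ k F x - iteratedFDeriv ℝ k (T a) x =
        ∑ i ∈ I, iteratedFDeriv ℝ k (fun y => φ i y * (T (pt i) y - T a y)) x := by
      have h1 : (fun y => F y - T a y) =ᶠ[𝓝 x] fun y => ∑ i ∈ I, φ i y * (T (pt i) y - T a y) := by
        filter_upwards [hFnear x hxK I hI, hI] with y hy1 hy2
        rw [hy1]
        simp only [mul_sub]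
        rw [Finset.sum_sub_distrib, ← Finset.sum_mul, hy2.2, one_mul]
      have hFc : ContDiffAt ℝ k F x := by
        refine ContDiffAt.congr_of_eventuallyEq ?_ (hFnear x hxK I hI)
        exact (ContDiff.sum fun i _ => (hφ i k).mul (hTle _ (hptK i) k (by omega))).contDiffAt
      rw [← fun_iteratedFDeriv_sub_apply hFc (hTle a haK k (by omega)).contDiffAt,
        (h1.iteratedFDeriv ℝ k).eq_of_nhds, iteratedFDeriv_fun_sum_apply]
      exact fun i _ => ((hφ i k).mul ((hTle _ (hptK i) k (by omega)).sub
        (hTle a haK k (by omega)))).contDiffAt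
    have hterm : ∀ i ∈ I, ‖iteratedFDeriv ℝ k (fun y => φ i y * (T (pt i) y - T a y)) x‖ ≤
        B * (η * d ^ (p - k)) := by
      intro i hi
      obtain ⟨hi1, hi2⟩ := hIb i hi
      have hpa : ‖pt i - a‖ ≤ (2 * A + 1) * d := by
        have h1 := norm_sub_le_norm_sub_add_norm_sub (pt i) x a
        rw [norm_sub_rev (pt i) x] at h1
        have : 0 ≤ A * d := by positivity
        linarith
      have hpx : ‖x - pt i‖ ≤ (2 * A + 1) * d := by
        have : 0 ≤ A * d := by positivity
        linarith
      have hpc : pt i ∈ Metric.ball c δ := by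
        rw [Metric.mem_ball, dist_eq_norm]
        have h1 := norm_sub_le_norm_sub_add_norm_sub (pt i) x c
        rw [norm_sub_rev (pt i) x] at h1
        have : A * d ≤ A * ‖x - c‖ := by gcongr
        have : 0 < ‖x - c‖ := hd0.trans_le hdc
        linarith
      have hdiff : ∀ j ≤ p, ‖iteratedFDeriv ℝ j (fun y => T (pt i) y - T a y) x‖ ≤
          (p + 1) * η * ((2 * A + 1) * d) ^ (p - j) := fun j hj =>
        norm_iteratedFDeriv_sub_le_of_compatible (hT _ (hptK i)) (hT a haK) (hT0 _ (hptK i))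
          (hT0 a haK) hη0.le (fun j hj => h a haK _ (hptK i) hac' hpc j hj) hj x hpx hpa
      refine (norm_iteratedFDeriv_mul_le (hφ i k) ((hTle _ (hptK i) k (by omega)).sub
        (hTle a haK k (by omega))) x le_rfl).trans ?_
      have hkB : ∑ l ∈ Finset.range (k + 1),
          (k.choose l : ℝ) * C l * ((p + 1) * (2 * A + 1) ^ (p - (k - l))) ≤ B :=
        Finset.single_le_sum (f := fun k => ∑ l ∈ Finset.range (k + 1),
          (k.choose l : ℝ) * C l * ((p + 1) * (2 * A + 1) ^ (p - (k - l))))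
          (fun k _ => Finset.sum_nonneg fun l _ =>
            mul_nonneg (mul_nonneg (by positivity) (hC l)) (by positivity))
          (Finset.mem_range.2 (by omega))
      refine le_trans ?_ (mul_le_mul_of_nonneg_right hkB (by positivity))
      rw [Finset.sum_mul]
      refine Finset.sum_le_sum fun l hl => ?_
      have hl' : l ≤ k := by simpa [Nat.lt_succ_iff] using hl
      have h1 := hdiff (k - l) (by omega)
      have h2 := hi2 l
      have h3 : d ^ (p - (k - l)) = d ^ l * d ^ (p - k) := by rw [← pow_add]; congr 1; omega
      calc _ ≤ (k.choose l : ℝ) * ‖iteratedFDeriv ℝ l (φ i) x‖ *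
            ((p + 1) * η * ((2 * A + 1) * d) ^ (p - (k - l))) := by gcongr
        _ = (k.choose l : ℝ) * (‖iteratedFDeriv ℝ l (φ i) x‖ * d ^ l) *
            ((p + 1) * (2 * A + 1) ^ (p - (k - l))) * (η * d ^ (p - k)) := by
            rw [mul_pow, h3]; ring
        _ ≤ _ := by gcongr
    have h1 : ‖iteratedFDeriv ℝ k F x - iteratedFDeriv ℝ k (T a) x‖ ≤
        N * B * (η * ‖x - c‖ ^ (p - k)) := by
      rw [hFx]
      refine (norm_sum_le_of_le _ hterm).trans ?_
      rw [Finset.sum_const, nsmul_eq_mul, ← mul_assoc]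
      have : (I.card : ℝ) ≤ N := by exact_mod_cast hIcard
      gcongr
    have h2 : ‖iteratedFDeriv ℝ k (T a) x - iteratedFDeriv ℝ k (T c) x‖ ≤
        (p + 1) * 3 ^ p * (η * ‖x - c‖ ^ (p - k)) := by
      rw [← fun_iteratedFDeriv_sub_apply (hTle a haK k (by omega)).contDiffAt
        (hTle c hc k (by omega)).contDiffAt]
      have h3 := norm_iteratedFDeriv_sub_le_of_compatible (hT a haK) (hT c hc) (hT0 a haK)
        (hT0 c hc) hη0.le (fun j hj => h c hc a haK (Metric.mem_ball_self hδ) hac' j hj) hk x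
        (s := 3 * ‖x - c‖) (by linarith [norm_nonneg (x - c)]) (by linarith [norm_nonneg (x - c)])
      refine h3.trans ?_
      have h4 : (3 : ℝ) ^ (p - k) ≤ 3 ^ p := pow_le_pow_right₀ (by norm_num) (Nat.sub_le _ _)
      calc (p + 1) * η * (3 * ‖x - c‖) ^ (p - k) =
            (p + 1) * 3 ^ (p - k) * (η * ‖x - c‖ ^ (p - k)) := by rw [mul_pow]; ring
        _ ≤ _ := by gcongr
    have h5 : ε = D * η := by rw [hη]; field_simp
    have h6 := norm_sub_le_norm_sub_add_norm_sub (iteratedFDeriv ℝ k F x)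
      (iteratedFDeriv ℝ k (T a) x) (iteratedFDeriv ℝ k (T c) x)
    have h7 : 0 ≤ η * ‖x - c‖ ^ (p - k) := by positivity
    calc _ ≤ N * B * (η * ‖x - c‖ ^ (p - k)) + (p + 1) * 3 ^ p * (η * ‖x - c‖ ^ (p - k)) := by
          linarith
      _ ≤ D * (η * ‖x - c‖ ^ (p - k)) := by rw [hD]; linarith
      _ = _ := by rw [h5]; ring

end WhitneyExtension

/-! ### Functionals on polynomials of bounded degree -/

section DualOfPolynomials

/-- In finite dimension a subspace of the dual is its own double annihilator. Membership in a fibre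
can thus be tested on the polynomials that the fibre kills. -/
theorem Submodule.mem_of_forall_dual {V : Type*} [AddCommGroup V] [Module ℝ V]
    [FiniteDimensional ℝ V] (S : Submodule ℝ (Module.Dual ℝ V)) (ξ : Module.Dual ℝ V)
    (h : ∀ v, (∀ η ∈ S, η v = 0) → ξ v = 0) : ξ ∈ S := by
  by_contra hξ
  obtain ⟨φ, hφ, hS⟩ := Submodule.exists_le_ker_of_notMem hξ
  have hv : ∀ η, φ η = η ((Module.evalEquiv ℝ V).symm φ) := fun η => by simp
  refine hφ ?_
  rw [hv]
  exact h _ fun η hη => by rw [← hv]; exact hS hη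

variable {n p : ℕ}

theorem deltaDual_apply (a : Euc n) (P : PolyLE n p) : deltaDual a P = polyFun P.1 a := rfl

theorem span_range_deltaDual : Submodule.span ℝ (Set.range (deltaDual (n := n) (p := p))) = ⊤ := by
  refine (Submodule.eq_top_iff'.2 fun ξ => Submodule.mem_of_forall_dual _ _ fun P hP => ?_)
  have : P = 0 := by
    refine Subtype.ext (polyFun_injective (funext fun x => ?_))
    have := hP (deltaDual x) (Submodule.subset_span ⟨x, rfl⟩)
    rw [deltaDual_apply] at this
    rw [this]
    simp [polyFun]
  rw [this, map_zero]

/-- Point evaluations span the dual, and convergence passes to linear combinations. -/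
theorem tendsto_dual_apply_of_pointwise {ι : Type*} {l : Filter ι} {P : ι → PolyLE n p}
    {Q : PolyLE n p} (h : ∀ x, Tendsto (fun i => polyFun (P i).1 x) l (𝓝 (polyFun Q.1 x)))
    (η : PolyDual n p) : Tendsto (fun i => η (P i)) l (𝓝 (η Q)) := by
  have hη : η ∈ Submodule.span ℝ (Set.range (deltaDual (n := n) (p := p))) := by
    rw [span_range_deltaDual]; trivial
  induction hη using Submodule.span_induction with
  | mem η hη => obtain ⟨x, rfl⟩ := hη; exact h x
  | zero => simpa using tendsto_const_nhds
  | add η ξ _ _ h1 h2 => simpa using h1.add h2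
  | smul c η _ h1 => simpa using h1.const_mul c

theorem tendsto_dual_apply {ι : Type*} {l : Filter ι} {ξ : ι → PolyDual n p} {ζ : PolyDual n p}
    {P : ι → PolyLE n p} {Q : PolyLE n p} (hξ : Tendsto ξ l (𝓝 ζ))
    (h : ∀ η : PolyDual n p, Tendsto (fun i => η (P i)) l (𝓝 (η Q))) :
    Tendsto (fun i => ξ i (P i)) l (𝓝 (ζ Q)) := by
  let β := Module.finBasis ℝ (PolyLE n p)
  have hexp : ∀ (η : PolyDual n p) (R : PolyLE n p), η R = ∑ k, β.coord k R * η (β k) := by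
    intro η R
    conv_lhs => rw [← β.sum_repr R, map_sum]
    simp
  simp only [hexp (ξ _) (P _), hexp ζ Q]
  exact tendsto_finsetSum _ fun k _ => (h (β.coord k)).mul (tendsto_polyDual_iff.1 hξ (β k))

theorem exists_polyLE_eq_taylorAt (p : ℕ) (F : Euc n → ℝ) (a : Euc n) :
    ∃ P : PolyLE n p, polyFun P.1 = taylorAt p F a := by
  classical
  have hX : ∀ i, (MvPolynomial.X i - MvPolynomial.C (a i) :
      MvPolynomial (Fin n) ℝ).totalDegree ≤ 1 := fun i => by
    refine (MvPolynomial.totalDegree_sub _ _).trans ?_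
    simp
  have hj : ∀ j ∈ Finset.range (p + 1), ∀ M : ContinuousMultilinearMap ℝ (fun _ : Fin j => Euc n) ℝ,
      ∃ P ∈ PolyLE n p, ∀ x, polyFun P x = M fun _ => x - a := by
    intro j hj M
    refine ⟨∑ r : Fin j → Fin n, MvPolynomial.C (M fun i => EuclideanSpace.single (r i) 1) *
      ∏ i, (MvPolynomial.X (r i) - MvPolynomial.C (a (r i))), ?_, fun x => ?_⟩
    · refine Submodule.sum_mem _ fun r _ => ?_
      rw [MvPolynomial.mem_restrictTotalDegree]
      refine (MvPolynomial.totalDegree_mul _ _).trans ?_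
      rw [MvPolynomial.totalDegree_C, zero_add]
      refine (MvPolynomial.totalDegree_finsetProd _ _).trans ?_
      refine (Finset.sum_le_sum fun i _ => hX (r i)).trans ?_
      rw [Finset.mem_range] at hj
      simp
      omega
    · have hx : (fun _ : Fin j => x - a) =
          fun _ => ∑ i, (x - a) i • EuclideanSpace.single i (1 : ℝ) := by
        funext _
        have := (EuclideanSpace.basisFun (Fin n) ℝ).sum_repr (x - a)
        simpa using this.symm
      rw [hx]
      have h1 := M.toMultilinearMap.map_sum
        (fun (_ : Fin j) (i : Fin n) => (x - a) i • EuclideanSpace.single i (1 : ℝ))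
      refine Eq.trans ?_ h1.symm
      rw [polyFun, map_sum]
      refine Finset.sum_congr rfl fun r _ => ?_
      have h2 := M.toMultilinearMap.map_smul_univ (fun i => (x - a) (r i))
        (fun i => EuclideanSpace.single (r i) (1 : ℝ))
      rw [h2]
      simp [mul_comm]
  choose! P hP hPx using fun j => hj j
  refine ⟨⟨∑ j ∈ Finset.range (p + 1), P j ((j.factorial : ℝ)⁻¹ • iteratedFDeriv ℝ j F a),
    Submodule.sum_mem _ fun j hj => hP j hj _⟩, funext fun x => ?_⟩
  rw [taylorAt, polyFun, map_sum]
  exact Finset.sum_congr rfl fun j hj => hPx j hj _ x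

theorem dualCoeff_eq (ξ : PolyDual n p) (b : Euc n) {α : Fin n → ℕ} (hα : miLen α ≤ p) :
    dualCoeff ξ b α hα = ξ ⟨taylorMonomial b α, taylorMonomial_mem b hα⟩ := rfl

/-- Taylor's formula at b, paired with ξ. It turns the bounds on the coefficients ξ_α(b) in ΔΦ into
bounds on values. -/
theorem dual_apply_eq_sum (ξ : PolyDual n p) (b : Euc n) (P : PolyLE n p) :
    ξ P = ∑ α ∈ (miLE n p).attach,
      polyFun (polyDeriv α.1 P.1) b * dualCoeff ξ b α.1 (mem_miLE.1 α.2) := by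
  have h1 : P = ∑ α ∈ (miLE n p).attach, polyFun (polyDeriv α.1 P.1) b •
      (⟨taylorMonomial b α.1, taylorMonomial_mem b (mem_miLE.1 α.2)⟩ : PolyLE n p) := by
    refine Subtype.ext ?_
    rw [AddSubmonoidClass.coe_finsetSum]
    conv_lhs => rw [polyLE_eq_sum_taylorMonomial P.2 b, ← Finset.sum_attach]
    refine Finset.sum_congr rfl fun α _ => ?_
    rw [Submodule.coe_smul, MvPolynomial.smul_eq_C_mul]
  conv_lhs => rw [h1, map_sum]
  refine Finset.sum_congr rfl fun α _ => ?_
  rw [map_smul, smul_eq_mul, dualCoeff_eq]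

end DualOfPolynomials

/-- A `C^p` map on an open set agrees near a compact ball with a `C^p` map on the whole space. -/
theorem exists_contDiff_eqOn_closedBall {E F : Type*} [NormedAddCommGroup E] [NormedSpace ℝ E]
    [HasContDiffBump E] [NormedAddCommGroup F] [NormedSpace ℝ F] {p : ℕ} {U : Set E} (hU : IsOpen U)
    {f : E → F} (hf : ContDiffOn ℝ p f U) {c : E} {r R : ℝ} (hr : 0 < r) (hrR : r < R)
    (hR : Metric.closedBall c R ⊆ U) :
    ∃ g : E → F, ContDiff ℝ p g ∧ Set.EqOn g f (Metric.closedBall c r) := by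
  let b : ContDiffBump c := ⟨r, R, hr, hrR⟩
  refine ⟨fun x => b x • f x, contDiff_iff_contDiffAt.2 fun x => ?_, fun x hx => ?_⟩
  · by_cases hx : x ∈ U
    · exact b.contDiffAt.smul (hf.contDiffAt (hU.mem_nhds hx))
    · have hx' : x ∈ (Metric.closedBall c R)ᶜ := fun h => hx (hR h)
      refine ContDiffAt.congr_of_eventuallyEq (f := fun _ => (0 : F)) contDiffAt_const ?_
      filter_upwards [Metric.isClosed_closedBall.isOpen_compl.mem_nhds hx'] with y hy
      have hy' : R < dist y c := by simpa using hy
      rw [b.zero_of_le_dist hy'.le, zero_smul]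
  · simp only
    rw [b.one_of_mem_closedBall hx, one_smul]

/-! ### The paratangent bundle and ∇^p f through their fibres -/

section Bundles

variable {n : ℕ}

/-- The fibres of the paratangent bundle. -/
noncomputable def paratangentFibre (p : ℕ) (X : Set (Euc n)) : Euc n → Submodule ℝ (PolyDual n p) :=
  (glaeserFibre LinearMap.id X)^[2 * Module.finrank ℝ (PolyDual n p)]
    fun a => Submodule.span ℝ {deltaDual a}

theorem paratangentBundle_eq (p : ℕ) (X : Set (Euc n)) :
    paratangentBundle p X = bundleOf X (paratangentFibre p X) := by
  have h : {q : Euc n × PolyDual n p | q.1 ∈ X ∧ ∃ t : ℝ, q.2 = t • deltaDual q.1} =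
      bundleOf X fun a => Submodule.span ℝ {deltaDual a} := by
    ext q
    simp only [bundleOf, Set.mem_ofPred_eq, Submodule.mem_span_singleton, eq_comm]
  rw [paratangentBundle, saturation, h, glaeserOp_iterate_bundleOf]
  rfl

open Classical in
/-- The fibres of the initial bundle of `∇^p f`. -/
noncomputable def graphFibre (p : ℕ) {X : Set (Euc n)} (f : X → ℝ) (a : Euc n) :
    Submodule ℝ (PolyDual n p × ℝ) :=
  if h : a ∈ X then Submodule.span ℝ {(deltaDual a, f ⟨a, h⟩)} else ⊥

/-- The fibres of `∇^p f`. -/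
noncomputable def nablaFibre (p : ℕ) {X : Set (Euc n)} (f : X → ℝ) :
    Euc n → Submodule ℝ (PolyDual n p × ℝ) :=
  (glaeserFibre (LinearMap.fst ℝ (PolyDual n p) ℝ) X)^[2 * Module.finrank ℝ (PolyDual n p × ℝ)]
    (graphFibre p f)

theorem graphFibre_of_mem (p : ℕ) {X : Set (Euc n)} (f : X → ℝ) {a : Euc n} (ha : a ∈ X) :
    graphFibre p f a = Submodule.span ℝ {(deltaDual a, f ⟨a, ha⟩)} := dif_pos ha

theorem nablaBundle_eq (p : ℕ) {X : Set (Euc n)} (f : X → ℝ) :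
    nablaBundle p f = bundleOf X (nablaFibre p f) := by
  have h : {q : Euc n × (PolyDual n p × ℝ) | ∃ (a : X) (t : ℝ),
      q = ((a : Euc n), t • deltaDual (a : Euc n), t * f a)} = bundleOf X (graphFibre p f) := by
    ext ⟨x, ξ, r⟩
    simp only [bundleOf, Set.mem_ofPred_eq]
    constructor
    · rintro ⟨a, t, h⟩
      simp only [Prod.mk.injEq] at h
      obtain ⟨rfl, rfl, rfl⟩ := h
      refine ⟨a.2, ?_⟩
      rw [graphFibre_of_mem p f a.2]
      exact Submodule.mem_span_singleton.2 ⟨t, rfl⟩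
    · rintro ⟨hx, h⟩
      rw [graphFibre_of_mem p f hx] at h
      obtain ⟨t, ht⟩ := Submodule.mem_span_singleton.1 h
      refine ⟨⟨x, hx⟩, t, ?_⟩
      rw [← ht]
      rfl
  rw [nablaBundle, saturation, h, glaeserOp_iterate_bundleOf]
  rfl

theorem deltaDual_ne_zero (p : ℕ) (a : Euc n) : (deltaDual a : PolyDual n p) ≠ 0 := by
  intro h
  have h1 : (1 : MvPolynomial (Fin n) ℝ) ∈ PolyLE n p := by
    rw [MvPolynomial.mem_restrictTotalDegree]; simp
  have := LinearMap.congr_fun h ⟨1, h1⟩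
  simp [deltaDual] at this

theorem one_le_finrank_span_deltaDual (p : ℕ) (a : Euc n) :
    1 ≤ Module.finrank ℝ (Submodule.span ℝ {(deltaDual a : PolyDual n p)}) :=
  (finrank_span_singleton (deltaDual_ne_zero p a)).ge

theorem one_le_finrank_graphFibre (p : ℕ) {X : Set (Euc n)} (f : X → ℝ) {a : Euc n} (ha : a ∈ X) :
    1 ≤ Module.finrank ℝ (graphFibre p f a) := by
  rw [graphFibre_of_mem p f ha, finrank_span_singleton]
  intro h
  exact deltaDual_ne_zero p a (congrArg Prod.fst h)

theorem glaeserFibre_paratangentFibre (p : ℕ) {X : Set (Euc n)} {a : Euc n} (ha : a ∈ X) :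
    glaeserFibre LinearMap.id X (paratangentFibre p X) a = paratangentFibre p X a :=
  glaeserFibre_saturated _ _ (fun a _ => one_le_finrank_span_deltaDual p a) ha

theorem glaeserFibre_nablaFibre (p : ℕ) {X : Set (Euc n)} (f : X → ℝ) {a : Euc n} (ha : a ∈ X) :
    glaeserFibre (LinearMap.fst ℝ (PolyDual n p) ℝ) X (nablaFibre p f) a = nablaFibre p f a :=
  glaeserFibre_saturated _ _ (fun _ ha => one_le_finrank_graphFibre p f ha) ha

theorem le_iterate_glaeserFibre {p : ℕ} {W : Type*} [AddCommGroup W] [Module ℝ W]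
    [TopologicalSpace W] [ContinuousSMul ℝ W] (pr : W →ₗ[ℝ] PolyDual n p) {X : Set (Euc n)}
    (S : Euc n → Submodule ℝ W) (k : ℕ) {a : Euc n} (ha : a ∈ X) :
    S a ≤ (glaeserFibre pr X)^[k] S a := by
  induction k with
  | zero => exact le_rfl
  | succ k ih =>
    rw [Function.iterate_succ_apply']
    exact ih.trans (le_glaeserFibre pr _ ha)

theorem deltaDual_mem_paratangentFibre (p : ℕ) {X : Set (Euc n)} {a : Euc n} (ha : a ∈ X) :
    deltaDual a ∈ paratangentFibre p X a :=
  le_iterate_glaeserFibre _ _ _ ha (Submodule.mem_span_singleton_self _)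

theorem graph_mem_nablaFibre (p : ℕ) {X : Set (Euc n)} (f : X → ℝ) (a : X) :
    ((deltaDual (a : Euc n), f a) : PolyDual n p × ℝ) ∈ nablaFibre p f a := by
  refine le_iterate_glaeserFibre _ _ _ a.2 ?_
  rw [graphFibre_of_mem p f a.2]
  exact Submodule.mem_span_singleton_self _

end Bundles

/-! ### Restrictions of C^p functions: ∇^p f is a graph -/

section Necessity

variable {n p : ℕ}

/-- The map `ξ ↦ (ξ, ξ(Q))`. -/
noncomputable def graphMap (Q : PolyLE n p) : PolyDual n p →ₗ[ℝ] PolyDual n p × ℝ :=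
  LinearMap.id.prod (Module.Dual.eval ℝ (PolyLE n p) Q)

theorem graphMap_apply (Q : PolyLE n p) (ξ : PolyDual n p) : graphMap Q ξ = (ξ, ξ Q) := rfl

/-- A field of polynomials that is compatible near the point `c`, in the sense of Whitney. -/
structure CompatibleAt (T : Euc n → PolyLE n p) (c : Euc n) : Prop where
  tendsto : ∀ η : PolyDual n p, Tendsto (fun a => η (T a)) (𝓝 c) (𝓝 (η (T c)))
  compat : ∀ ε > 0, ∀ᶠ q : Euc n × Euc n in 𝓝 (c, c), ∀ k ≤ p,
    ‖iteratedFDeriv ℝ k (polyFun ((T q.2).1 - (T q.1).1)) q.2‖ ≤ ε * ‖q.2 - q.1‖ ^ (p - k)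

/-- The value splits as (v + w)(T_a) + w(T_b - T_a). The first part converges because both the
functional and the polynomial do. In the Taylor expansion of the second at b, the factor |a - b|^(p
- |α|) from compatibility meets the coefficient w_α(b) that it controls. -/
theorem CompatibleAt.tendsto_add {T : Euc n → PolyLE n p} {c : Euc n} (hT : CompatibleAt T c)
    {ι : Type*} {l : Filter ι} {a b : ι → Euc n} {v w : ι → PolyDual n p} {ξ : PolyDual n p}
    (ha : Tendsto a l (𝓝 c)) (hb : Tendsto b l (𝓝 c))
    (hvw : Tendsto (fun i => v i + w i) l (𝓝 ξ))
    (hbd : ∀ᶠ i in l, ∀ (α : Fin n → ℕ) (hα : miLen α ≤ p),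
      ‖a i - b i‖ ^ (p - miLen α) * |dualCoeff (w i) (b i) α hα| ≤ 1) :
    Tendsto (fun i => v i (T (a i)) + w i (T (b i))) l (𝓝 (ξ (T c))) := by
  have h1 : Tendsto (fun i => (v i + w i) (T (a i))) l (𝓝 (ξ (T c))) :=
    tendsto_dual_apply hvw fun η => (hT.tendsto η).comp ha
  have h2 : Tendsto (fun i => w i (T (b i) - T (a i))) l (𝓝 0) := by
    rw [Metric.tendsto_nhds]
    intro ε hε
    set N : ℝ := (miLE n p).attach.card + 1 with hN
    have hN0 : 0 < N := by positivity
    have hab : Tendsto (fun i => (a i, b i)) l (𝓝 (c, c)) := ha.prodMk_nhds hb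
    filter_upwards [hbd, hab.eventually (hT.compat (ε / N) (by positivity))] with i h3 h4
    rw [dist_zero_right, dual_apply_eq_sum (w i) (b i)]
    have h5 : ∀ α ∈ (miLE n p).attach,
        ‖polyFun (polyDeriv α.1 (T (b i) - T (a i) : PolyLE n p).1) (b i) *
          dualCoeff (w i) (b i) α.1 (mem_miLE.1 α.2)‖ ≤ ε / N := by
      intro α _
      have hα := mem_miLE.1 α.2
      have h6 := (abs_polyFun_polyDeriv_le α.1 (T (b i) - T (a i) : PolyLE n p).1 (b i)).trans
        (h4 _ hα)
      have h7 := h3 α.1 hα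
      rw [norm_sub_rev] at h6
      rw [norm_mul, Real.norm_eq_abs, Real.norm_eq_abs]
      calc _ ≤ ε / N * ‖a i - b i‖ ^ (p - miLen α.1) *
            |dualCoeff (w i) (b i) α.1 (mem_miLE.1 α.2)| := by gcongr
        _ = ε / N * (‖a i - b i‖ ^ (p - miLen α.1) *
            |dualCoeff (w i) (b i) α.1 (mem_miLE.1 α.2)|) := by ring
        _ ≤ ε / N * 1 := by gcongr
        _ = ε / N := mul_one _
    refine (norm_sum_le_of_le _ h5).trans_lt ?_
    rw [Finset.sum_const, nsmul_eq_mul]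
    calc _ < N * (ε / N) := by
          have : ((miLE n p).attach.card : ℝ) < N := by rw [hN]; linarith
          gcongr
      _ = ε := by field_simp
  have h3 := h1.add h2
  rw [add_zero] at h3
  refine h3.congr fun i => ?_
  rw [LinearMap.add_apply, map_sub]
  ring

/-- Replaces the closure by limits along a filter on which the decomposition v + w has been chosen.
-/
theorem exists_filter_of_mem_bundlePrime {W : Type*} [AddCommGroup W] [Module ℝ W]
    [TopologicalSpace W] {pr : W →ₗ[ℝ] PolyDual n p} {X : Set (Euc n)} {Φ : Set (Euc n × W)}
    {c : Euc n} {u : W} (h : (c, u) ∈ bundlePrime pr X Φ) :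
    ∃ (l : Filter (Euc n × Euc n × W)) (_ : l.NeBot) (a b : Euc n × Euc n × W → Euc n)
      (v w : Euc n × Euc n × W → W),
      (∀ᶠ q in l, a q ∈ X ∧ b q ∈ X ∧ (a q, v q) ∈ Φ ∧ (b q, w q) ∈ Φ ∧
        ∀ (α : Fin n → ℕ) (hα : miLen α ≤ p),
          ‖a q - b q‖ ^ (p - miLen α) * |dualCoeff (pr (w q)) (b q) α hα| ≤ 1) ∧
      Tendsto a l (𝓝 c) ∧ Tendsto b l (𝓝 c) ∧ Tendsto (fun q => v q + w q) l (𝓝 u) := by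
  classical
  have hex : ∀ q ∈ bundleDelta pr X Φ, ∃ vw : W × W, q.1 ∈ X ∧ q.2.1 ∈ X ∧ (q.1, vw.1) ∈ Φ ∧
      (q.2.1, vw.2) ∈ Φ ∧ (∀ (α : Fin n → ℕ) (hα : miLen α ≤ p),
          ‖q.1 - q.2.1‖ ^ (p - miLen α) * |dualCoeff (pr vw.2) q.2.1 α hα| ≤ 1) ∧
      vw.1 + vw.2 = q.2.2 := by
    rintro q ⟨a, ha, b, hb, v, w, hv, hw, hbd, rfl⟩
    exact ⟨(v, w), ha, hb, hv, hw, hbd, rfl⟩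
  choose! vw hvw using hex
  have hmem : ∀ᶠ q in 𝓝[bundleDelta pr X Φ] (c, c, u), q ∈ bundleDelta pr X Φ :=
    self_mem_nhdsWithin
  have hle : 𝓝[bundleDelta pr X Φ] (c, c, u) ≤ 𝓝 (c, c, u) := nhdsWithin_le_nhds
  refine ⟨𝓝[bundleDelta pr X Φ] (c, c, u), mem_closure_iff_nhdsWithin_neBot.1 h.2,
    fun q => q.1, fun q => q.2.1, fun q => (vw q).1, fun q => (vw q).2, ?_, ?_, ?_, ?_⟩
  · filter_upwards [hmem] with q hq
    obtain ⟨h1, h2, h3, h4, h5, -⟩ := hvw q hq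
    exact ⟨h1, h2, h3, h4, h5⟩
  · exact (continuous_fst.tendsto (c, c, u)).mono_left hle
  · exact ((continuous_fst.comp continuous_snd).tendsto (c, c, u)).mono_left hle
  · have : Tendsto (fun q : Euc n × Euc n × W => q.2.2) (𝓝[bundleDelta pr X Φ] (c, c, u)) (𝓝 u) :=
      ((continuous_snd.comp continuous_snd).tendsto (c, c, u)).mono_left hle
    exact this.congr' (hmem.mono fun q hq => (hvw q hq).2.2.2.2.2.symm)

/-- The Glaeser operation respects graphs of compatible polynomial fields. -/
theorem glaeserFibre_map_graphMap {X : Set (Euc n)} {T : Euc n → PolyLE n p}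
    (hT : ∀ c ∈ X, CompatibleAt T c) {τ : Euc n → Submodule ℝ (PolyDual n p)}
    {N : Euc n → Submodule ℝ (PolyDual n p × ℝ)}
    (hN : ∀ a ∈ X, N a = (τ a).map (graphMap (T a))) {c : Euc n} (hc : c ∈ X) :
    glaeserFibre (LinearMap.fst ℝ (PolyDual n p) ℝ) X N c =
      (glaeserFibre LinearMap.id X τ c).map (graphMap (T c)) := by
  have hgr : ∀ a ∈ X, ∀ v ∈ N a, v.1 ∈ τ a ∧ v.2 = v.1 (T a) := by
    intro a ha v hv
    rw [hN a ha] at hv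
    obtain ⟨ξ, hξ, rfl⟩ := hv
    exact ⟨hξ, rfl⟩
  refine le_antisymm (Submodule.span_le.2 ?_) ?_
  · rintro ⟨ξ, r⟩ hξ
    obtain ⟨l, hl, a, b, v, w, hΔ, ha, hb, hvw⟩ := exists_filter_of_mem_bundlePrime hξ
    have hvw1 : Tendsto (fun q => (v q).1 + (w q).1) l (𝓝 ξ) :=
      (continuous_fst.tendsto (ξ, r)).comp hvw
    have hvw2 : Tendsto (fun q => (v q).2 + (w q).2) l (𝓝 r) :=
      (continuous_snd.tendsto (ξ, r)).comp hvw
    have hlim := (hT c hc).tendsto_add ha hb hvw1 (hΔ.mono fun q hq => hq.2.2.2.2)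
    have hr : r = ξ (T c) := by
      refine tendsto_nhds_unique hvw2 (hlim.congr' (hΔ.mono fun q hq => ?_))
      exact congrArg₂ (· + ·) (hgr _ hq.1 _ hq.2.2.1.2).2.symm (hgr _ hq.2.1 _ hq.2.2.2.1.2).2.symm
    refine ⟨ξ, ?_, by rw [graphMap_apply, hr]⟩
    exact mem_glaeserFibre_of_tendsto hc 1 (hΔ.mono fun q hq => ⟨hq.1, hq.2.1,
      (hgr _ hq.1 _ hq.2.2.1.2).1, (hgr _ hq.2.1 _ hq.2.2.2.1.2).1, hq.2.2.2.2⟩) ha hb hvw1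
  · rw [glaeserFibre, Submodule.map_span, Submodule.span_le]
    rintro _ ⟨ξ, hξ, rfl⟩
    obtain ⟨l, hl, a, b, v, w, hΔ, ha, hb, hvw⟩ := exists_filter_of_mem_bundlePrime hξ
    have hlim := (hT c hc).tendsto_add ha hb hvw (hΔ.mono fun q hq => hq.2.2.2.2)
    refine mem_glaeserFibre_of_tendsto (v := fun q => graphMap (T (a q)) (v q))
      (w := fun q => graphMap (T (b q)) (w q)) hc 1 (hΔ.mono fun q hq => ⟨hq.1, hq.2.1, ?_, ?_,
        hq.2.2.2.2⟩) ha hb (hvw.prodMk_nhds hlim)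
    · rw [hN _ hq.1]
      exact Submodule.mem_map_of_mem hq.2.2.1.2
    · rw [hN _ hq.2.1]
      exact Submodule.mem_map_of_mem hq.2.2.2.1.2

theorem nablaFibre_eq_map_graphMap {X : Set (Euc n)} {T : Euc n → PolyLE n p}
    (hT : ∀ c ∈ X, CompatibleAt T c) {f : X → ℝ} (hf : ∀ a : X, f a = polyFun (T a).1 a)
    {a : Euc n} (ha : a ∈ X) :
    nablaFibre p f a = (paratangentFibre p X a).map (graphMap (T a)) := by
  have key : ∀ k, ∀ a ∈ X,
      (glaeserFibre (LinearMap.fst ℝ (PolyDual n p) ℝ) X)^[k] (graphFibre p f) a =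
      ((glaeserFibre LinearMap.id X)^[k] (fun a => Submodule.span ℝ {deltaDual a}) a).map
        (graphMap (T a)) := by
    intro k
    induction k with
    | zero =>
      intro a ha
      simp only [Function.iterate_zero, id_eq]
      rw [graphFibre_of_mem p f ha, Submodule.map_span, Set.image_singleton, graphMap_apply,
        deltaDual_apply, hf]
    | succ k ih =>
      intro a ha
      rw [Function.iterate_succ_apply', Function.iterate_succ_apply']
      exact glaeserFibre_map_graphMap hT ih ha
  rw [nablaFibre, key _ a ha, paratangentFibre]
  congr 1
  -- The saturation in W × ℝ takes two more iterations than the one in W, where W is the dual of the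
  -- polynomials; stationarity makes them irrelevant.
  refine glaeserFibre_iterate_eq_of_le _ _ (fun a _ => one_le_finrank_span_deltaDual p a) ha ?_
  rw [Module.finrank_prod]
  omega

theorem nablaIsFunction_of_compatible {X : Set (Euc n)} {T : Euc n → PolyLE n p}
    (hT : ∀ c ∈ X, CompatibleAt T c) {f : X → ℝ} (hf : ∀ a : X, f a = polyFun (T a).1 a) :
    NablaIsFunction p f := by
  refine ⟨fun e => e.1.2 (T e.1.1), ?_⟩
  rw [nablaBundle_eq]
  ext ⟨a, ξ, r⟩
  constructor
  · rintro ⟨ha, h⟩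
    simp only at ha h
    rw [nablaFibre_eq_map_graphMap hT hf ha] at h
    obtain ⟨η, hη, h⟩ := h
    rw [graphMap_apply, Prod.mk.injEq] at h
    obtain ⟨rfl, rfl⟩ := h
    exact ⟨⟨(a, η), by rw [paratangentBundle_eq]; exact ⟨ha, hη⟩⟩, rfl⟩
  · rintro ⟨⟨⟨b, η⟩, he⟩, h⟩
    simp only [Prod.mk.injEq] at h
    obtain ⟨rfl, rfl, rfl⟩ := h
    rw [paratangentBundle_eq] at he
    refine ⟨he.1, ?_⟩
    simp only
    rw [nablaFibre_eq_map_graphMap hT hf he.1]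
    exact ⟨_, he.2, rfl⟩

/-- The Taylor polynomials of a `C^p` function form a compatible field. -/
theorem exists_compatible_of_contDiffOn {U : Set (Euc n)} (hU : IsOpen U) {F : Euc n → ℝ}
    (hF : ContDiffOn ℝ p F U) :
    ∃ T : Euc n → PolyLE n p, (∀ a, polyFun (T a).1 a = F a) ∧ ∀ c ∈ U, CompatibleAt T c := by
  choose T hT using fun a => exists_polyLE_eq_taylorAt p F a
  have hval : ∀ (G : Euc n → ℝ) a, taylorAt p G a a = G a := fun G a => by
    rw [taylorAt, Finset.sum_eq_single_of_mem 0 (by simp)]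
    · simp
    · intro j _ hj
      have : (fun _ : Fin j => a - a) = 0 := by funext; simp
      rw [this]
      have : Nonempty (Fin j) := ⟨⟨0, Nat.pos_of_ne_zero hj⟩⟩
      exact ContinuousMultilinearMap.map_zero _
  refine ⟨T, fun a => by rw [hT, hval], fun c hc => ?_⟩
  obtain ⟨R, hR, hRU⟩ := Metric.nhds_basis_closedBall.mem_iff.1 (hU.mem_nhds hc)
  -- Taylor's theorem above concerns functions on the whole space; near c the Taylor polynomials of
  -- F are those of the global function `G`.
  obtain ⟨G, hG, hGF⟩ := exists_contDiff_eqOn_closedBall hU hF (half_pos hR) (half_lt_self hR) hRU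
  have hTG : ∀ᶠ a in 𝓝 c, polyFun (T a).1 = taylorAt p G a := by
    filter_upwards [Metric.ball_mem_nhds c (half_pos hR)] with a ha
    have h1 : F =ᶠ[𝓝 a] G := by
      filter_upwards [Metric.isOpen_ball.mem_nhds ha] with y hy
      exact (hGF (Metric.ball_subset_closedBall hy)).symm
    rw [hT]
    funext x
    rw [taylorAt, taylorAt]
    refine Finset.sum_congr rfl fun j _ => ?_
    rw [(h1.iteratedFDeriv ℝ j).eq_of_nhds]
  constructor
  · refine tendsto_dual_apply_of_pointwise fun x => ?_
    have h1 : Continuous fun a => taylorAt p G a x := by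
      unfold taylorAt
      refine continuous_finsetSum _ fun j hj => ?_
      rw [Finset.mem_range] at hj
      have h2 : Continuous (iteratedFDeriv ℝ j G) :=
        hG.continuous_iteratedFDeriv (by exact_mod_cast (by omega : j ≤ p))
      have h3 : Continuous fun a => (fun _ : Fin j => x - a) :=
        continuous_pi fun _ => continuous_const.sub continuous_id
      exact (h2.const_smul ((j.factorial : ℝ)⁻¹)).eval h3
    rw [hTG.self_of_nhds]
    exact (h1.tendsto c).congr' (hTG.mono fun a ha => (congrFun ha x).symm)
  · intro ε hε
    have h1 : ∀ᶠ q : Euc n × Euc n in 𝓝 (c, c), polyFun (T q.1).1 = taylorAt p G q.1 :=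
      (continuous_fst.tendsto (c, c)).eventually hTG
    have h2 : ∀ᶠ q : Euc n × Euc n in 𝓝 (c, c), polyFun (T q.2).1 = taylorAt p G q.2 :=
      (continuous_snd.tendsto (c, c)).eventually hTG
    filter_upwards [h1, h2, eventually_norm_iteratedFDeriv_sub_taylorAt_le hG c hε] with q h1 h2 h3
      k hk
    have h4 : polyFun ((T q.2).1 - (T q.1).1) = fun x => taylorAt p G q.2 x - taylorAt p G q.1 x := by
      rw [← h1, ← h2]; funext x; simp [polyFun]
    have h5 := h3 k hk
    have hGk : ContDiff ℝ k G := hG.of_le (by exact_mod_cast hk)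
    rw [fun_iteratedFDeriv_sub_apply hGk.contDiffAt (contDiff_taylorAt p G _).contDiffAt,
      ← iteratedFDeriv_taylorAt_self hk hG] at h5
    rw [h4, fun_iteratedFDeriv_sub_apply (contDiff_taylorAt p G _).contDiffAt
      (contDiff_taylorAt p G _).contDiffAt]
    exact h5

theorem ExtendsCp.nablaIsFunction {U X : Set (Euc n)} (hU : IsOpen U) (hXU : X ⊆ U) {f : X → ℝ}
    (h : ExtendsCp p U f) : NablaIsFunction p f := by
  obtain ⟨F, hF, hFf⟩ := h
  obtain ⟨T, hT, hTc⟩ := exists_compatible_of_contDiffOn hU hF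
  exact nablaIsFunction_of_compatible (fun c hc => hTc c (hXU hc)) fun a => by rw [hT, hFf]

end Necessity

/-! ### From a graph to a Whitney field in a parametrization -/

section Sufficiency

variable {n p : ℕ}

/-- A subspace that is a graph is the graph of a linear function. It extends to the whole dual and,
by reflexivity, is evaluation at a polynomial. This polynomial need not be unique: only its pairing
with the paratangent fibre is determined. -/
theorem NablaIsFunction.exists_polynomial {X : Set (Euc n)} {f : X → ℝ} (hf : NablaIsFunction p f) :
    ∃ Q : Euc n → PolyLE n p, ∀ a ∈ X,
      nablaFibre p f a = (paratangentFibre p X a).map (graphMap (Q a)) := by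
  obtain ⟨g, hg⟩ := hf
  rw [nablaBundle_eq] at hg
  have hτ : ∀ a ∈ X, ∀ ξ ∈ paratangentFibre p X a, (a, ξ) ∈ paratangentBundle p X := by
    intro a ha ξ hξ
    rw [paratangentBundle_eq]
    exact ⟨ha, hξ⟩
  have hmem : ∀ a (ha : a ∈ X) ξ (hξ : ξ ∈ paratangentFibre p X a),
      (ξ, g ⟨(a, ξ), hτ a ha ξ hξ⟩) ∈ nablaFibre p f a := by
    intro a ha ξ hξ
    have : (a, ξ, g ⟨(a, ξ), hτ a ha ξ hξ⟩) ∈ bundleOf X (nablaFibre p f) := by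
      rw [hg]
      exact ⟨⟨(a, ξ), hτ a ha ξ hξ⟩, rfl⟩
    exact this.2
  have huniq : ∀ a (ha : a ∈ X) ξ r, (ξ, r) ∈ nablaFibre p f a →
      ∃ hξ : ξ ∈ paratangentFibre p X a, r = g ⟨(a, ξ), hτ a ha ξ hξ⟩ := by
    intro a ha ξ r h
    have h1 : (a, ξ, r) ∈ bundleOf X (nablaFibre p f) := ⟨ha, h⟩
    rw [hg] at h1
    obtain ⟨⟨⟨b, η⟩, he⟩, h2⟩ := h1
    simp only [Prod.mk.injEq] at h2
    obtain ⟨rfl, rfl, rfl⟩ := h2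
    have he' := he
    rw [paratangentBundle_eq] at he'
    exact ⟨he'.2, rfl⟩
  have hex : ∀ a ∈ X, ∃ Q : PolyLE n p,
      nablaFibre p f a = (paratangentFibre p X a).map (graphMap Q) := by
    intro a ha
    let L : paratangentFibre p X a →ₗ[ℝ] ℝ :=
      { toFun := fun ξ => g ⟨(a, ξ.1), hτ a ha ξ.1 ξ.2⟩
        map_add' := fun ξ η => by
          have h := Submodule.add_mem _ (hmem a ha ξ.1 ξ.2) (hmem a ha η.1 η.2)
          obtain ⟨_, h2⟩ := huniq a ha _ _ h
          exact h2.symm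
        map_smul' := fun t ξ => by
          have h := Submodule.smul_mem _ t (hmem a ha ξ.1 ξ.2)
          obtain ⟨_, h2⟩ := huniq a ha _ _ h
          exact h2.symm }
    obtain ⟨L', hL'⟩ := L.exists_extend
    have hQ : ∀ ξ : PolyDual n p, ξ ((Module.evalEquiv ℝ (PolyLE n p)).symm L') = L' ξ := fun ξ => by
      simp
    refine ⟨(Module.evalEquiv ℝ (PolyLE n p)).symm L', ?_⟩
    have hval : ∀ ξ (hξ : ξ ∈ paratangentFibre p X a), L' ξ = g ⟨(a, ξ), hτ a ha ξ hξ⟩ :=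
      fun ξ hξ => LinearMap.congr_fun hL' ⟨ξ, hξ⟩
    ext ⟨ξ, r⟩
    constructor
    · intro h
      obtain ⟨hξ, hr⟩ := huniq a ha ξ r h
      exact ⟨ξ, hξ, by rw [graphMap_apply, hQ, hval ξ hξ, hr]⟩
    · rintro ⟨η, hη, h⟩
      rw [graphMap_apply, hQ, hval η hη] at h
      rw [← h]
      exact hmem a ha η hη
  choose! Q hQ using hex
  exact ⟨Q, hQ⟩

theorem apply_eq_of_nablaFibre_eq {X : Set (Euc n)} {f : X → ℝ} {Q : Euc n → PolyLE n p}
    (hQ : ∀ a ∈ X, nablaFibre p f a = (paratangentFibre p X a).map (graphMap (Q a))) (a : X) :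
    polyFun (Q a).1 a = f a := by
  have h := graph_mem_nablaFibre p f a
  rw [hQ a a.2] at h
  obtain ⟨ξ, -, h⟩ := h
  rw [graphMap_apply, Prod.mk.injEq] at h
  rw [← h.2, h.1, deltaDual_apply]

theorem polyFun_add_comp {E : Type*} (φ : E → Euc n) (P R : PolyLE n p) :
    (fun x => polyFun (P + R).1 (φ x)) = fun x => polyFun P.1 (φ x) + polyFun R.1 (φ x) := by
  funext x; simp [polyFun]

theorem polyFun_smul_comp {E : Type*} (φ : E → Euc n) (t : ℝ) (P : PolyLE n p) :
    (fun x => polyFun (t • P).1 (φ x)) = fun x => t • polyFun P.1 (φ x) := by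
  funext x; simp [polyFun]

variable {E : Type*} [NormedAddCommGroup E] [NormedSpace ℝ E]

theorem contDiff_polyFun_comp {φ : E → Euc n} {N : WithTop ℕ∞} (hφ : ContDiff ℝ N φ)
    (P : MvPolynomial (Fin n) ℝ) : ContDiff ℝ N fun x => polyFun P (φ x) :=
  (contDiff_polyFun P).comp hφ

/-- The functional `P ↦ D^k(P ∘ φ)(y)(v)`. -/
noncomputable def jetDual {φ : E → Euc n} (hφ : ContDiff ℝ p φ) {k : ℕ} (hk : k ≤ p) (y : E)
    (v : Fin k → E) : PolyDual n p where
  toFun P := iteratedFDeriv ℝ k (fun x => polyFun P.1 (φ x)) y v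
  map_add' P R := by
    have hc := fun P : PolyLE n p => (contDiff_polyFun_comp
      (hφ.of_le (by exact_mod_cast hk : (k : WithTop ℕ∞) ≤ p)) P.1).contDiffAt (x := y)
    rw [polyFun_add_comp, fun_iteratedFDeriv_add_apply (hc P) (hc R)]
    rfl
  map_smul' t P := by
    have hc := fun P : PolyLE n p => (contDiff_polyFun_comp
      (hφ.of_le (by exact_mod_cast hk : (k : WithTop ℕ∞) ≤ p)) P.1).contDiffAt (x := y)
    rw [polyFun_smul_comp, iteratedFDeriv_const_smul_apply' (hc P)]
    rfl

theorem jetDual_apply {φ : E → Euc n} (hφ : ContDiff ℝ p φ) {k : ℕ} (hk : k ≤ p) (y : E)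
    (v : Fin k → E) (P : PolyLE n p) :
    jetDual hφ hk y v P = iteratedFDeriv ℝ k (fun x => polyFun P.1 (φ x)) y v := rfl

/-- The functional `P ↦ D^k T(b)(v)`, where `T` is the Taylor polynomial of `P ∘ φ` at `a`. -/
noncomputable def taylorJetDual {φ : E → Euc n} (hφ : ContDiff ℝ p φ) (k : ℕ) (a b : E)
    (v : Fin k → E) : PolyDual n p where
  toFun P := iteratedFDeriv ℝ k (taylorAt p (fun x => polyFun P.1 (φ x)) a) b v
  map_add' P R := by
    have hc := fun (j : ℕ) (hj : j ∈ Finset.range (p + 1)) (P : PolyLE n p) =>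
      (contDiff_polyFun_comp (hφ.of_le (by
        rw [Finset.mem_range] at hj
        exact_mod_cast (by omega) : (j : WithTop ℕ∞) ≤ p)) P.1).contDiffAt (x := a)
    have h : taylorAt p (fun x => polyFun (P + R).1 (φ x)) a =
        fun x => taylorAt p (fun x => polyFun P.1 (φ x)) a x +
          taylorAt p (fun x => polyFun R.1 (φ x)) a x := by
      funext x
      rw [taylorAt, taylorAt, taylorAt, ← Finset.sum_add_distrib]
      refine Finset.sum_congr rfl fun j hj => ?_
      rw [polyFun_add_comp, fun_iteratedFDeriv_add_apply (hc j hj P) (hc j hj R), smul_add]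
      rfl
    rw [h, fun_iteratedFDeriv_add_apply (contDiff_taylorAt p _ _).contDiffAt
      (contDiff_taylorAt p _ _).contDiffAt]
    rfl
  map_smul' t P := by
    have hc := fun (j : ℕ) (hj : j ∈ Finset.range (p + 1)) (P : PolyLE n p) =>
      (contDiff_polyFun_comp (hφ.of_le (by
        rw [Finset.mem_range] at hj
        exact_mod_cast (by omega) : (j : WithTop ℕ∞) ≤ p)) P.1).contDiffAt (x := a)
    have h : taylorAt p (fun x => polyFun (t • P).1 (φ x)) a =
        fun x => t • taylorAt p (fun x => polyFun P.1 (φ x)) a x := by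
      funext x
      rw [taylorAt, taylorAt, Finset.smul_sum]
      refine Finset.sum_congr rfl fun j hj => ?_
      rw [polyFun_smul_comp, iteratedFDeriv_const_smul_apply' (hc j hj P), smul_comm]
      rfl
    rw [h, iteratedFDeriv_const_smul_apply' (contDiff_taylorAt p _ _).contDiffAt]
    rfl

theorem tendsto_jetDual {φ : E → Euc n} (hφ : ContDiff ℝ p φ) {k : ℕ} (hk : k ≤ p) (v : Fin k → E)
    (y : E) : Tendsto (fun z => jetDual hφ hk z v) (𝓝 y) (𝓝 (jetDual hφ hk y v)) := by
  refine tendsto_polyDual_iff.2 fun P => ?_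
  have h : Continuous (iteratedFDeriv ℝ k fun x => polyFun P.1 (φ x)) :=
    (contDiff_polyFun_comp hφ P.1).continuous_iteratedFDeriv (by exact_mod_cast hk)
  exact (h.eval_const v).tendsto y

/-- Orders of vanishing add under multiplication, by Leibniz' rule. Derivatives beyond order p are
excluded since the factors are only C^p. -/
theorem iteratedFDeriv_prod_pow_eq_zero_of_vanish {ι : Type*} (s : ι → ℕ) (T : Finset ι)
    {g : ι → E → ℝ} {y : E} (hg : ∀ i, ContDiff ℝ p (g i)) (h0 : ∀ i, g i y = 0) {k : ℕ}
    (hk : k < ∑ i ∈ T, s i) (hkp : k ≤ p) :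
    iteratedFDeriv ℝ k (fun x => ∏ i ∈ T, g i x ^ s i) y = 0 := by
  classical
  have hmul : ∀ (u w : E → ℝ) (d e : ℕ), ContDiff ℝ p u → ContDiff ℝ p w →
      (∀ j < d, j ≤ p → iteratedFDeriv ℝ j u y = 0) →
      (∀ j < e, j ≤ p → iteratedFDeriv ℝ j w y = 0) → ∀ j < d + e, j ≤ p →
        iteratedFDeriv ℝ j (fun x => u x * w x) y = 0 := by
    intro u w d e hu hw hu0 hw0 j hj hjp
    have := norm_iteratedFDeriv_mul_le hu hw y (n := j) (by exact_mod_cast hjp)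
    rw [Finset.sum_eq_zero] at this
    · simpa using this
    · intro i hi
      rw [Finset.mem_range] at hi
      by_cases hd : i < d
      · rw [hu0 i hd (by omega)]; simp
      · rw [hw0 (j - i) (by omega) (by omega)]; simp
  have hpow : ∀ i m, ∀ j < m, j ≤ p → iteratedFDeriv ℝ j (fun x => g i x ^ m) y = 0 := by
    intro i m
    induction m with
    | zero => intro j hj; omega
    | succ m ih =>
      simp only [pow_succ]
      refine hmul _ _ m 1 ((hg i).pow m) (hg i) ih fun j hj _ => ?_
      obtain rfl : j = 0 := by omega
      rw [← norm_eq_zero, norm_iteratedFDeriv_zero, h0, norm_zero]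
  induction T using Finset.induction_on generalizing k with
  | empty => simp at hk
  | insert a T ha ih =>
    simp only [Finset.prod_insert ha]
    rw [Finset.sum_insert ha] at hk
    exact hmul _ _ _ _ ((hg a).pow _) (contDiff_prod fun i _ => (hg i).pow _) (hpow a (s a))
      (fun j hj hjp => ih hj hjp) k hk hkp

theorem polyFun_taylorMonomial (b : Euc n) (α : Fin n → ℕ) (x : Euc n) :
    polyFun (taylorMonomial b α) x = (miFact α : ℝ)⁻¹ • ∏ i, (x i - b i) ^ α i := by
  simp [polyFun, taylorMonomial]

theorem iteratedFDeriv_taylorMonomial_comp_eq_zero {φ : E → Euc n} (hφ : ContDiff ℝ p φ) {k : ℕ}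
    (hk : k ≤ p) (y : E) {α : Fin n → ℕ} (hα : k < miLen α) :
    iteratedFDeriv ℝ k (fun x => polyFun (taylorMonomial (φ y) α) (φ x)) y = 0 := by
  simp only [polyFun_taylorMonomial]
  have hg : ∀ i, ContDiff ℝ p fun x => φ x i - φ y i := fun i =>
    ((contDiff_piLp_apply 2).comp hφ).sub contDiff_const
  have hc : ContDiff ℝ p fun x => ∏ i, (φ x i - φ y i) ^ α i :=
    contDiff_prod fun i _ => (hg i).pow _
  rw [iteratedFDeriv_const_smul_apply' (hc.of_le (by exact_mod_cast hk)).contDiffAt,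
    iteratedFDeriv_prod_pow_eq_zero_of_vanish α Finset.univ hg (fun i => sub_self _) hα hk, smul_zero]

/-- The monomial is recentred at φ(y) as y moves. In a fixed basis of the polynomials only its
coefficients depend on the centre, and they do so continuously. -/
theorem continuous_iteratedFDeriv_taylorMonomial_comp {φ : E → Euc n} (hφ : ContDiff ℝ p φ) {k : ℕ}
    (hk : k ≤ p) {α : Fin n → ℕ} (hα : miLen α ≤ p) :
    Continuous fun y => iteratedFDeriv ℝ k (fun x => polyFun (taylorMonomial (φ y) α) (φ x)) y := by
  let β := Module.finBasis ℝ (PolyLE n p)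
  let R : Euc n → PolyLE n p := fun b => ⟨taylorMonomial b α, taylorMonomial_mem b hα⟩
  have hR : ∀ η : PolyDual n p, Continuous fun b => η (R b) := fun η =>
    continuous_iff_continuousAt.2 fun b => tendsto_dual_apply_of_pointwise (fun x => by
      have : Continuous fun b : Euc n => polyFun (R b).1 x := by
        simp only [R, polyFun_taylorMonomial]
        fun_prop
      exact this.tendsto b) η
  have h1 : ∀ y, iteratedFDeriv ℝ k (fun x => polyFun (taylorMonomial (φ y) α) (φ x)) y =
      ∑ j, β.coord j (R (φ y)) • iteratedFDeriv ℝ k (fun x => polyFun (β j).1 (φ x)) y := by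
    intro y
    have hc : ∀ j, ContDiff ℝ k fun x => polyFun (β j).1 (φ x) := fun j =>
      contDiff_polyFun_comp (hφ.of_le (by exact_mod_cast hk)) _
    have h2 : (fun x => polyFun (taylorMonomial (φ y) α) (φ x)) =
        fun x => ∑ j, β.coord j (R (φ y)) • polyFun (β j).1 (φ x) := by
      funext x
      have h3 := congrArg (fun P : PolyLE n p => deltaDual (φ x) P) (β.sum_repr (R (φ y)))
      simp only [map_sum, map_smul, deltaDual_apply] at h3
      exact h3.symm
    rw [h2, iteratedFDeriv_fun_sum_apply fun j _ => ((hc j).const_smul _).contDiffAt]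
    exact Finset.sum_congr rfl fun j _ => iteratedFDeriv_const_smul_apply' (hc j).contDiffAt
  simp only [h1]
  refine continuous_finsetSum _ fun j _ => ((hR (β.coord j)).comp hφ.continuous).smul ?_
  exact (contDiff_polyFun_comp hφ _).continuous_iteratedFDeriv (by exact_mod_cast hk)

/-- For |α| > k the coefficient is zero, because the monomial centred at φ(b) vanishes to order |α|
at b after composition. For |α| ≤ k it is locally bounded by a multiple of ∏ ‖v i‖, and |φ(a) -
φ(b)|^(p - |α|) is at most a constant times |b - a|^(p - k), as |b - a| < 1. -/
theorem exists_bound_dualCoeff_jetDual {φ : E → Euc n} (hφ : ContDiff ℝ p φ) {k : ℕ} (hk : k ≤ p)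
    (c : E) : ∃ C : ℝ, 0 ≤ C ∧ ∀ᶠ q : E × E in 𝓝 (c, c), ∀ (α : Fin n → ℕ) (hα : miLen α ≤ p)
      (v : Fin k → E), ‖φ q.1 - φ q.2‖ ^ (p - miLen α) *
        |dualCoeff (jetDual hφ hk q.2 v) (φ q.2) α hα| ≤ C * (‖q.2 - q.1‖ ^ (p - k) * ∏ i, ‖v i‖) := by
  obtain ⟨L, hL, hLip⟩ : ∃ L : ℝ, 1 ≤ L ∧ ∀ᶠ q : E × E in 𝓝 (c, c), p ≠ 0 →
      ‖φ q.1 - φ q.2‖ ≤ L * ‖q.2 - q.1‖ := by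
    -- For p = 0 the map φ need not be Lipschitz, but then all exponents are zero.
    by_cases hp : p = 0
    · exact ⟨1, le_rfl, Eventually.of_forall fun q h => absurd hp h⟩
    · obtain ⟨K, t, ht, hK⟩ := (hφ.of_le (m := 1) (by
        exact_mod_cast Nat.one_le_iff_ne_zero.2 hp)).contDiffAt.exists_lipschitzOnWith (x := c)
      refine ⟨max K 1, le_max_right _ _, ?_⟩
      filter_upwards [prod_mem_nhds ht ht] with q hq _
      have h1 := hK.dist_le_mul _ hq.1 _ hq.2
      rw [dist_eq_norm, dist_eq_norm, norm_sub_rev q.1] at h1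
      refine h1.trans ?_
      gcongr
      exact le_max_left _ _
  have hbd : ∀ α ∈ miLE n p, ∃ B : ℝ, 0 ≤ B ∧ ∀ᶠ y in 𝓝 c,
      ‖iteratedFDeriv ℝ k (fun x => polyFun (taylorMonomial (φ y) α) (φ x)) y‖ ≤ B := by
    intro α hα
    have h1 := (continuous_iteratedFDeriv_taylorMonomial_comp hφ hk (mem_miLE.1 hα)).norm
    refine ⟨‖iteratedFDeriv ℝ k (fun x => polyFun (taylorMonomial (φ c) α) (φ x)) c‖ + 1,
      by positivity, ?_⟩
    filter_upwards [h1.continuousAt.eventually (gt_mem_nhds (lt_add_one _))] with y hy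
    exact hy.le
  choose! B hB0 hB using hbd
  have hBall : ∀ᶠ y in 𝓝 c, ∀ α ∈ miLE n p,
      ‖iteratedFDeriv ℝ k (fun x => polyFun (taylorMonomial (φ y) α) (φ x)) y‖ ≤ B α :=
    (Finset.eventually_all _).2 hB
  have hsmall : ∀ᶠ q : E × E in 𝓝 (c, c), ‖q.2 - q.1‖ < 1 := by
    have h1 : Continuous fun q : E × E => ‖q.2 - q.1‖ := by fun_prop
    exact h1.continuousAt.eventually (gt_mem_nhds (by simp))
  have hSB : 0 ≤ ∑ α ∈ miLE n p, B α := Finset.sum_nonneg hB0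
  refine ⟨L ^ p * ∑ α ∈ miLE n p, B α, by positivity, ?_⟩
  filter_upwards [hLip, (continuous_snd.tendsto (c, c)).eventually hBall, hsmall] with q h1 h2 h3
    α hα v
  have hcoeff : |dualCoeff (jetDual hφ hk q.2 v) (φ q.2) α hα| ≤
      ‖iteratedFDeriv ℝ k (fun x => polyFun (taylorMonomial (φ q.2) α) (φ x)) q.2‖ * ∏ i, ‖v i‖ := by
    rw [dualCoeff_eq, jetDual_apply]
    exact (iteratedFDeriv ℝ k (fun x => polyFun (taylorMonomial (φ q.2) α) (φ x)) q.2).le_opNorm v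
  by_cases hαk : k < miLen α
  · rw [iteratedFDeriv_taylorMonomial_comp_eq_zero hφ hk q.2 hαk, norm_zero, zero_mul] at hcoeff
    rw [le_antisymm hcoeff (abs_nonneg _), mul_zero]
    positivity
  · rw [not_lt] at hαk
    have hBα : B α ≤ ∑ α ∈ miLE n p, B α := Finset.single_le_sum hB0 (mem_miLE.2 hα)
    have hpow : ‖φ q.1 - φ q.2‖ ^ (p - miLen α) ≤ L ^ p * ‖q.2 - q.1‖ ^ (p - k) := by
      rcases eq_or_ne p 0 with hp | hp
      · have e1 : p - miLen α = 0 := by omega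
        have e2 : p - k = 0 := by omega
        rw [e1, e2, hp]; simp
      · calc _ ≤ (L * ‖q.2 - q.1‖) ^ (p - miLen α) := by gcongr; exact h1 hp
          _ = L ^ (p - miLen α) * ‖q.2 - q.1‖ ^ (p - miLen α) := mul_pow _ _ _
          _ ≤ L ^ p * ‖q.2 - q.1‖ ^ (p - k) := by
            have e1 : L ^ (p - miLen α) ≤ L ^ p := pow_le_pow_right₀ hL (Nat.sub_le _ _)
            have e2 : ‖q.2 - q.1‖ ^ (p - miLen α) ≤ ‖q.2 - q.1‖ ^ (p - k) :=
              pow_le_pow_of_le_one (norm_nonneg _) h3.le (by omega)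
            gcongr
    have h4 := h2 α (mem_miLE.2 hα)
    calc _ ≤ (L ^ p * ‖q.2 - q.1‖ ^ (p - k)) * ((∑ α ∈ miLE n p, B α) * ∏ i, ‖v i‖) := by
          refine mul_le_mul hpow (hcoeff.trans ?_) (abs_nonneg _) (by positivity)
          have := h4.trans hBα
          gcongr
      _ = _ := by ring

/-- The jets of functions `P ∘ φ` along a set that is the closure of its interior are given by
elements of the paratangent bundle. -/
theorem jetDual_mem_paratangentFibre {X : Set (Euc n)} {φ : E → Euc n} (hφ : ContDiff ℝ p φ)
    {Y : Set E} (hY : Y ⊆ closure (interior Y)) (hφY : ∀ y ∈ Y, φ y ∈ X) {k : ℕ} (hk : k ≤ p)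
    {y : E} (hy : y ∈ Y) (v : Fin k → E) :
    jetDual hφ hk y v ∈ paratangentFibre p X (φ y) := by
  -- The jet of order k + 1 is the limit of difference quotients of jets of order k along the
  -- direction `v 0`. The summand at the moved point carries a factor 1/t, compensated in the bounds
  -- of ΔΦ by |t|^(p - k) ≤ |t|. Interior points are needed for the moved point to stay in Y.
  have hint : ∀ k (hk : k ≤ p), ∀ y ∈ interior Y, ∀ v : Fin k → E,
      jetDual hφ hk y v ∈ paratangentFibre p X (φ y) := by
    intro k
    induction k with
    | zero =>
      intro hk y hy v
      exact deltaDual_mem_paratangentFibre p (hφY y (interior_subset hy))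
    | succ k ih =>
      intro hk y hy v
      have hk' : k ≤ p := by omega
      rw [← glaeserFibre_paratangentFibre p (hφY y (interior_subset hy))]
      have hline : Tendsto (fun t : ℝ => y + t • v 0) (𝓝[≠] 0) (𝓝 y) := by
        have h1 : Continuous fun t : ℝ => y + t • v 0 := by fun_prop
        have h2 := (h1.tendsto 0).mono_left (nhdsWithin_le_nhds (s := {0}ᶜ))
        simpa using h2
      obtain ⟨C, hC, hbd⟩ := exists_bound_dualCoeff_jetDual hφ hk' y
      have hpair : Tendsto (fun t : ℝ => (y, y + t • v 0)) (𝓝[≠] 0) (𝓝 (y, y)) :=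
        tendsto_const_nhds.prodMk_nhds hline
      have hsmall : ∀ᶠ t : ℝ in 𝓝[≠] 0, |t| < 1 ∧ t ≠ 0 := by
        have h1 : ∀ᶠ t : ℝ in 𝓝 0, |t| < 1 := by
          have : Continuous fun t : ℝ => |t| := by fun_prop
          exact this.continuousAt.eventually (gt_mem_nhds (by simp))
        exact (h1.filter_mono nhdsWithin_le_nhds).and self_mem_nhdsWithin
      refine mem_glaeserFibre_of_tendsto (l := 𝓝[≠] (0 : ℝ)) (a := fun _ => φ y)
        (b := fun t => φ (y + t • v 0)) (v := fun t => -(t⁻¹ • jetDual hφ hk' y (Fin.tail v)))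
        (w := fun t => t⁻¹ • jetDual hφ hk' (y + t • v 0) (Fin.tail v))
        (hφY y (interior_subset hy)) (C * (‖v 0‖ ^ (p - k) * ∏ i, ‖Fin.tail v i‖)) ?_
        tendsto_const_nhds ((hφ.continuous.tendsto y).comp hline) ?_
      · filter_upwards [hpair.eventually hbd, hsmall,
          hline.eventually (isOpen_interior.mem_nhds hy)] with t h1 h2 h3
        refine ⟨hφY y (interior_subset hy), hφY _ (interior_subset h3),
          Submodule.neg_mem _ (Submodule.smul_mem _ _ (ih hk' y hy _)),
          Submodule.smul_mem _ _ (ih hk' _ h3 _), fun α hα => ?_⟩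
        have h4 := h1 α hα (Fin.tail v)
        have e : dualCoeff ((LinearMap.id : PolyDual n p →ₗ[ℝ] PolyDual n p) (t⁻¹ • jetDual hφ hk' (y + t • v 0) (Fin.tail v)))
            (φ (y + t • v 0)) α hα =
            t⁻¹ * dualCoeff (jetDual hφ hk' (y + t • v 0) (Fin.tail v)) (φ (y + t • v 0)) α hα := rfl
        rw [e, abs_mul, mul_left_comm, abs_inv, inv_mul_le_iff₀ (abs_pos.2 h2.2)]
        refine h4.trans ?_
        simp only [add_sub_cancel_left]
        rw [norm_smul, Real.norm_eq_abs, mul_pow]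
        have h5 : |t| ^ (p - k) ≤ |t| := by
          calc |t| ^ (p - k) ≤ |t| ^ 1 := pow_le_pow_of_le_one (abs_nonneg _) h2.1.le (by omega)
            _ = |t| := pow_one _
        have h6 : 0 ≤ ∏ i, ‖Fin.tail v i‖ := by positivity
        calc C * (|t| ^ (p - k) * ‖v 0‖ ^ (p - k) * ∏ i, ‖Fin.tail v i‖) ≤
              C * (|t| * ‖v 0‖ ^ (p - k) * ∏ i, ‖Fin.tail v i‖) := by gcongr
          _ = _ := by ring
      · refine tendsto_polyDual_iff.2 fun P => ?_
        set h : E → ℝ := fun x => polyFun P.1 (φ x) with hh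
        have hd : DifferentiableAt ℝ (iteratedFDeriv ℝ k h) y :=
          ((contDiff_polyFun_comp hφ P.1).differentiable_iteratedFDeriv
            (by exact_mod_cast (by omega : k < p))) y
        have h1 := (hd.hasFDerivAt.hasLineDerivAt (v 0)).tendsto_slope_zero
        have h2 := ((ContinuousMultilinearMap.apply ℝ (fun _ : Fin k => E) ℝ
          (Fin.tail v)).continuous.tendsto _).comp h1
        have e1 : jetDual hφ hk y v P = ContinuousMultilinearMap.apply ℝ (fun _ : Fin k => E) ℝ
            (Fin.tail v) (fderiv ℝ (iteratedFDeriv ℝ k h) y (v 0)) := by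
          rw [jetDual_apply, iteratedFDeriv_succ_apply_left]
          rfl
        rw [e1]
        refine h2.congr fun t => ?_
        simp only [Function.comp_apply]
        rw [LinearMap.add_apply, LinearMap.neg_apply, LinearMap.smul_apply, LinearMap.smul_apply,
          jetDual_apply, jetDual_apply]
        simp only [map_smul, map_sub, ContinuousMultilinearMap.apply_apply, smul_eq_mul]
        ring
  -- The remaining points of Y are limits of interior ones, along which the jets converge;
  -- saturation keeps the limit in the fibre.
  rw [← glaeserFibre_paratangentFibre p (hφY y hy)]
  have : (𝓝[interior Y] y).NeBot := mem_closure_iff_nhdsWithin_neBot.1 (hY hy)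
  refine mem_glaeserFibre_of_tendsto_mem (l := 𝓝[interior Y] y) (a := φ)
    (v := fun z => jetDual hφ hk z v) (hφY y hy) ?_
    ((hφ.continuous.tendsto y).mono_left nhdsWithin_le_nhds)
    ((tendsto_jetDual hφ hk v y).mono_left nhdsWithin_le_nhds)
  filter_upwards [self_mem_nhdsWithin] with z hz
  exact ⟨hφY z (interior_subset hz), hint k hk z hz v⟩

/-- The functional depends on P only through the jet of P ∘ φ at a, whose components belong to the
fibre over φ(a). So it kills every polynomial killed by that fibre. -/
theorem taylorJetDual_mem_paratangentFibre {X : Set (Euc n)} {φ : E → Euc n} (hφ : ContDiff ℝ p φ)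
    {Y : Set E} (hY : Y ⊆ closure (interior Y)) (hφY : ∀ y ∈ Y, φ y ∈ X) (k : ℕ)
    {a : E} (ha : a ∈ Y) (b : E) (v : Fin k → E) :
    taylorJetDual hφ k a b v ∈ paratangentFibre p X (φ a) := by
  refine Submodule.mem_of_forall_dual _ _ fun P hP => ?_
  have h0 : taylorAt p (fun x => polyFun P.1 (φ x)) a = 0 := by
    funext x
    rw [taylorAt]
    refine Finset.sum_eq_zero fun j hj => ?_
    have hj' : j ≤ p := by simpa [Nat.lt_succ_iff] using hj
    have := hP _ (jetDual_mem_paratangentFibre hφ hY hφY hj' ha fun _ => x - a)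
    rw [jetDual_apply] at this
    rw [smul_apply, this, smul_zero]
  change iteratedFDeriv ℝ k (taylorAt p (fun x => polyFun P.1 (φ x)) a) b v = 0
  rw [h0]
  simp

/-- If `∇^p f` is a function, then the polynomials representing it give, through `φ`, a Whitney
field on any set that is the closure of its interior. -/
theorem eventually_norm_iteratedFDeriv_sub_le_of_nabla {X : Set (Euc n)} {f : X → ℝ}
    {Q : Euc n → PolyLE n p}
    (hQ : ∀ a ∈ X, nablaFibre p f a = (paratangentFibre p X a).map (graphMap (Q a)))
    {φ : E → Euc n} (hφ : ContDiff ℝ p φ) {Y : Set E} (hY : Y ⊆ closure (interior Y))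
    (hφY : ∀ y ∈ Y, φ y ∈ X) {c : E} (hc : c ∈ Y) {ε : ℝ} (hε : 0 < ε) :
    ∀ᶠ q : E × E in 𝓝 (c, c), q.1 ∈ Y → q.2 ∈ Y → ∀ k ≤ p,
      ‖iteratedFDeriv ℝ k (fun x => taylorAt p (fun z => polyFun (Q (φ q.2)).1 (φ z)) q.2 x -
        taylorAt p (fun z => polyFun (Q (φ q.1)).1 (φ z)) q.1 x) q.2‖ ≤
        ε * ‖q.2 - q.1‖ ^ (p - k) := by
  set T : E → E → ℝ := fun a => taylorAt p (fun z => polyFun (Q (φ a)).1 (φ z)) a with hT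
  suffices h : ∀ k ∈ Finset.range (p + 1), ∀ᶠ q : E × E in 𝓝 (c, c), q.1 ∈ Y → q.2 ∈ Y →
      ‖iteratedFDeriv ℝ k (fun x => T q.2 x - T q.1 x) q.2‖ ≤ ε * ‖q.2 - q.1‖ ^ (p - k) by
    filter_upwards [(Finset.eventually_all _).2 h] with q hq h1 h2 k hk
    exact hq k (Finset.mem_range.2 (by omega)) h1 h2
  intro k hk
  have hkp : k ≤ p := by simpa [Nat.lt_succ_iff] using hk
  by_contra hcon
  rw [not_eventually, frequently_iff_neBot] at hcon
  set S : Set (E × E) := {q | ¬(q.1 ∈ Y → q.2 ∈ Y →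
      ‖iteratedFDeriv ℝ k (fun x => T q.2 x - T q.1 x) q.2‖ ≤ ε * ‖q.2 - q.1‖ ^ (p - k))} with hS
  -- At its own base point b, the Taylor polynomial has the k-th derivative of Q(φ(b)) ∘ φ.
  have hval : ∀ (a b : E) (v : Fin k → E),
      iteratedFDeriv ℝ k (fun x => T b x - T a x) b v =
        jetDual hφ hkp b v (Q (φ b)) - taylorJetDual hφ k a b v (Q (φ a)) := by
    intro a b v
    rw [fun_iteratedFDeriv_sub_apply (contDiff_taylorAt p _ _).contDiffAt
      (contDiff_taylorAt p _ _).contDiffAt,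
      iteratedFDeriv_taylorAt_self hkp (contDiff_polyFun_comp hφ _)]
    rfl
  have hex : ∀ q ∈ S, ∃ v : Fin k → E, q.1 ∈ Y ∧ q.2 ∈ Y ∧
      ε * ‖q.2 - q.1‖ ^ (p - k) * ∏ i, ‖v i‖ <
        |jetDual hφ hkp q.2 v (Q (φ q.2)) - taylorJetDual hφ k q.1 q.2 v (Q (φ q.1))| := by
    intro q hq
    simp only [hS, Set.mem_ofPred_eq] at hq
    push Not at hq
    obtain ⟨h1, h2, h3⟩ := hq
    by_contra hcon
    push Not at hcon
    refine absurd (ContinuousMultilinearMap.opNorm_le_bound (by positivity) fun v => ?_)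
      (not_le.2 h3)
    rw [hval]
    exact hcon v h1 h2
  choose! v hv using hex
  have hSl : ∀ᶠ q in 𝓝 (c, c) ⊓ 𝓟 S, q ∈ S := mem_inf_of_right (mem_principal_self S)
  have hle : 𝓝 (c, c) ⊓ 𝓟 S ≤ 𝓝 (c, c) := inf_le_left
  set D : E × E → ℝ := fun q =>
    jetDual hφ hkp q.2 (v q) (Q (φ q.2)) - taylorJetDual hφ k q.1 q.2 (v q) (Q (φ q.1)) with hD
  have hDpos : ∀ q ∈ S, 0 < |D q| := fun q hq =>
    lt_of_le_of_lt (by positivity) (hv q hq).2.2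
  obtain ⟨C, hC, hbd⟩ := exists_bound_dualCoeff_jetDual hφ hkp c
  have hlim1 : Tendsto (fun q : E × E => φ q.1) (𝓝 (c, c) ⊓ 𝓟 S) (𝓝 (φ c)) :=
    ((hφ.continuous.comp continuous_fst).tendsto (c, c)).mono_left hle
  have hlim2 : Tendsto (fun q : E × E => φ q.2) (𝓝 (c, c) ⊓ 𝓟 S) (𝓝 (φ c)) :=
    ((hφ.continuous.comp continuous_snd).tendsto (c, c)).mono_left hle
  -- The offending functionals are divided by their value `D` on the field Q. The jet at b takes the
  -- role of w, since its coefficients are controlled: by the lower bound for |D|, the constant is C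
  -- / ε. The functional over φ(a) takes the role of v, on which ΔΦ imposes no bound.
  have hmem : ((0, 1) : PolyDual n p × ℝ) ∈ nablaFibre p f (φ c) := by
    rw [← glaeserFibre_nablaFibre p f (hφY c hc)]
    refine mem_glaeserFibre_of_tendsto (a := fun q : E × E => φ q.1) (b := fun q : E × E => φ q.2)
      (v := fun q => -((D q)⁻¹ • graphMap (Q (φ q.1)) (taylorJetDual hφ k q.1 q.2 (v q))))
      (w := fun q => (D q)⁻¹ • graphMap (Q (φ q.2)) (jetDual hφ hkp q.2 (v q)))
      (hφY c hc) (C / ε) ?_ hlim1 hlim2 ?_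
    · filter_upwards [hSl, hle hbd] with q hq hbq
      obtain ⟨h1, h2, h3⟩ := hv q hq
      refine ⟨hφY _ h1, hφY _ h2, Submodule.neg_mem _ (Submodule.smul_mem _ _ ?_),
        Submodule.smul_mem _ _ ?_, fun α hα => ?_⟩
      · rw [hQ _ (hφY _ h1)]
        exact Submodule.mem_map_of_mem (taylorJetDual_mem_paratangentFibre hφ hY hφY k h1 _ _)
      · rw [hQ _ (hφY _ h2)]
        exact Submodule.mem_map_of_mem (jetDual_mem_paratangentFibre hφ hY hφY hkp h2 _)
      · have e : dualCoeff (LinearMap.fst ℝ (PolyDual n p) ℝ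
            ((D q)⁻¹ • graphMap (Q (φ q.2)) (jetDual hφ hkp q.2 (v q)))) (φ q.2) α hα =
            (D q)⁻¹ * dualCoeff (jetDual hφ hkp q.2 (v q)) (φ q.2) α hα := rfl
        rw [e, abs_mul, mul_left_comm, abs_inv, inv_mul_le_iff₀ (hDpos q hq)]
        refine (hbq α hα (v q)).trans ?_
        rw [mul_div_assoc', le_div_iff₀ hε, mul_comm |D q|, mul_assoc]
        refine mul_le_mul_of_nonneg_left ?_ hC
        rw [mul_comm, ← mul_assoc]
        exact h3.le
    · have hone : Tendsto (fun q => -((D q)⁻¹ • taylorJetDual hφ k q.1 q.2 (v q) (Q (φ q.1))) +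
          (D q)⁻¹ • jetDual hφ hkp q.2 (v q) (Q (φ q.2))) (𝓝 (c, c) ⊓ 𝓟 S) (𝓝 1) := by
        refine tendsto_const_nhds.congr' (hSl.mono fun q hq => ?_)
        have : D q ≠ 0 := abs_pos.1 (hDpos q hq)
        beta_reduce
        rw [smul_eq_mul, smul_eq_mul, ← sub_eq_neg_add, ← mul_sub]
        exact (inv_mul_cancel₀ this).symm
      -- On a fixed polynomial P the combination is the k-th derivative of the Taylor remainder of P
      -- ∘ φ, which is o(|b - a|^(p - k)) ∏ |v_i|, while |D| exceeds ε |b - a|^(p - k) ∏ |v_i|.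
      have hzero : Tendsto (fun q => -((D q)⁻¹ • taylorJetDual hφ k q.1 q.2 (v q)) +
          (D q)⁻¹ • jetDual hφ hkp q.2 (v q)) (𝓝 (c, c) ⊓ 𝓟 S) (𝓝 0) := by
        refine tendsto_polyDual_iff.2 fun P => ?_
        rw [LinearMap.zero_apply, Metric.tendsto_nhds]
        intro η hη
        filter_upwards [hSl, hle (eventually_norm_iteratedFDeriv_sub_taylorAt_le
          (contDiff_polyFun_comp hφ P.1) c (ε := η / 2 * ε) (by positivity))] with q hq hT
        have h1 := hT k hkp
        obtain ⟨-, -, h3⟩ := hv q hq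
        have e : (-((D q)⁻¹ • taylorJetDual hφ k q.1 q.2 (v q)) +
            (D q)⁻¹ • jetDual hφ hkp q.2 (v q)) P =
            (D q)⁻¹ * iteratedFDeriv ℝ k (fun x => polyFun P.1 (φ x) -
              taylorAt p (fun x => polyFun P.1 (φ x)) q.1 x) q.2 (v q) := by
          rw [fun_iteratedFDeriv_sub_apply (contDiff_polyFun_comp
            (hφ.of_le (by exact_mod_cast hkp)) _).contDiffAt (contDiff_taylorAt p _ _).contDiffAt,
            LinearMap.add_apply, LinearMap.neg_apply, LinearMap.smul_apply, LinearMap.smul_apply,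
            smul_eq_mul, smul_eq_mul, ← sub_eq_neg_add, ← mul_sub]
          rfl
        rw [dist_zero_right, e, norm_mul, norm_inv, Real.norm_eq_abs,
          inv_mul_lt_iff₀ (hDpos q hq)]
        have h4 := (ContinuousMultilinearMap.le_opNorm (iteratedFDeriv ℝ k (fun x =>
          polyFun P.1 (φ x) - taylorAt p (fun x => polyFun P.1 (φ x)) q.1 x) q.2) (v q))
        refine h4.trans_lt ?_
        have hDq : ε * ‖q.2 - q.1‖ ^ (p - k) * ∏ i, ‖v q i‖ < |D q| := h3
        calc _ ≤ η / 2 * ε * ‖q.2 - q.1‖ ^ (p - k) * ∏ i, ‖v q i‖ := by gcongr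
          _ = η / 2 * (ε * ‖q.2 - q.1‖ ^ (p - k) * ∏ i, ‖v q i‖) := by ring
          _ ≤ η / 2 * |D q| := by gcongr
          _ < |D q| * η := by linarith [mul_pos (hDpos q hq) hη]
      exact hzero.prodMk_nhds hone
  rw [hQ _ (hφY c hc)] at hmem
  obtain ⟨ξ, -, h⟩ := hmem
  rw [graphMap_apply, Prod.mk.injEq] at h
  rw [h.1, LinearMap.zero_apply] at h
  exact zero_ne_one h.2

theorem NablaIsFunction.exists_contDiff_comp [FiniteDimensional ℝ E] {X : Set (Euc n)} {f : X → ℝ}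
    (hf : NablaIsFunction p f) {φ : E → Euc n} (hφ : ContDiff ℝ p φ) {K : Set E} (hK : IsClosed K)
    (hKi : K ⊆ closure (interior K)) (hφK : ∀ y ∈ K, φ y ∈ X) :
    ∃ F : E → ℝ, ContDiff ℝ p F ∧ ∀ y (hy : y ∈ K), F y = f ⟨φ y, hφK y hy⟩ := by
  obtain ⟨Q, hQ⟩ := hf.exists_polynomial
  set T : E → E → ℝ := fun a => taylorAt p (fun z => polyFun (Q (φ a)).1 (φ z)) a with hT
  obtain ⟨F, hF, hFT⟩ := exists_contDiff_of_whitney hK (T := T)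
    (fun a _ => contDiff_taylorAt p _ a) (fun a _ x => iteratedFDeriv_taylorAt_of_lt
      (Nat.lt_succ_self p) _ a x) (fun c hc ε hε => by
        have h := eventually_norm_iteratedFDeriv_sub_le_of_nabla hQ hφ hKi hφK hc hε
        obtain ⟨δ, hδ, hδh⟩ := Metric.eventually_nhds_iff_ball.1 h
        exact ⟨δ, hδ, fun a ha b hb hac hbc k hk =>
          hδh (a, b) (by rw [← ball_prod_same]; exact ⟨hac, hbc⟩) ha hb k hk⟩)
  refine ⟨F, hF, fun y hy => ?_⟩
  rw [hFT y hy, ← apply_eq_of_nablaFibre_eq hQ]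
  have h1 := iteratedFDeriv_taylorAt_self (Nat.zero_le p)
    (contDiff_polyFun_comp hφ (Q (φ y)).1) y
  have h2 := congrArg (fun M => M (fun _ => 0)) h1
  simpa only [iteratedFDeriv_zero_apply] using h2

end Sufficiency

/-! ### Charts and gluing of local extensions -/

section Globalization

open scoped Manifold

variable {n p : ℕ}

/-- Being the restriction of a `𝒞^p` function is a local property. -/
theorem ExtendsCp.of_local {U X : Set (Euc n)} (hU : IsOpen U) (hXU : X ⊆ U)
    (hXc : IsClosed (Subtype.val ⁻¹' X : Set U)) {f : X → ℝ}
    (h : ∀ c ∈ X, ∃ V ∈ 𝓝 c, ∃ g : Euc n → ℝ, ContDiffOn ℝ p g V ∧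
      ∀ x (hx : x ∈ X), x ∈ V → g x = f ⟨x, hx⟩) : ExtendsCp p U f := by
  classical
  let O : TopologicalSpace.Opens (Euc n) := ⟨U, hU⟩
  have hlc : LocallyCompactSpace O := hU.locallyCompactSpace
  have hsc : SigmaCompactSpace O := sigmaCompactSpace_of_locallyCompact_secondCountable
  -- Prescribed value on X, no condition elsewhere: the sets are convex, so local solutions glue by
  -- a partition of unity on the manifold U.
  let t : O → Set ℝ := fun x => {y | ∀ hx : (x : Euc n) ∈ X, y = f ⟨x, hx⟩}
  have ht : ∀ x, Convex ℝ (t x) := by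
    intro x
    by_cases hx : (x : Euc n) ∈ X
    · have : t x = {f ⟨x, hx⟩} := by
        ext y; exact ⟨fun hy => hy hx, fun hy _ => hy⟩
      rw [this]
      exact convex_singleton _
    · have : t x = Set.univ := Set.eq_univ_of_forall fun y hx' => absurd hx' hx
      rw [this]
      exact convex_univ
  obtain ⟨g, hg⟩ := exists_contMDiffMap_forall_mem_convex_of_local (n := (p : ℕ∞)) 𝓘(ℝ, Euc n) ht
    (fun x => by
      by_cases hx : (x : Euc n) ∈ X
      · obtain ⟨V, hV, g, hg, hgf⟩ := h x hx
        refine ⟨Subtype.val ⁻¹' V, continuous_subtype_val.continuousAt.preimage_mem_nhds hV,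
          fun y => g y, ?_, fun y hy hyX => hgf y hyX hy⟩
        exact (contMDiffOn_iff_contDiffOn.2 hg).comp contMDiff_subtype_val.contMDiffOn
          fun y hy => hy
      · exact ⟨(Subtype.val ⁻¹' X)ᶜ, hXc.isOpen_compl.mem_nhds hx, fun _ => 0, contMDiffOn_const,
          fun y hy hyX => absurd hyX hy⟩)
  let F : Euc n → ℝ := fun x => if hx : x ∈ U then g ⟨x, hx⟩ else 0
  have hF : ∀ x : O, F x = g x := fun x => dif_pos x.2
  refine ⟨F, fun x hx => ?_, fun x => ?_⟩
  · have h1 : ContMDiffAt 𝓘(ℝ, Euc n) 𝓘(ℝ, ℝ) (p : ℕ∞) (fun y : O => F y) ⟨x, hx⟩ := by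
      simp only [hF]
      exact g.contMDiff _
    exact (contMDiffAt_iff_contDiffAt.1
      (contMDiffAt_subtype_iff (U := O) (x := ⟨x, hx⟩).1 h1)).contDiffWithinAt
  · rw [hF ⟨x, hXU x.2⟩]
    exact hg ⟨x, hXU x.2⟩ x.2

theorem IsClosureOfInteriorIn.exists_mem {X M : Set (Euc n)} (h : IsClosureOfInteriorIn X M)
    {x : Euc n} (hx : x ∈ X) {N : Set (Euc n)} (hN : IsOpen N) (hxN : x ∈ N) :
    ∃ z ∈ N, z ∈ M ∧ ∃ G, IsOpen G ∧ z ∈ G ∧ G ∩ M ⊆ X := by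
  have h1 : (⟨x, h.1 hx⟩ : M) ∈ closure (interior (Subtype.val ⁻¹' X : Set M)) :=
    h.2.subset hx
  obtain ⟨z, hzN, hz⟩ := mem_closure_iff.1 h1 _ (hN.preimage continuous_subtype_val) hxN
  obtain ⟨G', hG'X, hG', hzG'⟩ := mem_interior.1 hz
  obtain ⟨G, hG, rfl⟩ := isOpen_induced_iff.1 hG'
  exact ⟨z, hzN, z.2, G, hG, hzG', fun y hy => hG'X (show (⟨y, hy.2⟩ : M) ∈ _ from hy.1)⟩

theorem IsClosureOfInteriorIn.subset_closure_interior {X U : Set (Euc n)}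
    (h : IsClosureOfInteriorIn X U) (hU : IsOpen U) : X ⊆ closure (interior X) := by
  intro x hx
  refine mem_closure_iff.2 fun N hN hxN => ?_
  obtain ⟨z, hzN, hzU, G, hG, hzG, hGX⟩ := h.exists_mem hx hN hxN
  exact ⟨z, hzN, mem_interior.2 ⟨G ∩ U, hGX, hG.inter hU, hzG, hzU⟩⟩

variable {E : Type*} [NormedAddCommGroup E] [NormedSpace ℝ E]

/-- The chart identifies M locally with the range of `ι`, so points interior to X relative to M
become points of the interior of Y in E. -/
theorem IsClosureOfInteriorIn.chart_subset_closure_interior {U X M : Set (Euc n)} (hXU : X ⊆ U)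
    (hXM : IsClosureOfInteriorIn X M) {σ : OpenPartialHomeomorph (Euc n) (Euc n)}
    {ι : E →L[ℝ] Euc n} {π : Euc n →L[ℝ] E} (hπ : ∀ y, π (ι y) = y)
    (hσM : ∀ x ∈ σ.source, (x ∈ M ↔ σ x ∈ Set.range ι)) {Y : Set E}
    (hY : ∀ y, y ∈ Y ↔ ι y ∈ σ.target ∩ σ.symm ⁻¹' U ∧ σ.symm (ι y) ∈ X) :
    Y ⊆ closure (interior Y) := by
  intro y hy
  obtain ⟨hyO, hyX⟩ := (hY y).1 hy
  refine mem_closure_iff.2 fun N hN hyN => ?_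
  obtain ⟨z, ⟨hzσ, hzN⟩, hzM, G, hG, hzG, hGX⟩ := hXM.exists_mem hyX
    (σ.isOpen_inter_preimage (hN.preimage π.continuous)) ⟨σ.map_target hyO.1, by
      rw [Set.mem_preimage, Set.mem_preimage, σ.right_inv hyO.1, hπ]; exact hyN⟩
  obtain ⟨w, hw⟩ := (hσM z hzσ).1 hzM
  refine ⟨w, by rwa [Set.mem_preimage, Set.mem_preimage, ← hw, hπ] at hzN, mem_interior.2
    ⟨ι ⁻¹' (σ.target ∩ σ.symm ⁻¹' G), fun u hu => ?_,
      (σ.isOpen_inter_preimage_symm hG).preimage ι.continuous, ?_⟩⟩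
  · have huM : σ.symm (ι u) ∈ M := by
      rw [hσM _ (σ.map_target hu.1), σ.right_inv hu.1]
      exact ⟨u, rfl⟩
    have huX : σ.symm (ι u) ∈ X := hGX ⟨hu.2, huM⟩
    exact (hY u).2 ⟨⟨hu.1, hXU huX⟩, huX⟩
  · rw [Set.mem_preimage, hw]
    exact ⟨σ.map_source hzσ, by rwa [Set.mem_preimage, σ.left_inv hzσ]⟩

theorem NablaIsFunction.exists_local_extension_of_chart [FiniteDimensional ℝ E]
    {U X M : Set (Euc n)} (hU : IsOpen U) (hXU : X ⊆ U)
    (hXc : IsClosed (Subtype.val ⁻¹' X : Set U)) (hXM : IsClosureOfInteriorIn X M)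
    {f : X → ℝ} (hf : NablaIsFunction p f) {c : Euc n} (hc : c ∈ X)
    {σ : OpenPartialHomeomorph (Euc n) (Euc n)} (hcσ : c ∈ σ.source)
    (hσ : ContDiffOn ℝ p σ σ.source) (hσ' : ContDiffOn ℝ p σ.symm σ.target)
    {ι : E →L[ℝ] Euc n} {π : Euc n →L[ℝ] E} (hπ : ∀ y, π (ι y) = y)
    (hσM : ∀ x ∈ σ.source, (x ∈ M ↔ σ x ∈ Set.range ι)) :
    ∃ V ∈ 𝓝 c, ∃ g : Euc n → ℝ, ContDiffOn ℝ p g V ∧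
      ∀ x (hx : x ∈ X), x ∈ V → g x = f ⟨x, hx⟩ := by
  have hOo : IsOpen (σ.target ∩ σ.symm ⁻¹' U) := σ.isOpen_inter_preimage_symm hU
  have hcO : σ c ∈ σ.target ∩ σ.symm ⁻¹' U := ⟨σ.map_source hcσ, by
    rw [Set.mem_preimage, σ.left_inv hcσ]; exact hXU hc⟩
  obtain ⟨c', hc'⟩ := (hσM c hcσ).1 (hXM.1 hc)
  have hV : IsOpen (ι ⁻¹' (σ.target ∩ σ.symm ⁻¹' U)) := hOo.preimage ι.continuous
  obtain ⟨R, hR, hRV⟩ := Metric.nhds_basis_closedBall.mem_iff.1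
    (hV.mem_nhds (x := c') (by rwa [Set.mem_preimage, hc']))
  have hψ : ContDiffOn ℝ p (fun y => σ.symm (ι y)) (ι ⁻¹' (σ.target ∩ σ.symm ⁻¹' U)) :=
    hσ'.comp ι.contDiff.contDiffOn fun y hy => hy.1
  -- The inverse chart is cut off to a C^p map on all of E, unchanged on the closed ball of radius R
  -- / 2.
  obtain ⟨φ, hφ, hφσ⟩ := exists_contDiff_eqOn_closedBall hV hψ (half_pos hR) (half_lt_self hR) hRV
  obtain ⟨Y, hY⟩ : ∃ Y : Set E, ∀ y,
      y ∈ Y ↔ ι y ∈ σ.target ∩ σ.symm ⁻¹' U ∧ σ.symm (ι y) ∈ X := ⟨_, fun _ => Iff.rfl⟩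
  have hYi := hXM.chart_subset_closure_interior hXU hπ hσM hY
  -- Whitney's theorem needs a set closed in E on which φ is still the inverse chart; Y need not be
  -- such a set. Taking the closure of an open part of Y inside the ball also keeps K in the closure
  -- of its interior.
  obtain ⟨K, hK⟩ : ∃ K, K = closure (interior Y ∩ Metric.ball c' (R / 2)) := ⟨_, rfl⟩
  have hKc : IsClosed K := hK ▸ isClosed_closure
  have hKi : K ⊆ closure (interior K) := by
    rw [hK]
    exact closure_mono (interior_maximal subset_closure (isOpen_interior.inter Metric.isOpen_ball))
  have hKB : K ⊆ Metric.closedBall c' (R / 2) := by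
    rw [hK]
    exact closure_minimal (Set.inter_subset_right.trans Metric.ball_subset_closedBall)
      Metric.isClosed_closedBall
  have hφK : ∀ y ∈ K, φ y ∈ X := by
    intro y hy
    have hyO := hRV (Metric.closedBall_subset_closedBall (half_le_self hR.le) (hKB hy))
    -- The image of a limit point lies in a closed set whose trace on U is X, and also in U because
    -- of the choice of R; hence it lies in X.
    obtain ⟨C, hC, hCX⟩ := isClosed_induced_iff.1 hXc
    have hCX' : ∀ x ∈ U, (x ∈ C ↔ x ∈ X) := fun x hx => Set.ext_iff.1 hCX ⟨x, hx⟩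
    have hcl : φ y ∈ C := by
      refine hC.closure_subset (map_mem_closure hφ.continuous (hK ▸ hy) fun z hz => ?_)
      have hzY := (hY z).1 (interior_subset hz.1)
      rw [hφσ (Metric.ball_subset_closedBall hz.2), hCX' _ hzY.1.2]
      exact hzY.2
    rw [hφσ (hKB hy)] at hcl ⊢
    exact (hCX' _ hyO.2).1 hcl
  obtain ⟨F, hF, hFf⟩ := hf.exists_contDiff_comp hφ hKc hKi hφK
  have hcB : π (σ c) ∈ Metric.ball c' (R / 2) := by
    rw [← hc', hπ]
    exact Metric.mem_ball_self (half_pos hR)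
  refine ⟨σ.source ∩ σ ⁻¹' (π ⁻¹' Metric.ball c' (R / 2)),
    (σ.isOpen_inter_preimage (Metric.isOpen_ball.preimage π.continuous)).mem_nhds ⟨hcσ, hcB⟩,
    fun x => F (π (σ x)),
    (hF.comp π.contDiff).comp_contDiffOn (hσ.mono Set.inter_subset_left), fun x hx hxV => ?_⟩
  obtain ⟨y, hy⟩ := (hσM x hxV.1).1 (hXM.1 hx)
  have hxy : σ.symm (ι y) = x := by rw [hy, σ.left_inv hxV.1]
  have hyY : y ∈ Y := (hY y).2 ⟨⟨by rw [hy]; exact σ.map_source hxV.1, by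
    rw [Set.mem_preimage, hxy]; exact hXU hx⟩, by rw [hxy]; exact hx⟩
  have hyB : y ∈ Metric.ball c' (R / 2) := by
    have := hxV.2
    rwa [Set.mem_preimage, Set.mem_preimage, ← hy, hπ] at this
  have hyK : y ∈ K := by
    have := Metric.isOpen_ball.inter_closure (s := Metric.ball c' (R / 2)) (t := interior Y)
      ⟨hyB, hYi hyY⟩
    rwa [Set.inter_comm, ← hK] at this
  have e1 : π (σ x) = y := by rw [← hy, hπ]
  have e2 : φ y = x := by rw [hφσ (hKB hyK)]; exact hxy
  simp only [e1, hFf y hyK, e2]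

theorem NablaIsFunction.exists_local_extension {U X M : Set (Euc n)} (hU : IsOpen U) (hXU : X ⊆ U)
    (hXc : IsClosed (Subtype.val ⁻¹' X : Set U)) (hM : IsCpSubmanifold p M)
    (hXM : IsClosureOfInteriorIn X M) {f : X → ℝ} (hf : NablaIsFunction p f) {c : Euc n}
    (hc : c ∈ X) : ∃ V ∈ 𝓝 c, ∃ g : Euc n → ℝ, ContDiffOn ℝ p g V ∧
      ∀ x (hx : x ∈ X), x ∈ V → g x = f ⟨x, hx⟩ := by
  obtain ⟨m, -, σ, hcσ, hσ, hσ', hσM⟩ := hM c (hXM.1 hc)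
  let L : Submodule ℝ (Euc n) :=
    { carrier := {y | ∀ i : Fin n, m ≤ (i : ℕ) → y i = 0}
      add_mem' := fun {a b} ha hb i hi => by simp [ha i hi, hb i hi]
      zero_mem' := fun i _ => rfl
      smul_mem' := fun t a ha i hi => by simp [ha i hi] }
  obtain ⟨π, hπ⟩ := L.subtype.exists_leftInverse_of_injective L.ker_subtype
  refine hf.exists_local_extension_of_chart hU hXU hXc hXM hc hcσ hσ hσ' (ι := L.subtypeL)
    (π := LinearMap.toContinuousLinearMap π) (fun y => LinearMap.congr_fun hπ y) fun x hx => ?_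
  rw [hσM x hx]
  exact ⟨fun h => ⟨⟨σ x, h⟩, rfl⟩, fun ⟨y, hy⟩ => hy ▸ y.2⟩

end Globalization

/-! ### Sets that are the closure of their interior in U -/

section FullDimensional

variable {n p : ℕ}

/-- The two sides have the same jet at a, and the derivatives of order p + 1 of both vanish
identically. -/
theorem taylorAt_polyFun {P : MvPolynomial (Fin n) ℝ} (hP : P ∈ PolyLE n p) (a : Euc n) :
    taylorAt p (polyFun P) a = polyFun P := by
  have hT : ContDiff ℝ (p + 1 : ℕ) (taylorAt p (polyFun P) a) := contDiff_taylorAt _ _ _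
  have hPc : ContDiff ℝ (p + 1 : ℕ) (polyFun P) := contDiff_polyFun P
  have hsub : ∀ k ≤ p + 1, ∀ x, iteratedFDeriv ℝ k (fun x => taylorAt p (polyFun P) a x - polyFun P x) x =
      iteratedFDeriv ℝ k (taylorAt p (polyFun P) a) x - iteratedFDeriv ℝ k (polyFun P) x :=
    fun k hk x => fun_iteratedFDeriv_sub_apply (hT.of_le (by exact_mod_cast hk)).contDiffAt
      (hPc.of_le (by exact_mod_cast hk)).contDiffAt
  have := eq_zero_of_jet_eq_zero (hT.sub hPc) (fun x => by
      rw [hsub _ le_rfl, iteratedFDeriv_taylorAt_of_lt (Nat.lt_succ_self p),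
        iteratedFDeriv_polyFun_eq_zero hP (Nat.lt_succ_self p), sub_zero]) a (fun k hk => by
      rw [hsub _ (by omega), iteratedFDeriv_taylorAt_self hk (contDiff_polyFun P), sub_self])
  funext x
  exact sub_eq_zero.1 (congrFun this x)

/-- With φ = id, the fibre contains all jet functionals at a, and a polynomial of degree at most p
killed by them is zero. -/
theorem paratangentFibre_eq_top {X : Set (Euc n)} (hX : X ⊆ closure (interior X)) {a : Euc n}
    (ha : a ∈ X) : paratangentFibre p X a = ⊤ := by
  refine Submodule.eq_top_iff'.2 fun ξ => Submodule.mem_of_forall_dual _ _ fun P hP => ?_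
  have h0 : polyFun P.1 = 0 := by
    refine eq_zero_of_jet_eq_zero (p := p) (contDiff_polyFun P.1)
      (fun x => iteratedFDeriv_polyFun_eq_zero P.2 (Nat.lt_succ_self p) x) a fun k hk => ?_
    ext v
    exact hP _ (jetDual_mem_paratangentFibre contDiff_id hX (fun y hy => hy) hk ha v)
  have : P = 0 := Subtype.ext (polyFun_injective (h0.trans (by funext x; simp [polyFun])))
  rw [this, map_zero]

theorem paratangentBundle_eq_prod_univ {X : Set (Euc n)} (hX : X ⊆ closure (interior X)) :
    paratangentBundle p X = X ×ˢ (Set.univ : Set (PolyDual n p)) := by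
  rw [paratangentBundle_eq]
  ext ⟨a, ξ⟩
  simp only [bundleOf, Set.mem_ofPred_eq, Set.mem_prod, Set.mem_univ, and_true]
  refine ⟨fun h => h.1, fun h => ⟨h, ?_⟩⟩
  rw [paratangentFibre_eq_top hX h]
  trivial

/-- The sum in the remainder is the exact Taylor expansion at a of the α-th derivative of Q(a),
which has degree at most p - |α|. -/
theorem whitneyRemainder_polyDeriv {X : Set (Euc n)} {Q : Euc n → PolyLE n p} {α : Fin n → ℕ}
    (a b : X) : whitneyRemainder p (fun α x => polyFun (polyDeriv α (Q x).1) x) α a b =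
      polyFun (polyDeriv α ((Q b).1 - (Q a).1)) b := by
  have h := polyFun_eq_sum_taylor (polyDeriv_mem α (Q a).2) (a : Euc n) b
  simp only [polyDeriv_polyDeriv] at h
  rw [whitneyRemainder, ← h, map_sub]
  simp [polyFun]

theorem NablaIsFunction.exists_isWhitneyField {X : Set (Euc n)} (hX : X ⊆ closure (interior X))
    {f : X → ℝ} (hf : NablaIsFunction p f) :
    ∃ F : (Fin n → ℕ) → X → ℝ, IsWhitneyField p F ∧ ∀ x : X, F 0 x = f x := by
  obtain ⟨Q, hQ⟩ := hf.exists_polynomial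
  refine ⟨fun α x => polyFun (polyDeriv α (Q x).1) x, fun α hα c => ?_, fun x => ?_⟩
  · rw [Metric.tendsto_nhds]
    intro ε hε
    have h := eventually_norm_iteratedFDeriv_sub_le_of_nabla hQ contDiff_id hX (fun y hy => hy)
      c.2 (half_pos hε)
    have hc : Tendsto (fun q : X × X => ((q.1 : Euc n), (q.2 : Euc n))) (𝓝 (c, c))
        (𝓝 ((c : Euc n), (c : Euc n))) := by
      have : Continuous fun q : X × X => ((q.1 : Euc n), (q.2 : Euc n)) := by fun_prop
      exact this.tendsto (c, c)
    filter_upwards [(hc.mono_left nhdsWithin_le_nhds).eventually h, self_mem_nhdsWithin]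
      with q hq hne
    have hpos : 0 < ‖(q.2 : Euc n) - q.1‖ :=
      norm_pos_iff.2 (sub_ne_zero.2 fun h => hne (Subtype.ext h.symm))
    have h1 := hq q.1.2 q.2.2 _ hα
    -- For φ = id the polynomials Q are their own Taylor polynomials, so the general estimate speaks
    -- of Q(b) - Q(a).
    have e : (fun x => taylorAt p (fun z => polyFun (Q (id (q.2 : Euc n))).1 (id z)) q.2 x -
        taylorAt p (fun z => polyFun (Q (id (q.1 : Euc n))).1 (id z)) q.1 x) =
        polyFun ((Q q.2).1 - (Q q.1).1) := by
      funext x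
      have e1 := congrFun (taylorAt_polyFun (Q q.2).2 (q.2 : Euc n)) x
      have e2 := congrFun (taylorAt_polyFun (Q q.1).2 (q.1 : Euc n)) x
      refine (congrArg₂ (· - ·) e1 e2).trans ?_
      simp [polyFun]
    rw [e] at h1
    rw [dist_zero_right, whitneyRemainder_polyDeriv, norm_div, norm_pow, norm_norm,
      div_lt_iff₀ (pow_pos hpos _)]
    calc _ ≤ ε / 2 * ‖(q.2 : Euc n) - q.1‖ ^ (p - miLen α) :=
          (abs_polyFun_polyDeriv_le _ _ _).trans h1
      _ < _ := mul_lt_mul_of_pos_right (half_lt_self hε) (pow_pos hpos _)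
  · simp only [polyDeriv_zero]
    exact apply_eq_of_nablaFibre_eq hQ x

end FullDimensional

/-! ### The theorem -/

theorem theorem1p2 (n p : ℕ) (U X : Set (Euc n)) (hU : IsOpen U) (hXU : X ⊆ U)
    (hXclosed : IsClosed (Subtype.val ⁻¹' X : Set U)) :
    (∀ M : Set (Euc n), IsCpSubmanifold p M → IsClosureOfInteriorIn X M →
      ∀ f : X → ℝ, ExtendsCp p U f ↔ NablaIsFunction p f) ∧
    (IsClosureOfInteriorIn X U →
      paratangentBundle p X = X ×ˢ (Set.univ : Set (PolyDual n p)) ∧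
      ∀ f : X → ℝ, NablaIsFunction p f →
        ∃ F : (Fin n → ℕ) → X → ℝ, IsWhitneyField p F ∧ ∀ x : X, F 0 x = f x) := by
  refine ⟨fun M hM hXM f => ⟨fun h => h.nablaIsFunction hU hXU, fun h => ?_⟩, fun hX => ?_⟩
  · exact ExtendsCp.of_local hU hXU hXclosed fun c hc =>
      h.exists_local_extension hU hXU hXclosed hM hXM hc
  · have hXi := hX.subset_closure_interior hU
    exact ⟨paratangentBundle_eq_prod_univ hXi, fun f hf => hf.exists_isWhitneyField hXi⟩
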